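/- **Theorem 5.1.** Let $\tfrac12<H<1$, $\alpha\in(1-H,\tfrac12)$ and $T>0$. For a measurable $f:[0,1]\to\mathbb R$ put $$\|f\|_{\alpha,\infty}=\sup_{\xi\in[0,1]}\Big(|f(\xi)|+\int_0^\xi\frac{|f(\xi)-f(\eta)|}{(\xi-\eta)^{\alpha+1}}\,d\eta\Big),$$ let $W^{\alpha,\infty}[0,1]$ be the space of measurable $f$ with $\|f\|_{\alpha,\infty}<\infty$, and let $E_T$ be the space of measurable $f:[0,T]\times[0,1]\to\mathbb R$ with $\|f\|_{E_T}=\sup_{t\in[0,T]}\|f(t,\cdot)\|_{\alpha,\infty}<\infty$. Let $(\Omega,\mathcal F,P)$ be a probability space and let $B^H=\{B^H(t,\xi):t\in[0,T],\ \xi\in[0,1]\}$ be a jointly measurable real random field such that, for every $t\in[0,T]$, $B^H(t,\cdot)$ is a fractional Brownian motion with Hurst parameter $H$, i.e. a centered Gaussian process with $$E[B^H(t,\gamma)B^H(t,\eta)]=\tfrac12\big(\eta^{2H}+\gamma^{2H}-|\eta-\gamma|^{2H}\big),$$ and such that almost surely $\xi\mapsto B^H(t,\xi)$ is continuous for all $t$.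 Let $\phi\in W^{\alpha,\infty}[0,1]$ and let $A:\mathbb R\to\mathbb R$ be differentiable, globally Lipschitz and bounded, with $A'$ Lipschitz on every interval $[-N,N]$. For $a<b$ the generalized Stieltjes integral of order $\alpha$ is $$\int_a^b f\,dg=(-1)^\alpha\int_a^b D^\alpha_{a+}f_{a+}(x)\,D^{1-\alpha}_{b-}g_{b-}(x)\,dx+f(a+)\,[g(b-)-g(a+)],$$ where $f_{a+}=(f-f(a+))1_{(a,b)}$, $g_{b-}=(g-g(b-))1_{(a,b)}$, and, on $(a,b)$, $$D^{\beta}_{a+}f(x)=\frac1{\Gamma(1-\beta)}\Big(\frac{f(x)}{(x-a)^\beta}+\beta\int_a^x\frac{f(x)-f(y)}{(x-y)^{\beta+1}}dy\Big),\quad D^{\beta}_{b-}g(x)=\frac{(-1)^\beta}{\Gamma(1-\beta)}\Big(\frac{g(x)}{(b-x)^\beta}+\beta\int_x^b\frac{g(x)-g(y)}{(y-x)^{\beta+1}}dy\Big),$$ with $(-1)^\beta=e^{i\pi\beta}$. It is said to exist if $f(a+),g(a+),g(b-)$ exist and $f_{a+}\in I^\alpha_{a+}(L^p(a,b))$, $g_{b-}\in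 I^{1-\alpha}_{b-}(L^q(a,b))$ (images under the Riemann–Liouville fractional integrals) for some $p,q\in[1,\infty)$ with $\frac1p+\frac1q\le1$. An integral over $[0,0]$ is $0$. Call $y\in E_T$ a solution driven by $g:[0,T]\times[0,1]\to\mathbb R$ if for almost every $s\in[0,T]$ the integral $\int_0^\xi A(y(s,\eta))\,dg(s,\eta)$ exists for all $\xi\in(0,1]$, for each $\xi\in[0,1]$ it is an integrable function of $s\in[0,T]$, and $$y(t,\xi)=\phi(\xi)+\int_0^t\int_0^\xi A(y(s,\eta))\,dg(s,\eta)\,ds\qquad\text{for all }t\in[0,T],\ \xi\in[0,1].$$ Then there is a stochastic process $Y\in L^0(\Omega;E_T)$ (a jointly measurable random field with trajectories almost surely in $E_T$, which is almost surely the limit in $E_T$ of simple $E_T$-valued random variables) such that almost surely $Y$ is a solution driven by $B^H$. Almost surely $t\mapsto Y(t,\cdot)$ is continuous from $[0,T]$ to $W^{\alpha,\infty}[0,1]$, and for every $\xi\in[0,1]$ and almost every $t\in[0,T]$, $$\frac{\partial Y(t,\xi)}{\partial t}=\int_0^\xi A(Y(t,\eta))\,dB^H(t,\eta),\qquad Y(0,\xi)=\phi(\xi).$$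 The process is unique: if $Z$ is any family of functions $Z(\omega)$, $\omega\in\Omega$, which almost surely belong to $E_T$ and are solutions driven by $B^H$, then almost surely $Z(t,\xi)=Y(t,\xi)$ for all $t\in[0,T]$, $\xi\in[0,1]$. -/

import Mathlib

open MeasureTheory ProbabilityTheory Filter Topology Set
open scoped ENNReal

noncomputable section

namespace FracEq

/-! ### Function spaces -/

/-- The norm of `W^{α,∞}[0,1]`, with values in `[0,∞]`:
`sup_{ξ ∈ [0,1]} ( |f ξ| + ∫_0^ξ |f ξ - f η| / (ξ - η)^{α+1} dη )`. -/
def normW (α : ℝ) (f : ℝ → ℝ) : ℝ≥0∞ :=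
  ⨆ ξ ∈ Icc (0 : ℝ) 1, (ENNReal.ofReal |f ξ| +
    ∫⁻ η in Ioo 0 ξ, ENNReal.ofReal (|f ξ - f η| / (ξ - η) ^ (α + 1)))

/-- `f ∈ W^{α,∞}[0,1]`; only the values of `f` on `[0,1]` matter. -/
def MemW (α : ℝ) (f : ℝ → ℝ) : Prop :=
  Measurable (fun ξ : Icc (0 : ℝ) 1 => f ξ) ∧ normW α f < ⊤

/-- `sup_{t ∈ [0,T]} ‖f(t,·)‖_{W^{α,∞}[0,1]}`, with values in `[0,∞]`. -/
def normCW (T α : ℝ) (f : ℝ → ℝ → ℝ) : ℝ≥0∞ :=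
  ⨆ t ∈ Icc (0 : ℝ) T, normW α (f t)

/-- The space of measurable functions `f : [0,T] × [0,1] → ℝ` with
`sup_{t ∈ [0,T]} ‖f(t,·)‖_{W^{α,∞}} < ∞`; only values on `[0,T] × [0,1]` matter. -/
def MemCW (T α : ℝ) (f : ℝ → ℝ → ℝ) : Prop :=
  Measurable (fun p : Icc (0 : ℝ) T × Icc (0 : ℝ) 1 => f p.1 p.2) ∧ normCW T α f < ⊤

/-- `t ↦ f(t,·)` is continuous from `[0,T]` to `W^{α,∞}[0,1]` with its norm. -/
def ContinuousInW (T α : ℝ) (f : ℝ → ℝ → ℝ) : Prop :=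
  ∀ t ∈ Icc (0 : ℝ) T,
    Tendsto (fun s => normW α (fun ξ => f s ξ - f t ξ)) (𝓝[Icc 0 T] t) (𝓝 0)

/-! ### Fractional integrals and derivatives, generalized Stieltjes integral

The right-sided operators are written without their constant phases `(-1)^{∓α}`. In the generalized
Stieltjes integral of order `α` these phases only enter through
`(-1)^α (-1)^{1-α} = e^{iπα} e^{iπ(1-α)} = -1`, which is the sign in `stieltjes` below. -/

/-- Left-sided Riemann–Liouville integral `I^α_{a+} f`. -/
def rlLeft (α a : ℝ) (f : ℝ → ℝ) (x : ℝ) : ℝ :=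
  1 / Real.Gamma α * ∫ y in a..x, f y / (x - y) ^ (1 - α)

/-- Right-sided Riemann–Liouville integral `I^α_{b-} f`, without the phase. -/
def rlRight (α b : ℝ) (f : ℝ → ℝ) (x : ℝ) : ℝ :=
  1 / Real.Gamma α * ∫ y in x..b, f y / (y - x) ^ (1 - α)

/-- `f ∈ I^α_{a+}(L^p(a,b))`. -/
def MemRlLeft (α p a b : ℝ) (f : ℝ → ℝ) : Prop :=
  ∃ ψ : ℝ → ℝ, MemLp ψ (ENNReal.ofReal p) (volume.restrict (Ioo a b)) ∧
    ∀ᵐ x ∂(volume.restrict (Ioo a b)), f x = rlLeft α a ψ x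

/-- `f ∈ I^α_{b-}(L^p(a,b))`. -/
def MemRlRight (α p a b : ℝ) (f : ℝ → ℝ) : Prop :=
  ∃ ψ : ℝ → ℝ, MemLp ψ (ENNReal.ofReal p) (volume.restrict (Ioo a b)) ∧
    ∀ᵐ x ∂(volume.restrict (Ioo a b)), f x = rlRight α b ψ x

/-- Left-sided Weyl derivative `D^α_{a+} f` on `(a,b)`. -/
def weylLeft (α a b : ℝ) (f : ℝ → ℝ) : ℝ → ℝ :=
  (Ioo a b).indicator fun x => 1 / Real.Gamma (1 - α) *
    (f x / (x - a) ^ α + α * ∫ y in a..x, (f x - f y) / (x - y) ^ (α + 1))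

/-- Right-sided Weyl derivative `D^α_{b-} f` on `(a,b)`, without the phase. -/
def weylRight (α a b : ℝ) (f : ℝ → ℝ) : ℝ → ℝ :=
  (Ioo a b).indicator fun x => 1 / Real.Gamma (1 - α) *
    (f x / (b - x) ^ α + α * ∫ y in x..b, (f x - f y) / (y - x) ^ (α + 1))

/-- The right limit `f(a+)`. -/
def limR (f : ℝ → ℝ) (a : ℝ) : ℝ := limUnder (𝓝[>] a) f

/-- The left limit `f(b-)`. -/
def limL (f : ℝ → ℝ) (b : ℝ) : ℝ := limUnder (𝓝[<] b) f

/-- `f_{a+} = (f - f(a+)) 1_{(a,b)}`. -/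
def centerLeft (a b : ℝ) (f : ℝ → ℝ) : ℝ → ℝ := (Ioo a b).indicator fun x => f x - limR f a

/-- `g_{b-} = (g - g(b-)) 1_{(a,b)}`. -/
def centerRight (a b : ℝ) (g : ℝ → ℝ) : ℝ → ℝ := (Ioo a b).indicator fun x => g x - limL g b

/-- The conditions under which the generalized Stieltjes integral `∫_a^b f dg` of order `α` is
defined (for `a < b`). -/
def StieltjesIntegrable (α : ℝ) (f g : ℝ → ℝ) (a b : ℝ) : Prop :=
  (∃ l, Tendsto f (𝓝[>] a) (𝓝 l)) ∧ (∃ l, Tendsto g (𝓝[>] a) (𝓝 l)) ∧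
  (∃ l, Tendsto g (𝓝[<] b) (𝓝 l)) ∧
  ∃ p q : ℝ, 1 ≤ p ∧ 1 ≤ q ∧ 1 / p + 1 / q ≤ 1 ∧
    MemRlLeft α p a b (centerLeft a b f) ∧ MemRlRight (1 - α) q a b (centerRight a b g)

/-- The generalized Stieltjes integral `∫_a^b f dg` of order `α`; it is `0` for `a = b`. -/
def stieltjes (α : ℝ) (f g : ℝ → ℝ) (a b : ℝ) : ℝ :=
  if a < b then
    -(∫ x in a..b, weylLeft α a b (centerLeft a b f) x *
        weylRight (1 - α) a b (centerRight a b g) x) + limR f a * (limL g b - limR g a)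
  else 0

/-! ### The equation driven by a deterministic path -/

/-- `y` solves `y(t,ξ) = φ(ξ) + ∫_0^t ∫_0^ξ A(y(s,η)) dg(s,η) ds` on `[0,T] × [0,1]`: the inner
integral exists as a generalized Stieltjes integral for almost every time and is an integrable
function of time, and the equation holds at every `(t,ξ)`. -/
structure IsSolution (T α : ℝ) (A φ : ℝ → ℝ) (g y : ℝ → ℝ → ℝ) : Prop where
  exists_inner : ∀ᵐ s ∂(volume.restrict (Icc 0 T)), ∀ ξ ∈ Ioc (0 : ℝ) 1,
    StieltjesIntegrable α (fun η => A (y s η)) (g s) 0 ξ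
  integrable : ∀ ξ ∈ Icc (0 : ℝ) 1,
    IntervalIntegrable (fun s => stieltjes α (fun η => A (y s η)) (g s) 0 ξ) volume 0 T
  eqn : ∀ t ∈ Icc (0 : ℝ) T, ∀ ξ ∈ Icc (0 : ℝ) 1,
    y t ξ = φ ξ + ∫ s in (0 : ℝ)..t, stieltjes α (fun η => A (y s η)) (g s) 0 ξ

/-! ### Stochastic objects -/

/-- `X` is a fractional Brownian motion on `[0,1]` with Hurst parameter `H`: a centered Gaussian
process with the fractional covariance function. -/
structure IsFBM {Ω : Type*} [MeasurableSpace Ω] (H : ℝ) (X : Icc (0 : ℝ) 1 → Ω → ℝ)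
    (P : Measure Ω) : Prop where
  gaussian : IsGaussianProcess X P
  centered : ∀ ξ, ∫ ω, X ξ ω ∂P = 0
  covariance : ∀ γ η : Icc (0 : ℝ) 1, ∫ ω, X γ ω * X η ω ∂P =
    1 / 2 * ((η : ℝ) ^ (2 * H) + (γ : ℝ) ^ (2 * H) - |(η : ℝ) - γ| ^ (2 * H))

/-- The driving noise `B(t,ξ)`, `t ∈ [0,T]`, `ξ ∈ [0,1]`: a measurable random field such that
`B(t,·)` is a fractional Brownian motion for every `t`, with sample paths continuous in `ξ`.
Nothing is assumed about the joint law for different times, nor about regularity in time. -/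
structure IsFBMField {Ω : Type*} [MeasurableSpace Ω] (T H : ℝ) (B : Ω → ℝ → ℝ → ℝ)
    (P : Measure Ω) : Prop where
  measurable : Measurable (fun p : Ω × Icc (0 : ℝ) T × Icc (0 : ℝ) 1 => B p.1 p.2.1 p.2.2)
  fbm : ∀ t ∈ Icc (0 : ℝ) T, IsFBM H (fun ξ ω => B ω t ξ) P
  continuous : ∀ᵐ ω ∂P, ∀ t ∈ Icc (0 : ℝ) T, ContinuousOn (B ω t) (Icc 0 1)

/-- `Y ∈ L⁰(Ω; E)` for the space `E` of `MemCW T α` with the norm `normCW T α`: `Y` is a measurable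
random field on `[0,T] × [0,1]`, its trajectories are almost surely in `E`, and it is strongly
measurable as an `E`-valued map, i.e. almost surely the limit in `E` of measurable maps
`Ω → E` with finitely many values. -/
structure MemL0 {Ω : Type*} [MeasurableSpace Ω] (T α : ℝ) (Y : Ω → ℝ → ℝ → ℝ)
    (P : Measure Ω) : Prop where
  measurable : Measurable (fun p : Ω × Icc (0 : ℝ) T × Icc (0 : ℝ) 1 => Y p.1 p.2.1 p.2.2)
  paths : ∀ᵐ ω ∂P, MemCW T α (Y ω)
  approx : ∃ S : ℕ → Ω → ℝ → ℝ → ℝ,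
    (∀ n, (range (S n)).Finite ∧ (∀ f, MeasurableSet (S n ⁻¹' {f})) ∧ ∀ ω, MemCW T α (S n ω)) ∧
    ∀ᵐ ω ∂P, Tendsto (fun n => normCW T α (fun t ξ => S n ω t ξ - Y ω t ξ)) atTop (𝓝 0)

end FracEq

end

/-! The argument is pathwise: a fixed point in weighted `W^{α,∞}` norms, preceded by a
Kolmogorov-type estimate that is integrated over time.

For `f` bounded in `W^{α,∞}` and `g` Hölder of exponent `β > 1 - α`, the left Weyl derivative of
order `α` is bounded by a constant plus a multiple of `(x - a)^(-α)`, while the right derivative of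
order `1 - α` of `g` is bounded by a multiple of its Hölder constant `Λ`. Pairing `L¹` with `L^∞`
gives `|∫_a^b f dg| ≤ c C Λ (b - a)^(1 - α)` (`abs_stieltjes_le`). For the existence of the integral
one needs that a function is the fractional integral of its Weyl derivative
(`HasBddMarchaud.ae_eq_rlLeft_weylLeft`); `α < 1/2` makes `p = q = 2` admissible. Additivity over
intervals and measurability in parameters are not visible from the definition. They come from
writing the integral as a limit of ordinary integrals against difference quotients of `g`
(`tendsto_integral_diffQuot`): against a Steklov average of `g`, fractional integration by parts
undoes the two derivatives. Hence `ξ ↦ ∫_0^ξ f dg` is Hölder of exponent `1 - α > α` and lies again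
in `W^{α,∞}`.

Composition with `A` has affine growth in `W^{α,∞}` and is locally Lipschitz there
(`BddW.comp_sub`). The Hölder constant `Λ(s)` is only integrable in time, and that suffices: some
weight `e^{λt}` makes integration against `Λ` as small as desired (`exists_exp_weight`). Affine
growth then bounds all Picard iterates, a second weight makes the increments decay geometrically
(`picardLim_spec`), and the same contraction gives uniqueness (`eq_of_solutions`).

Nothing is known about the noise across different times, so Hölder bounds cannot be asked at all
times at once. The expected sum of weighted dyadic increments of `B(t,·)` is finite and the same for
every `t`. By Fubini this sum is almost surely integrable in time, and it controls the Hölder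
constant by chaining. Almost every path therefore agrees, for almost every time, with a driver to
which the deterministic theory applies (`IsFBMField.exists_driver`), and the equation does not see
null sets of times.

For strong measurability in `E_T`, the solution minus its initial value is jointly continuous and
`(1 - α)`-Hölder in space uniformly in time. Such functions form a separable set for a weaker Hölder
norm still stronger than that of `W^{α,∞}`, so measurable selection of a nearest point among
finitely many candidates gives simple approximants (`exists_simple_approx`). The time derivative is
Lebesgue differentiation of the equation. -/

noncomputable section

namespace FracEq

/-! ### Power kernels -/

/-- The kernel `r ^ (α - 1)` cut off to `(0, L)`. -/
def powKernel (α L : ℝ) : ℝ → ℝ := (Ioo 0 L).indicator fun r => r ^ (α - 1)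

lemma integrable_powKernel {α : ℝ} (hα : 0 < α) (L : ℝ) : Integrable (powKernel α L) := by
  unfold powKernel
  rw [integrable_indicator_iff measurableSet_Ioo]
  rcases le_or_gt L 0 with hL | hL
  · simp [Ioo_eq_empty_of_le hL]
  · exact (intervalIntegral.integrableOn_Ioo_rpow_iff hL).2 (by linarith)

/-- The Beta integral `∫_y^z (z - t)^(α - 1) (t - y)^(-α) dt`. -/
lemma integral_beta {α y z : ℝ} (h0 : 0 < α) (h1 : α < 1) (hyz : y < z) :
    ∫ t in Ioo y z, (z - t) ^ (α - 1) * (t - y) ^ (1 - α - 1) =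
      Real.Gamma α * Real.Gamma (1 - α) := by
  have hz : 0 < z - y := sub_pos.2 hyz
  have key := Complex.betaIntegral_scaled ((1 - α : ℝ) : ℂ) (α : ℂ) hz
  -- The exponents add up to `1`, so the power of `z - y` produced by scaling is trivial and the
  -- integral does not depend on the interval.
  have e1 : ((1 - α : ℝ) : ℂ) + α - 1 = 0 := by push_cast; ring
  rw [e1, Complex.cpow_zero, one_mul, Complex.betaIntegral_eq_Gamma_mul_div] at key
  · have e2 : ((1 - α : ℝ) : ℂ) + α = ((1 : ℝ) : ℂ) := by push_cast; ring
    rw [e2, Complex.Gamma_ofReal, Complex.Gamma_ofReal, Complex.Gamma_ofReal, Real.Gamma_one] at key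
    have e3 : ∫ x in (0 : ℝ)..(z - y), (x : ℂ) ^ (((1 - α : ℝ) : ℂ) - 1) *
        (((z - y : ℝ) : ℂ) - x) ^ ((α : ℂ) - 1) =
        ((∫ x in (0 : ℝ)..(z - y), x ^ (1 - α - 1) * (z - y - x) ^ (α - 1) : ℝ) : ℂ) := by
      rw [← intervalIntegral.integral_ofReal]
      refine intervalIntegral.integral_congr fun x hx => ?_
      rw [uIcc_of_le hz.le] at hx
      have : 0 ≤ z - y - x := by linarith [hx.2]
      simp only [Complex.ofReal_mul, Complex.ofReal_cpow hx.1, Complex.ofReal_cpow this]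
      push_cast
      rfl
    rw [e3] at key
    have key' : ∫ x in (0 : ℝ)..(z - y), x ^ (1 - α - 1) * (z - y - x) ^ (α - 1) =
        Real.Gamma (1 - α) * Real.Gamma α := by
      apply Complex.ofReal_injective
      rw [key]
      push_cast
      ring
    rw [← integral_Ioc_eq_integral_Ioo, ← intervalIntegral.integral_of_le hyz.le, mul_comm,
      ← key']
    have := intervalIntegral.integral_comp_sub_right (a := y) (b := z)
      (fun x => x ^ (1 - α - 1) * (z - y - x) ^ (α - 1)) y
    rw [sub_self] at this
    rw [← this]
    refine intervalIntegral.integral_congr fun x _ => ?_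
    rw [mul_comm]
    congr 2
    ring
  · simpa using h1
  · simpa using h0

/-- Kernel form of the semigroup law `I^α I^(1-α) = I^1`. The cutoff at `L` is harmless because both
arguments stay below `z - y ≤ L`. -/
lemma integral_powKernel_mul_powKernel {α L y z : ℝ} (h0 : 0 < α) (h1 : α < 1)
    (hyz : y < z) (hL : z - y ≤ L) :
    ∫ t, powKernel α L (z - t) * powKernel (1 - α) L (t - y) =
      Real.Gamma α * Real.Gamma (1 - α) := by
  rw [← integral_beta h0 h1 hyz, ← integral_indicator measurableSet_Ioo]
  congr 1
  ext t
  by_cases ht : t ∈ Ioo y z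
  · rw [indicator_of_mem ht, powKernel, powKernel, indicator_of_mem, indicator_of_mem]
    · constructor <;> linarith [ht.1, ht.2]
    · constructor <;> linarith [ht.1, ht.2]
  · rw [indicator_of_notMem ht]
    by_cases h : t ≤ y
    · rw [powKernel, powKernel, indicator_of_notMem (a := t - y), mul_zero]
      exact fun h' => by linarith [h'.1]
    · have : z ≤ t := by
        by_contra h2
        exact ht ⟨not_le.1 h, not_le.1 h2⟩
      rw [powKernel, indicator_of_notMem (a := z - t), zero_mul]
      exact fun h' => by linarith [h'.1]

/-- With `ψ` supported in `(a, b)` and the kernel cut off at `b - a`, the fractional integral is a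
convolution of two functions on the line; when `ψ` is integrable, Fubini applies without moving
endpoints. -/
lemma rlLeft_eq_integral_powKernel {α a b x : ℝ} {ψ : ℝ → ℝ} (hψ : ∀ y ∉ Ioo a b, ψ y = 0)
    (hx : x ∈ Ioo a b) :
    rlLeft α a ψ x = 1 / Real.Gamma α * ∫ y, ψ y * powKernel α (b - a) (x - y) := by
  rw [rlLeft, intervalIntegral.integral_of_le hx.1.le, integral_Ioc_eq_integral_Ioo,
    ← integral_indicator measurableSet_Ioo]
  congr 2
  ext y
  by_cases hy : y ∈ Ioo a x
  · rw [indicator_of_mem hy, powKernel, indicator_of_mem, div_eq_mul_inv,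
      ← Real.rpow_neg (by linarith [hy.2])]
    · congr 2
      ring
    · constructor <;> linarith [hy.1, hy.2, hx.2]
  · rw [indicator_of_notMem hy]
    by_cases h : y ≤ a
    · rw [hψ y (fun h' => by linarith [h'.1]), zero_mul]
    · have : x ≤ y := by
        by_contra h2
        exact hy ⟨not_le.1 h, not_le.1 h2⟩
      rw [powKernel, indicator_of_notMem, mul_zero]
      exact fun h' => by linarith [h'.1]

/-! ### The Marchaud form of the Weyl derivative -/

/-- `∫_0^∞ (F x - F (x - r)) r^(-α-1) dr`. -/
def marchaud (α : ℝ) (F : ℝ → ℝ) (x : ℝ) : ℝ :=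
  ∫ r in Ioi 0, (F x - F (x - r)) * r ^ (-α - 1)

lemma measurable_marchaud {α : ℝ} {F : ℝ → ℝ} (hF : Measurable F) :
    Measurable (marchaud α F) := by
  have h : StronglyMeasurable (fun p : ℝ × ℝ => (F p.1 - F (p.1 - p.2)) * p.2 ^ (-α - 1)) :=
    Measurable.stronglyMeasurable (by fun_prop)
  exact (h.integral_prod_right (ν := volume.restrict (Ioi 0))).measurable

lemma lintegral_Ioi_rpow {α c : ℝ} (h0 : 0 < α) (hc : 0 < c) :
    ∫⁻ r in Ioi c, ENNReal.ofReal (r ^ (-α - 1)) = ENNReal.ofReal (c ^ (-α) / α) := by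
  rw [← ofReal_integral_eq_lintegral_ofReal]
  · rw [integral_Ioi_rpow_of_lt (by linarith) hc]
    congr 1
    rw [show -α - 1 + 1 = -α by ring, neg_div_neg_eq]
  · exact integrableOn_Ioi_rpow_of_lt (by linarith) hc
  · filter_upwards [ae_restrict_mem measurableSet_Ioi] with r hr
    exact Real.rpow_nonneg (hc.le.trans (le_of_lt hr)) _

/-- Reflection `y ↦ x - y` between `(a, x)` and `(0, x - a)`. -/
lemma lintegral_Ioo_sub_left (k : ℝ → ℝ≥0∞) (a x : ℝ) :
    ∫⁻ r in Ioo 0 (x - a), k (x - r) = ∫⁻ y in Ioo a x, k y := by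
  rw [← lintegral_indicator measurableSet_Ioo, ← lintegral_indicator measurableSet_Ioo,
    ← lintegral_sub_left_eq_self _ x]
  congr 1
  ext r
  by_cases hr : r ∈ Ioo a x
  · rw [indicator_of_mem hr, indicator_of_mem, sub_sub_cancel]
    constructor <;> linarith [hr.1, hr.2]
  · rw [indicator_of_notMem hr, indicator_of_notMem]
    exact fun h => hr ⟨by linarith [h.2], by linarith [h.1]⟩

/-- Split at `r = x - a`. Beyond it `F (x - r) = 0`, and the explicit tail is exactly the boundary
term `F x / (x - a)^α` of the Weyl derivative, up to the factor `1/α`. -/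
lemma lintegral_marchaud_eq {α a x : ℝ} {F : ℝ → ℝ} (h0 : 0 < α) (hF0 : ∀ y ≤ a, F y = 0)
    (hx : a < x) :
    ∫⁻ r in Ioi 0, ENNReal.ofReal (|F x - F (x - r)| * r ^ (-α - 1)) =
      (∫⁻ y in Ioo a x, ENNReal.ofReal (|F x - F y| / (x - y) ^ (α + 1))) +
        ENNReal.ofReal (|F x| * ((x - a) ^ (-α) / α)) := by
  have hxa : 0 < x - a := sub_pos.2 hx
  rw [← Ioc_union_Ioi_eq_Ioi hxa.le, lintegral_union measurableSet_Ioi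
    (Ioc_disjoint_Ioi le_rfl)]
  congr 1
  · rw [setLIntegral_congr (Ioo_ae_eq_Ioc (μ := volume)).symm,
      ← lintegral_Ioo_sub_left _ a x]
    refine setLIntegral_congr_fun measurableSet_Ioo fun r hr => ?_
    rw [sub_sub_cancel, div_eq_mul_inv, ← Real.rpow_neg hr.1.le]
    congr 3
    ring
  · rw [ENNReal.ofReal_mul (abs_nonneg _), ← lintegral_Ioi_rpow h0 hxa,
      ← lintegral_const_mul' _ _ ENNReal.ofReal_ne_top]
    refine setLIntegral_congr_fun measurableSet_Ioi fun r hr => ?_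
    rw [hF0 (x - r) (by linarith [mem_Ioi.1 hr]), sub_zero, ENNReal.ofReal_mul (abs_nonneg _)]

/-- The same splitting with signs. The Marchaud form no longer mentions the base point `a`, so its
integral over a half-line can be computed by translation. -/
lemma weylLeft_eq_marchaud {α a b x : ℝ} {F : ℝ → ℝ} (h0 : 0 < α) (hF : Measurable F)
    (hF0 : ∀ y ≤ a, F y = 0) (hx : x ∈ Ioo a b)
    (hfin : ∫⁻ y in Ioo a x, ENNReal.ofReal (|F x - F y| / (x - y) ^ (α + 1)) < ⊤) :
    weylLeft α a b F x = α / Real.Gamma (1 - α) * marchaud α F x := by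
  have hxa : 0 < x - a := sub_pos.2 hx.1
  have hint : IntegrableOn (fun r => (F x - F (x - r)) * r ^ (-α - 1)) (Ioi 0) := by
    refine ⟨Measurable.aestronglyMeasurable (by fun_prop), ?_⟩
    rw [hasFiniteIntegral_iff_norm]
    have e : ∫⁻ r in Ioi 0, ENNReal.ofReal ‖(F x - F (x - r)) * r ^ (-α - 1)‖ =
        ∫⁻ r in Ioi 0, ENNReal.ofReal (|F x - F (x - r)| * r ^ (-α - 1)) := by
      refine setLIntegral_congr_fun measurableSet_Ioi fun r hr => ?_
      rw [norm_mul, Real.norm_eq_abs, Real.norm_of_nonneg (Real.rpow_nonneg (le_of_lt hr) _)]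
    rw [e, lintegral_marchaud_eq h0 hF0 hx.1]
    exact ENNReal.add_lt_top.2 ⟨hfin, ENNReal.ofReal_lt_top⟩
  rw [weylLeft, indicator_of_mem hx, marchaud, ← Ioc_union_Ioi_eq_Ioi hxa.le,
    setIntegral_union (Ioc_disjoint_Ioi le_rfl) measurableSet_Ioi (hint.mono_set Ioc_subset_Ioi_self)
      (hint.mono_set (Ioi_subset_Ioi hxa.le))]
  have e1 : ∫ r in Ioc 0 (x - a), (F x - F (x - r)) * r ^ (-α - 1) =
      ∫ y in a..x, (F x - F y) / (x - y) ^ (α + 1) := by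
    rw [← intervalIntegral.integral_of_le hxa.le]
    have := intervalIntegral.integral_comp_sub_left (a := 0) (b := x - a)
      (fun y => (F x - F y) / (x - y) ^ (α + 1)) x
    rw [sub_zero, sub_sub_cancel] at this
    rw [← this]
    refine intervalIntegral.integral_congr fun r hr => ?_
    rw [uIcc_of_le hxa.le] at hr
    rw [sub_sub_cancel, div_eq_mul_inv, ← Real.rpow_neg hr.1]
    congr 2
    ring
  have e2 : ∫ r in Ioi (x - a), (F x - F (x - r)) * r ^ (-α - 1) =
      F x * ((x - a) ^ (-α) / α) := by
    have : ∫ r in Ioi (x - a), (F x - F (x - r)) * r ^ (-α - 1) =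
        ∫ r in Ioi (x - a), F x * r ^ (-α - 1) := by
      refine setIntegral_congr_fun measurableSet_Ioi fun r hr => ?_
      rw [hF0 (x - r) (by linarith [mem_Ioi.1 hr]), sub_zero]
    rw [this, integral_const_mul, integral_Ioi_rpow_of_lt (by linarith) hxa,
      show -α - 1 + 1 = -α by ring, neg_div_neg_eq]
  rw [e1, e2, Real.rpow_neg hxa.le]
  field_simp
  ring


/-! ### Inversion of the fractional integral -/

lemma integrable_of_abs_le_of_support {a b C : ℝ} {F : ℝ → ℝ} (hF : Measurable F)
    (hF0 : ∀ y ∉ Ioo a b, F y = 0) (hC : ∀ x, |F x| ≤ C) : Integrable F := by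
  have h : IntegrableOn F (Ioo a b) :=
    IntegrableOn.of_bound measure_Ioo_lt_top hF.aestronglyMeasurable C
      (Eventually.of_forall fun x => by simpa using hC x)
  have e : (Ioo a b).indicator F = F := by
    ext x
    by_cases hx : x ∈ Ioo a b
    · rw [indicator_of_mem hx]
    · rw [indicator_of_notMem hx, hF0 x hx]
  rw [← e]
  exact (integrable_indicator_iff measurableSet_Ioo).2 h

lemma mul_rpow_eq_mul_powKernel {a b β y z : ℝ} {F : ℝ → ℝ}
    (hF0 : ∀ y ∉ Ioo a b, F y = 0) (hz : z - a ≤ b - a) (hy : y < z) :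
    F y * (z - y) ^ (-β) = F y * powKernel (1 - β) (b - a) (z - y) := by
  by_cases ha : y ≤ a
  · rw [hF0 y fun h => by linarith [h.1], zero_mul, zero_mul]
  · rw [powKernel, indicator_of_mem]
    · congr 2
      ring
    · constructor <;> linarith [not_le.1 ha]

lemma integrable_mul_powKernel_sub {α L C : ℝ} {F : ℝ → ℝ} (h0 : 0 < α) (hF : Measurable F)
    (hC : ∀ x, |F x| ≤ C) (z : ℝ) : Integrable fun y => F y * powKernel α L (z - y) := by
  refine ((integrable_powKernel h0 L).comp_sub_left z).bdd_mul (c := C)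
    hF.aestronglyMeasurable (Eventually.of_forall fun x => by simpa using hC x)

lemma integrableOn_mul_rpow {a b β C z : ℝ} {F : ℝ → ℝ} (h1 : β < 1) (hF : Measurable F)
    (hF0 : ∀ y ∉ Ioo a b, F y = 0) (hC : ∀ x, |F x| ≤ C) (hz : z ≤ b) :
    IntegrableOn (fun y => F y * (z - y) ^ (-β)) (Iio z) := by
  refine (integrable_mul_powKernel_sub (α := 1 - β) (L := b - a) (by linarith) hF hC z).integrableOn
    |>.congr_fun (fun y hy => ?_) measurableSet_Iio
  exact (mul_rpow_eq_mul_powKernel hF0 (by linarith) hy).symm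

lemma setIntegral_Iio_mul_rpow {a b β z : ℝ} {F : ℝ → ℝ}
    (hF0 : ∀ y ∉ Ioo a b, F y = 0) (hz : z ≤ b) :
    ∫ y in Iio z, F y * (z - y) ^ (-β) = ∫ y, F y * powKernel (1 - β) (b - a) (z - y) := by
  rw [← integral_indicator measurableSet_Iio]
  congr 1
  ext y
  by_cases hy : y ∈ Iio z
  · rw [indicator_of_mem hy, mul_rpow_eq_mul_powKernel hF0 (by linarith) hy]
  · rw [indicator_of_notMem hy, powKernel, indicator_of_notMem, mul_zero]
    exact fun h => hy (by simpa using h.1)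

/-- The Marchaud integral of a primitive is a fractional integral. -/
lemma integral_Ioi_setIntegral_mul_rpow {a b β C z : ℝ} {F : ℝ → ℝ} (h0 : 0 < β) (h1 : β < 1)
    (hF : Measurable F) (hF0 : ∀ y ∉ Ioo a b, F y = 0) (hC : ∀ x, |F x| ≤ C) (hz : z ≤ b) :
    ∫ r in Ioi 0, (∫ y in Ico (z - r) z, F y) * r ^ (-β - 1) =
      1 / β * ∫ y in Iio z, F y * (z - y) ^ (-β) := by
  -- The condition `z - r ≤ y` is read as `r ≥ z - y`; integrating first in `r` then gives `(z -
  -- y)^(-β) / β`.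
  let k : ℝ → ℝ → ℝ := fun y r => F y * (Ici (z - y)).indicator (fun r => r ^ (-β - 1)) r
  have hk : Measurable (Function.uncurry k) := by
    have : Function.uncurry k = fun p : ℝ × ℝ =>
        F p.1 * {p : ℝ × ℝ | z - p.1 ≤ p.2}.indicator (fun p => p.2 ^ (-β - 1)) p := by
      ext p
      simp [k, Function.uncurry, indicator]
    rw [this]
    exact (hF.comp measurable_fst).mul (Measurable.indicator (by fun_prop)
      (measurableSet_le (by fun_prop) (by fun_prop)))
  have hker : ∀ y < z, ∫ r in Ioi 0, (Ici (z - y)).indicator (fun r => r ^ (-β - 1)) r =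
      (z - y) ^ (-β) / β := by
    intro y hy
    rw [setIntegral_indicator measurableSet_Ici, inter_eq_right.2 (Ici_subset_Ioi.2 (by linarith)),
      integral_Ici_eq_integral_Ioi, integral_Ioi_rpow_of_lt (by linarith) (by linarith),
      show -β - 1 + 1 = -β by ring, neg_div_neg_eq]
  have hint : ∀ y < z, IntegrableOn (fun r => (Ici (z - y)).indicator
      (fun r => r ^ (-β - 1)) r) (Ioi 0) := by
    intro y hy
    refine ((integrable_indicator_iff measurableSet_Ici).2 ?_).integrableOn
    rw [integrableOn_Ici_iff_integrableOn_Ioi]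
    exact integrableOn_Ioi_rpow_of_lt (by linarith) (by linarith)
  have hprod : Integrable (Function.uncurry k)
      ((volume.restrict (Iio z)).prod (volume.restrict (Ioi 0))) := by
    rw [integrable_prod_iff hk.aestronglyMeasurable]
    constructor
    · filter_upwards [ae_restrict_mem measurableSet_Iio] with y hy
      exact (hint y hy).const_mul (F y)
    · refine Integrable.congr (f := fun y => |F y| * (z - y) ^ (-β) * (1 / β)) ?_ ?_
      · refine (integrableOn_mul_rpow (a := a) (b := b) (C := C) h1 hF.abs ?_ ?_ hz).mul_const _
        · intro y hy
          rw [hF0 y hy, abs_zero]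
        · intro x
          rw [abs_abs]
          exact hC x
      · filter_upwards [ae_restrict_mem measurableSet_Iio] with y hy
        have : ∀ r ∈ Ioi (0 : ℝ), ‖Function.uncurry k (y, r)‖ =
            |F y| * (Ici (z - y)).indicator (fun r => r ^ (-β - 1)) r := by
          intro r hr
          simp only [Function.uncurry, k, norm_mul, Real.norm_eq_abs]
          rw [abs_of_nonneg (indicator_nonneg (fun r' hr' => Real.rpow_nonneg ?_ _) r)]
          linarith [mem_Ici.1 hr', mem_Iio.1 hy]
        rw [setIntegral_congr_fun measurableSet_Ioi this, integral_const_mul, hker y hy]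
        ring
  have swap := integral_integral_swap hprod
  have lhs : ∫ y in Iio z, ∫ r in Ioi 0, k y r = 1 / β * ∫ y in Iio z, F y * (z - y) ^ (-β) := by
    rw [← integral_const_mul]
    refine setIntegral_congr_fun measurableSet_Iio fun y hy => ?_
    simp only [k]
    rw [integral_const_mul, hker y hy]
    ring
  rw [← lhs, swap]
  refine setIntegral_congr_fun measurableSet_Ioi fun r hr => ?_
  simp only [k]
  rw [← integral_mul_const, ← Iio_inter_Ici, ← setIntegral_indicator measurableSet_Ici]
  congr 1
  ext y
  simp only [indicator, mem_Ici]
  by_cases h : z - r ≤ y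
  · rw [if_pos h, if_pos (by linarith)]
  · rw [if_neg h, if_neg (by intro h'; apply h; linarith)]
    ring

/-- Boundedness of the Marchaud integrals of a function supported in `(a, b)`. -/
structure HasBddMarchaud (α a b C : ℝ) (F : ℝ → ℝ) : Prop where
  meas : Measurable F
  supp : ∀ y ∉ Ioo a b, F y = 0
  bound : ∀ x, |F x| ≤ C
  lint : ∀ x ∈ Ioo a b, ∫⁻ y in Ioo a x, ENNReal.ofReal (|F x - F y| / (x - y) ^ (α + 1)) ≤
    ENNReal.ofReal C

namespace HasBddMarchaud

variable {α a b C : ℝ} {F : ℝ → ℝ}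

lemma nonneg (h : HasBddMarchaud α a b C F) : 0 ≤ C := (abs_nonneg _).trans (h.bound 0)

lemma integrable (h : HasBddMarchaud α a b C F) : Integrable F :=
  integrable_of_abs_le_of_support h.meas h.supp h.bound

lemma eq_zero_of_le (h : HasBddMarchaud α a b C F) : ∀ y ≤ a, F y = 0 :=
  fun y hy => h.supp y fun h' => by linarith [h'.1]

lemma lintegral_le (h : HasBddMarchaud α a b C F) (h0 : 0 < α) {x : ℝ} (hx : x ∈ Ioo a b) :
    ∫⁻ r in Ioi 0, ENNReal.ofReal (|F x - F (x - r)| * r ^ (-α - 1)) ≤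
      ENNReal.ofReal (C + C * ((x - a) ^ (-α) / α)) := by
  have hxa : 0 ≤ x - a := by linarith [hx.1]
  rw [lintegral_marchaud_eq h0 h.eq_zero_of_le hx.1, ENNReal.ofReal_add h.nonneg
    (mul_nonneg h.nonneg (div_nonneg (Real.rpow_nonneg hxa _) h0.le))]
  refine add_le_add (h.lint x hx) (ENNReal.ofReal_le_ofReal ?_)
  exact mul_le_mul_of_nonneg_right (h.bound x) (div_nonneg (Real.rpow_nonneg hxa _) h0.le)

lemma integrableOn_bound (h1 : α < 1) (c d : ℝ) :
    IntegrableOn (fun x => c + d * ((x - a) ^ (-α) / α)) (Ioo a b) := by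
  refine Integrable.add (integrableOn_const measure_Ioo_lt_top.ne) (Integrable.const_mul ?_ _)
  refine Integrable.div_const ?_ _
  have := ((integrable_powKernel (α := 1 - α) (by linarith) (b - a)).comp_sub_right a).integrableOn
    (s := Ioo a b)
  refine this.congr_fun (fun x hx => ?_) measurableSet_Ioo
  simp only [powKernel]
  rw [indicator_of_mem]
  · congr 1
    ring
  · constructor <;> linarith [hx.1, hx.2]

/-- Absolute convergence needed for Fubini: the inner integral is at most a constant plus a multiple
of `(t - a)^(-α)`, integrable since `α < 1`, and it vanishes for `t ≤ a`. -/
lemma integrable_prod (h : HasBddMarchaud α a b C F) (h0 : 0 < α) (h1 : α < 1) {z : ℝ}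
    (hz : z ≤ b) :
    Integrable (Function.uncurry fun t r => (F t - F (t - r)) * r ^ (-α - 1))
      ((volume.restrict (Iio z)).prod (volume.restrict (Ioi 0))) := by
  have hm : Measurable (Function.uncurry fun t r => (F t - F (t - r)) * r ^ (-α - 1)) := by
    have := h.meas
    unfold Function.uncurry
    fun_prop
  refine ⟨hm.aestronglyMeasurable, ?_⟩
  rw [hasFiniteIntegral_iff_norm, lintegral_prod _ hm.norm.ennreal_ofReal.aemeasurable]
  have hle : ∀ t ∈ Iio z, ∫⁻ r in Ioi 0, ENNReal.ofReal
      ‖Function.uncurry (fun t r => (F t - F (t - r)) * r ^ (-α - 1)) (t, r)‖ ≤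
      (Ioo a b).indicator (fun t => ENNReal.ofReal (C + C * ((t - a) ^ (-α) / α))) t := by
    intro t ht
    by_cases ha : a < t
    · have htab : t ∈ Ioo a b := ⟨ha, lt_of_lt_of_le ht hz⟩
      rw [indicator_of_mem htab]
      refine le_trans (le_of_eq ?_) (h.lintegral_le h0 htab)
      refine setLIntegral_congr_fun measurableSet_Ioi fun r hr => ?_
      simp only [Function.uncurry]
      rw [norm_mul, Real.norm_eq_abs, Real.norm_of_nonneg (Real.rpow_nonneg (le_of_lt hr) _)]
    · rw [indicator_of_notMem (fun h => ha h.1)]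
      refine le_of_eq ?_
      rw [setLIntegral_congr_fun (g := fun _ => 0) measurableSet_Ioi fun r hr => ?_]
      · simp
      · simp only [Function.uncurry]
        rw [h.eq_zero_of_le t (not_lt.1 ha),
          h.eq_zero_of_le (t - r) (by linarith [mem_Ioi.1 hr])]
        simp
  refine lt_of_le_of_lt (setLIntegral_mono' measurableSet_Iio hle) ?_
  refine lt_of_le_of_lt (setLIntegral_le_lintegral _ _) ?_
  rw [lintegral_indicator measurableSet_Ioo]
  exact (integrableOn_bound h1 C C).lintegral_lt_top

lemma integrableOn_marchaud (h : HasBddMarchaud α a b C F) (h0 : 0 < α) (h1 : α < 1) :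
    IntegrableOn (marchaud α F) (Iio b) :=
  (h.integrable_prod h0 h1 le_rfl).integral_prod_left

/-- For fixed `r`, translation gives `∫_{-∞}^z (F t - F (t - r)) dt = ∫_{z-r}^z F`. After Fubini, a
primitive of the Marchaud derivative is a fractional integral of order `1 - α`. -/
lemma setIntegral_marchaud (h : HasBddMarchaud α a b C F) (h0 : 0 < α) (h1 : α < 1) {z : ℝ}
    (hz : z ≤ b) :
    ∫ t in Iio z, marchaud α F t = 1 / α * ∫ y in Iio z, F y * (z - y) ^ (-α) := by
  rw [← integral_Ioi_setIntegral_mul_rpow h0 h1 h.meas h.supp h.bound hz]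
  unfold marchaud
  rw [integral_integral_swap (h.integrable_prod h0 h1 hz)]
  refine setIntegral_congr_fun measurableSet_Ioi fun r hr => ?_
  have hr' : 0 < r := hr
  rw [integral_mul_const, integral_sub h.integrable.integrableOn
    (h.integrable.comp_sub_right r).integrableOn]
  have e : ∫ t in Iio z, F (t - r) = ∫ t in Iio (z - r), F t := by
    rw [← integral_indicator measurableSet_Iio, ← integral_indicator measurableSet_Iio,
      ← integral_sub_right_eq_self ((Iio (z - r)).indicator F) r]
    congr 1
    ext t
    simp [indicator]
  have e2 : ∫ t in Iio z, F t = (∫ t in Iio (z - r), F t) + ∫ t in Ico (z - r) z, F t := by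
    rw [← setIntegral_union (s := Iio (z - r)) (t := Ico (z - r) z)
      (Set.disjoint_left.2 fun t h1 h2 => absurd h2.1 (not_le.2 h1))
      measurableSet_Ico h.integrable.integrableOn h.integrable.integrableOn,
      Iio_union_Ico_eq_Iio (by linarith)]
  rw [e, e2]
  ring

lemma weylLeft_eq (h : HasBddMarchaud α a b C F) (h0 : 0 < α) :
    weylLeft α a b F = (Ioo a b).indicator fun x =>
      α / Real.Gamma (1 - α) * marchaud α F x := by
  ext x
  by_cases hx : x ∈ Ioo a b
  · rw [indicator_of_mem hx, weylLeft_eq_marchaud h0 h.meas h.eq_zero_of_le hx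
      ((h.lint x hx).trans_lt ENNReal.ofReal_lt_top)]
  · rw [indicator_of_notMem hx, weylLeft, indicator_of_notMem hx]

lemma measurable_weylLeft (h : HasBddMarchaud α a b C F) (h0 : 0 < α) :
    Measurable (weylLeft α a b F) := by
  rw [h.weylLeft_eq h0]
  exact ((measurable_marchaud h.meas).const_mul _).indicator measurableSet_Ioo

lemma integrable_weylLeft (h : HasBddMarchaud α a b C F) (h0 : 0 < α) (h1 : α < 1) :
    Integrable (weylLeft α a b F) := by
  rw [h.weylLeft_eq h0, integrable_indicator_iff measurableSet_Ioo]
  exact ((h.integrableOn_marchaud h0 h1).mono_set Ioo_subset_Iio_self).const_mul _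

lemma marchaud_eq_zero (h : HasBddMarchaud α a b C F) {x : ℝ} (hx : x ≤ a) :
    marchaud α F x = 0 := by
  unfold marchaud
  rw [setIntegral_congr_fun (g := fun _ => 0) measurableSet_Ioi fun r hr => ?_]
  · simp
  · simp only
    rw [h.eq_zero_of_le x hx, h.eq_zero_of_le (x - r) (by linarith [mem_Ioi.1 hr])]
    simp

lemma setIntegral_weylLeft (h : HasBddMarchaud α a b C F) (h0 : 0 < α) (h1 : α < 1) {z : ℝ}
    (hz : z ≤ b) :
    ∫ t in Iio z, weylLeft α a b F t =
      1 / Real.Gamma (1 - α) * ∫ y, F y * powKernel (1 - α) (b - a) (z - y) := by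
  have e : ∫ t in Iio z, weylLeft α a b F t =
      ∫ t in Iio z, α / Real.Gamma (1 - α) * marchaud α F t := by
    refine setIntegral_congr_fun measurableSet_Iio fun t ht => ?_
    rw [h.weylLeft_eq h0]
    by_cases ha : a < t
    · rw [indicator_of_mem (show t ∈ Ioo a b from ⟨ha, lt_of_lt_of_le ht hz⟩)]
    · rw [indicator_of_notMem (fun h => ha h.1 : t ∉ Ioo a b), h.marchaud_eq_zero (not_lt.1 ha), mul_zero]
  rw [e, integral_const_mul, h.setIntegral_marchaud h0 h1 hz, setIntegral_Iio_mul_rpow h.supp hz]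
  field_simp

end HasBddMarchaud


lemma integrable_powKernel_conv {α L : ℝ} {ψ : ℝ → ℝ} (h0 : 0 < α) (hψ : Integrable ψ) :
    Integrable (fun p : ℝ × ℝ => ψ p.2 * powKernel α L (p.1 - p.2)) :=
  hψ.convolution_integrand (ContinuousLinearMap.mul ℝ ℝ) (integrable_powKernel h0 L)

lemma setIntegral_Iio_powKernel (α L y z : ℝ) :
    ∫ t in Iio z, powKernel α L (t - y) = ∫ t in Ioi y, powKernel α L (z - t) := by
  rw [← integral_indicator measurableSet_Iio, ← integral_indicator measurableSet_Ioi,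
    ← integral_sub_left_eq_self _ volume (z + y)]
  congr 1
  ext t
  have e1 : z + y - t - y = z - t := by ring
  have e2 : z + y - t < z ↔ y < t := by constructor <;> intro h <;> linarith
  simp only [indicator, mem_Iio, mem_Ioi, e1, e2]

lemma integral_mul_setIntegral_Ioi {ψ k : ℝ → ℝ} (hψ : Integrable ψ) (hk : Integrable k) :
    ∫ y, ψ y * ∫ t in Ioi y, k t = ∫ t, k t * ∫ y in Iio t, ψ y := by
  let f : ℝ → ℝ → ℝ := fun y t => {p : ℝ × ℝ | p.1 < p.2}.indicator (fun p => ψ p.1 * k p.2) (y, t)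
  have hf : Integrable (Function.uncurry f) :=
    (hψ.mul_prod hk).indicator (measurableSet_lt measurable_fst measurable_snd)
  have swap := integral_integral_swap hf
  have e1 : ∀ y, ∫ t, f y t = ψ y * ∫ t in Ioi y, k t := by
    intro y
    rw [← integral_const_mul, ← integral_indicator measurableSet_Ioi]
    congr 1
  have e2 : ∀ t, ∫ y, f y t = k t * ∫ y in Iio t, ψ y := by
    intro t
    rw [← integral_const_mul, ← integral_indicator measurableSet_Iio]
    congr 1
    ext y
    simp only [f, indicator, mem_ofPred_eq, mem_Iio, mul_comm]
  simpa only [e1, e2] using swap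

/-- In operator form `I^1 I^α D^α F = I^α (I^1 D^α F) = I^α I^(1-α) F = I^1 F`: convolutions
commute, a primitive of `D^α F` is `I^(1-α) F`, and the Beta integral closes the chain. -/
lemma HasBddMarchaud.setIntegral_powKernel_weylLeft {α a b C : ℝ} {F : ℝ → ℝ}
    (h : HasBddMarchaud α a b C F) (h0 : 0 < α) (h1 : α < 1) {z : ℝ} (hz : z ≤ b) :
    ∫ t in Iio z, ∫ y, weylLeft α a b F y * powKernel α (b - a) (t - y) =
      Real.Gamma α * ∫ y in Iio z, F y := by
  set ψ := weylLeft α a b F with hψdef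
  set L := b - a
  have hψ : Integrable ψ := h.integrable_weylLeft h0 h1
  have hG : Real.Gamma (1 - α) ≠ 0 := (Real.Gamma_pos_of_pos (by linarith)).ne'
  have hconv : Integrable (Function.uncurry fun t y => ψ y * powKernel α L (t - y))
      ((volume.restrict (Iio z)).prod volume) := by
    have := (integrable_powKernel_conv (L := L) h0 hψ).integrableOn (s := Iio z ×ˢ univ)
    rw [IntegrableOn, Measure.volume_eq_prod, ← Measure.prod_restrict, Measure.restrict_univ] at this
    exact this
  rw [integral_integral_swap hconv]
  have e1 : ∀ y, ∫ t in Iio z, ψ y * powKernel α L (t - y) =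
      ψ y * ∫ t in Ioi y, powKernel α L (z - t) := fun y => by
    rw [integral_const_mul, setIntegral_Iio_powKernel]
  simp only [e1]
  rw [integral_mul_setIntegral_Ioi hψ ((integrable_powKernel h0 L).comp_sub_left z)]
  have e2 : ∀ t, powKernel α L (z - t) * ∫ y in Iio t, ψ y =
      ∫ y, 1 / Real.Gamma (1 - α) *
        (F y * (powKernel α L (z - t) * powKernel (1 - α) L (t - y))) := by
    intro t
    rw [integral_const_mul]
    by_cases ht : t < z
    · rw [h.setIntegral_weylLeft h0 h1 (ht.le.trans hz), mul_left_comm, ← integral_const_mul]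
      congr 2
      ext y
      ring
    · have : powKernel α L (z - t) = 0 := by
        rw [powKernel, indicator_of_notMem]
        exact fun h' => ht (by linarith [h'.1])
      simp [this]
  simp only [e2]
  have hbeta : Integrable (Function.uncurry fun y t => 1 / Real.Gamma (1 - α) *
      (F y * (powKernel α L (z - t) * powKernel (1 - α) L (t - y)))) := by
    have hi : Integrable (fun p : ℝ × ℝ => powKernel α L (z - p.2) *
        powKernel (1 - α) L (-(p.1 - p.2))) :=
      ((integrable_powKernel h0 L).comp_sub_left z).convolution_integrand
        (ContinuousLinearMap.mul ℝ ℝ)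
        (integrable_powKernel (α := 1 - α) (by linarith) L).comp_neg
    have hi2 := (hi.bdd_mul (f := fun p : ℝ × ℝ => F p.1) (c := C)
      (h.meas.comp measurable_fst).aestronglyMeasurable
      (Eventually.of_forall fun p => by simpa using h.bound p.1)).const_mul
        (1 / Real.Gamma (1 - α))
    refine hi2.congr (Eventually.of_forall fun p => ?_)
    simp only [Function.uncurry, neg_sub]
  rw [← integral_integral_swap hbeta, ← integral_const_mul, ← integral_indicator measurableSet_Iio]
  congr 1
  ext y
  rw [integral_const_mul, integral_const_mul]
  by_cases hy : y < z
  · rw [indicator_of_mem (show y ∈ Iio z from hy)]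
    by_cases hya : y ≤ a
    · rw [h.eq_zero_of_le y hya]
      simp
    · rw [integral_powKernel_mul_powKernel h0 h1 hy (by simp only [L]; linarith [not_le.1 hya])]
      field_simp
  · rw [indicator_of_notMem (show y ∉ Iio z from hy)]
    have : ∀ t, powKernel α L (z - t) * powKernel (1 - α) L (t - y) = 0 := by
      intro t
      by_cases ht : t < z
      · rw [powKernel, powKernel, indicator_of_notMem (a := t - y), mul_zero]
        exact fun h' => hy (by linarith [h'.1])
      · rw [powKernel, indicator_of_notMem (a := z - t), zero_mul]
        exact fun h' => ht (by linarith [h'.1])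
    simp [this]

/-- A function with bounded Marchaud integrals is the fractional integral of its Weyl derivative. -/
theorem HasBddMarchaud.ae_eq_rlLeft_weylLeft {α a b C : ℝ} {F : ℝ → ℝ}
    (h : HasBddMarchaud α a b C F) (h0 : 0 < α) (h1 : α < 1) :
    ∀ᵐ x ∂(volume.restrict (Ioo a b)), F x = rlLeft α a (weylLeft α a b F) x := by
  have hΓ : Real.Gamma α ≠ 0 := (Real.Gamma_pos_of_pos h0).ne'
  set K : ℝ → ℝ := fun t => ∫ y, weylLeft α a b F y * powKernel α (b - a) (t - y) with hKdef
  have hK : Integrable K :=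
    (integrable_powKernel_conv (L := b - a) h0 (h.integrable_weylLeft h0 h1)).integral_prod_left
  set D : ℝ → ℝ := fun t => Real.Gamma α * F t - K t with hDdef
  have hD : Integrable D := (h.integrable.const_mul _).sub hK
  -- All primitives of the defect `D` vanish up to `b`, so Lebesgue differentiation forces `D = 0`
  -- almost everywhere on `(a, b)`.
  have hDz : ∀ z ≤ b, ∫ t in Iio z, D t = 0 := by
    intro z hz
    simp only [hDdef]
    rw [integral_sub (h.integrable.const_mul _).integrableOn hK.integrableOn, integral_const_mul,
      hKdef, h.setIntegral_powKernel_weylLeft h0 h1 hz, sub_self]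
  rw [ae_restrict_iff' measurableSet_Ioo]
  filter_upwards [LocallyIntegrable.ae_hasDerivAt_integral hD.locallyIntegrable] with x hx hxab
  have hx' := hx a
  have hzero : (fun x => ∫ t in a..x, D t) =ᶠ[𝓝 x] fun _ => 0 := by
    filter_upwards [Ioo_mem_nhds hxab.1 hxab.2] with z hz
    rw [intervalIntegral.integral_of_le hz.1.le, integral_Ioc_eq_integral_Ioo,
      ← integral_Ico_eq_integral_Ioo]
    have := setIntegral_union (s := Iio a) (t := Ico a z) (μ := volume) (f := D)
      (Set.disjoint_left.2 fun t h1 h2 => absurd h2.1 (not_le.2 h1))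
      measurableSet_Ico hD.integrableOn hD.integrableOn
    rw [Iio_union_Ico_eq_Iio hz.1.le, hDz z hz.2.le, hDz a (hz.1.le.trans hz.2.le)] at this
    linarith
  have hD0 : D x = 0 := hx'.unique ((hasDerivAt_const x (0 : ℝ)).congr_of_eventuallyEq hzero)
  have hsupp : ∀ y ∉ Ioo a b, weylLeft α a b F y = 0 := fun y hy => by
    rw [weylLeft, indicator_of_notMem hy]
  rw [rlLeft_eq_integral_powKernel hsupp hxab]
  simp only [hDdef, hKdef] at hD0
  field_simp
  linarith

/-- Fractional integration by parts. -/
lemma integral_mul_rlRight {α a b C : ℝ} {ψ k : ℝ → ℝ} (h0 : 0 < α) (hψ : Integrable ψ)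
    (hψ0 : ∀ y ∉ Ioo a b, ψ y = 0) (hk : Measurable k) (hC : ∀ x, |k x| ≤ C) :
    ∫ x in Ioo a b, ψ x * rlRight α b k x = ∫ x in Ioo a b, rlLeft α a ψ x * k x := by
  have hi : Integrable (Function.uncurry fun t y => k t * (ψ y * powKernel α (b - a) (t - y)))
      ((volume.restrict (Ioo a b)).prod (volume.restrict (Ioo a b))) := by
    have := ((integrable_powKernel_conv (L := b - a) h0 hψ).bdd_mul
      (f := fun p : ℝ × ℝ => k p.1) (c := C)
      (hk.comp measurable_fst).aestronglyMeasurable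
      (Eventually.of_forall fun p => by simpa using hC p.1)).integrableOn (s := Ioo a b ×ˢ Ioo a b)
    rw [IntegrableOn, Measure.volume_eq_prod, ← Measure.prod_restrict] at this
    exact this
  have swap := integral_integral_swap hi
  have e1 : ∀ t ∈ Ioo a b, ∫ y in Ioo a b, k t * (ψ y * powKernel α (b - a) (t - y)) =
      Real.Gamma α * (rlLeft α a ψ t * k t) := by
    intro t ht
    rw [rlLeft_eq_integral_powKernel hψ0 ht, integral_const_mul,
      setIntegral_eq_integral_of_forall_compl_eq_zero fun y hy => by rw [hψ0 y hy, zero_mul]]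
    have := (Real.Gamma_pos_of_pos h0).ne'
    field_simp
  have e2 : ∀ y ∈ Ioo a b, ∫ t in Ioo a b, k t * (ψ y * powKernel α (b - a) (t - y)) =
      Real.Gamma α * (ψ y * rlRight α b k y) := by
    intro y hy
    have e3 : ∫ t in y..b, k t / (t - y) ^ (1 - α) =
        ∫ t in Ioo a b, k t * powKernel α (b - a) (t - y) := by
      rw [intervalIntegral.integral_of_le hy.2.le, integral_Ioc_eq_integral_Ioo,
        ← integral_indicator measurableSet_Ioo, ← integral_indicator measurableSet_Ioo]
      congr 1
      ext t
      by_cases ht : t ∈ Ioo y b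
      · rw [indicator_of_mem ht, indicator_of_mem (show t ∈ Ioo a b from ⟨hy.1.trans ht.1, ht.2⟩),
          powKernel, indicator_of_mem, div_eq_mul_inv, ← Real.rpow_neg (by linarith [ht.1])]
        · congr 2
          ring
        · constructor <;> linarith [ht.1, ht.2, hy.1]
      · rw [indicator_of_notMem ht]
        by_cases hb : t < b
        · have : powKernel α (b - a) (t - y) = 0 := by
            rw [powKernel, indicator_of_notMem]
            exact fun h' => ht ⟨by linarith [h'.1], hb⟩
          simp [indicator, this]
        · rw [indicator_of_notMem fun h' => hb h'.2]
    rw [rlRight, e3]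
    have : ∀ t, k t * (ψ y * powKernel α (b - a) (t - y)) =
        ψ y * (k t * powKernel α (b - a) (t - y)) := fun t => by ring
    simp only [this]
    rw [integral_const_mul]
    have := (Real.Gamma_pos_of_pos h0).ne'
    field_simp
  rw [setIntegral_congr_fun measurableSet_Ioo e1, setIntegral_congr_fun measurableSet_Ioo e2,
    integral_const_mul, integral_const_mul] at swap
  exact (mul_left_cancel₀ (Real.Gamma_pos_of_pos h0).ne' swap).symm


/-! ### Functions in `W^{α,∞}` -/

/-- Both parts of the norm of `W^{α,∞}[0,1]` are bounded by `C`. -/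
structure BddW (α : ℝ) (f : ℝ → ℝ) (C : ℝ) : Prop where
  bound : ∀ ξ ∈ Icc (0 : ℝ) 1, |f ξ| ≤ C
  lint : ∀ ξ ∈ Icc (0 : ℝ) 1,
    ∫⁻ η in Ioo 0 ξ, ENNReal.ofReal (|f ξ - f η| / (ξ - η) ^ (α + 1)) ≤ ENNReal.ofReal C

namespace BddW

variable {α C : ℝ} {f : ℝ → ℝ}

lemma nonneg (h : BddW α f C) : 0 ≤ C := (abs_nonneg _).trans (h.bound 0 (by simp))

/-- On `(a, x)` the weight `(y - η)^(-α-1)` is at least `(y - a)^(-α-1)`, which trades the singular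
integral for an unweighted one. -/
lemma lintegral_abs_sub_le (h : BddW α f C) (h0 : 0 < α) {a x y : ℝ} (ha : 0 ≤ a) (hax : a < x)
    (hxy : x ≤ y) (hy : y ≤ 1) :
    ∫⁻ η in Ioo a x, ENNReal.ofReal |f y - f η| ≤ ENNReal.ofReal ((y - a) ^ (α + 1) * C) := by
  have hya : 0 ≤ y - a := by linarith
  rw [ENNReal.ofReal_mul (Real.rpow_nonneg hya _)]
  refine le_trans ?_ (mul_le_mul_right (h.lint y ⟨by linarith, hy⟩) _)
  rw [← lintegral_const_mul' _ _ ENNReal.ofReal_ne_top]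
  refine le_trans (setLIntegral_mono' measurableSet_Ioo fun η hη => ?_)
    (lintegral_mono_set (Ioo_subset_Ioo ha hxy))
  rw [← ENNReal.ofReal_mul (Real.rpow_nonneg hya _)]
  refine ENNReal.ofReal_le_ofReal ?_
  have hp : 0 < (y - η) ^ (α + 1) := Real.rpow_pos_of_pos (by linarith [hη.2]) _
  rw [mul_div_assoc', le_div_iff₀ hp, mul_comm]
  refine mul_le_mul_of_nonneg_right ?_ (abs_nonneg _)
  exact Real.rpow_le_rpow (by linarith [hη.2]) (by linarith [hη.1]) (by linarith)

/-- Average `|f y - f x| ≤ |f y - f η| + |f x - f η|` over `η ∈ (a, x)`; the length `x - a` of this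
interval is comparable to `y - a`. The bound is in the distance to `a`, not in `y - x`. -/
lemma abs_sub_le_of_half (h : BddW α f C) (hf : Measurable f) (h0 : 0 < α) {a x y : ℝ}
    (ha : 0 ≤ a) (hax : a < x) (hxy : x ≤ y) (hy : y ≤ 1) (hh : y - a ≤ 2 * (x - a)) :
    |f y - f x| ≤ 4 * C * (y - a) ^ α := by
  have hxa : 0 < x - a := sub_pos.2 hax
  have hya : 0 < y - a := by linarith
  have h1 := h.lintegral_abs_sub_le h0 ha hax hxy hy
  have h2 := h.lintegral_abs_sub_le h0 ha hax le_rfl (hxy.trans hy)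
  have h3 : ∫⁻ _ in Ioo a x, ENNReal.ofReal |f y - f x| ≤
      (∫⁻ η in Ioo a x, ENNReal.ofReal |f y - f η|) +
        ∫⁻ η in Ioo a x, ENNReal.ofReal |f x - f η| := by
    rw [← lintegral_add_left (by fun_prop)]
    refine lintegral_mono fun η => ?_
    rw [← ENNReal.ofReal_add (abs_nonneg _) (abs_nonneg _)]
    refine ENNReal.ofReal_le_ofReal ?_
    rw [abs_sub_comm (f x) (f η)]
    exact abs_sub_le _ _ _
  have hpow : (x - a) ^ (α + 1) ≤ (y - a) ^ (α + 1) :=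
    Real.rpow_le_rpow hxa.le (by linarith) (by linarith)
  have hpy : 0 ≤ (y - a) ^ α := Real.rpow_nonneg hya.le _
  have h4 := h3.trans (add_le_add h1 h2)
  rw [setLIntegral_const, Real.volume_Ioo, ← ENNReal.ofReal_mul (abs_nonneg _),
    ← ENNReal.ofReal_add (mul_nonneg (Real.rpow_nonneg hya.le _) h.nonneg)
      (mul_nonneg (Real.rpow_nonneg hxa.le _) h.nonneg), ENNReal.ofReal_le_ofReal_iff
      (add_nonneg (mul_nonneg (Real.rpow_nonneg hya.le _) h.nonneg)
      (mul_nonneg (Real.rpow_nonneg hxa.le _) h.nonneg))] at h4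
  have h5 : |f y - f x| * (x - a) ≤ 2 * C * (y - a) ^ (α + 1) := by
    nlinarith [mul_le_mul_of_nonneg_right hpow h.nonneg]
  rw [Real.rpow_add_one hya.ne'] at h5
  have h6 : 2 * C * ((y - a) ^ α * (y - a)) ≤ 2 * C * ((y - a) ^ α * (2 * (x - a))) :=
    mul_le_mul_of_nonneg_left (mul_le_mul_of_nonneg_left hh hpy) (by linarith [h.nonneg])
  have h7 : |f y - f x| * (x - a) ≤ (4 * C * (y - a) ^ α) * (x - a) := by linarith
  exact le_of_mul_le_mul_right h7 hxa

/-- Remove the comparability of `x - a` and `y - a` by repeatedly halving `y - a`. The errors form a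
geometric series of ratio `2^(-α)`, so the constant is independent of the number `n` of halvings. -/
lemma abs_sub_le_rpow (h : BddW α f C) (hf : Measurable f) (h0 : 0 < α) {a : ℝ} (ha : 0 ≤ a)
    (n : ℕ) : ∀ x y : ℝ, a < x → x ≤ y → y ≤ 1 → y - a ≤ 2 ^ n * (x - a) →
    |f y - f x| ≤ 4 * C / (1 - 2⁻¹ ^ α) * (y - a) ^ α := by
  have hlt : (2⁻¹ : ℝ) ^ α < 1 := Real.rpow_lt_one (by norm_num) (by norm_num) h0
  have hpos : 0 < 1 - (2⁻¹ : ℝ) ^ α := by linarith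
  have h2 : 0 < (2⁻¹ : ℝ) ^ α := Real.rpow_pos_of_pos (by norm_num) _
  have hC := h.nonneg
  induction n with
  | zero =>
    intro x y hax hxy hy hh
    have : y = x := by linarith
    subst this
    rw [sub_self, abs_zero]
    have := Real.rpow_nonneg (by linarith : (0:ℝ) ≤ y - a) α
    positivity
  | succ n ih =>
    intro x y hax hxy hy hh
    have hya : 0 ≤ y - a := by linarith
    have hr := Real.rpow_nonneg hya α
    rcases le_or_gt (y - a) (2 * (x - a)) with hc | hc
    · refine (h.abs_sub_le_of_half hf h0 ha hax hxy hy hc).trans ?_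
      refine mul_le_mul_of_nonneg_right ?_ hr
      rw [le_div_iff₀ hpos]
      nlinarith
    · set m := a + (y - a) / 2 with hm
      have hma : m - a = 2⁻¹ * (y - a) := by rw [hm]; ring
      have e1 := h.abs_sub_le_of_half hf h0 ha (x := m) (y := y) (by linarith) (by linarith) hy
        (by linarith)
      have e2 := ih x m hax (by linarith) (by linarith)
        (by rw [pow_succ] at hh; linarith)
      rw [hma, Real.mul_rpow (by norm_num) hya] at e2
      refine (abs_sub_le _ (f m) _).trans ((add_le_add e1 e2).trans (le_of_eq ?_))
      generalize (2⁻¹ : ℝ) ^ α = w at hpos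
      field_simp
      ring

/-- The oscillation of `f` on `(a, y]` is at most a multiple of `(y - a)^α`, so the Cauchy criterion
holds at `a` from the right. -/
lemma exists_tendsto_right (h : BddW α f C) (hf : Measurable f) (h0 : 0 < α) {a : ℝ}
    (ha : 0 ≤ a) (ha1 : a < 1) : ∃ l, Tendsto f (𝓝[>] a) (𝓝 l) := by
  set K := 4 * C / (1 - 2⁻¹ ^ α) with hK
  have hxy : ∀ x y, a < x → x ≤ y → y ≤ 1 → |f y - f x| ≤ K * (y - a) ^ α := by
    intro x y hax hxy hy
    obtain ⟨n, hn⟩ := pow_unbounded_of_one_lt ((y - a) / (x - a)) (one_lt_two)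
    refine h.abs_sub_le_rpow hf h0 ha n x y hax hxy hy ?_
    rw [div_lt_iff₀ (by linarith)] at hn
    exact hn.le
  rw [← cauchy_map_iff_exists_tendsto, Metric.cauchy_iff]
  refine ⟨inferInstance, fun ε hε => ?_⟩
  have hlim : Tendsto (fun y => K * (y - a) ^ α) (𝓝[>] a) (𝓝 0) := by
    have : Tendsto (fun y => K * (y - a) ^ α) (𝓝 a) (𝓝 (K * (a - a) ^ α)) :=
      ((continuousAt_id.sub continuousAt_const).rpow_const (Or.inr h0.le)).const_mul K
    rw [sub_self, Real.zero_rpow h0.ne', mul_zero] at this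
    exact this.mono_left nhdsWithin_le_nhds
  have hev : ∀ᶠ y in 𝓝[>] a, K * (y - a) ^ α < ε ∧ y ∈ Ioc a 1 :=
    (hlim.eventually (gt_mem_nhds hε)).and (Ioc_mem_nhdsGT ha1)
  refine ⟨f '' {y | K * (y - a) ^ α < ε ∧ y ∈ Ioc a 1}, image_mem_map hev, ?_⟩
  rintro _ ⟨x, hx, rfl⟩ _ ⟨y, hy, rfl⟩
  rcases le_total x y with hle | hle
  · rw [dist_comm, Real.dist_eq]
    exact (hxy x y hx.2.1 hle hy.2.2).trans_lt hy.1
  · rw [Real.dist_eq]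
    exact (hxy y x hy.2.1 hle hx.2.2).trans_lt hx.1

lemma tendsto_limR (h : BddW α f C) (hf : Measurable f) (h0 : 0 < α) {a : ℝ}
    (ha : 0 ≤ a) (ha1 : a < 1) : Tendsto f (𝓝[>] a) (𝓝 (limR f a)) :=
  tendsto_nhds_limUnder (h.exists_tendsto_right hf h0 ha ha1)

lemma abs_limR_le (h : BddW α f C) (hf : Measurable f) (h0 : 0 < α) {a : ℝ}
    (ha : 0 ≤ a) (ha1 : a < 1) : |limR f a| ≤ C := by
  refine le_of_tendsto (h.tendsto_limR hf h0 ha ha1).abs ?_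
  filter_upwards [Ioc_mem_nhdsGT ha1] with x hx
  exact h.bound x ⟨by linarith [hx.1], hx.2⟩

/-- Centring does not change differences inside `(a, b)`; the factor `2` only pays for the supremum
of `f - f(a+)`. -/
lemma hasBddMarchaud (h : BddW α f C) (hf : Measurable f) (h0 : 0 < α) {a b : ℝ}
    (ha : 0 ≤ a) (hab : a < b) (hb : b ≤ 1) :
    HasBddMarchaud α a b (2 * C) (centerLeft a b f) where
  meas := (hf.sub_const _).indicator measurableSet_Ioo
  supp := fun y hy => by rw [centerLeft, indicator_of_notMem hy]
  bound := fun x => by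
    by_cases hx : x ∈ Ioo a b
    · rw [centerLeft, indicator_of_mem hx]
      have h1 := h.bound x ⟨by linarith [hx.1], by linarith [hx.2]⟩
      have h2 := h.abs_limR_le hf h0 ha (by linarith)
      exact (abs_sub _ _).trans (by linarith)
    · rw [centerLeft, indicator_of_notMem hx, abs_zero]
      linarith [h.nonneg]
  lint := fun x hx => by
    refine le_trans ?_ ((h.lint x ⟨by linarith [hx.1], by linarith [hx.2]⟩).trans
      (ENNReal.ofReal_le_ofReal (by linarith [h.nonneg])))
    refine le_trans (le_of_eq ?_) (lintegral_mono_set (Ioo_subset_Ioo_left ha))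
    refine setLIntegral_congr_fun measurableSet_Ioo fun y hy => ?_
    rw [centerLeft, indicator_of_mem hx,
      indicator_of_mem (show y ∈ Ioo a b from ⟨hy.1, hy.2.trans hx.2⟩), sub_sub_sub_cancel_right]

end BddW

/-! ### Pointwise, `L¹` and `L²` bounds for Weyl derivatives -/

/-- The boundary term has its own constant `C₂`, so the estimate serves both a merely bounded `F`,
with `C₂` growing like `(x - a)^(-α)`, and a Hölder `F` that tends to zero at the endpoint. -/
lemma abs_weylLeft_le {α a b x C₁ C₂ : ℝ} {F : ℝ → ℝ} (h0 : 0 < α) (h1 : α < 1)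
    (hF : Measurable F) (hF0 : ∀ y ≤ a, F y = 0) (hx : x ∈ Ioo a b) (hC₁ : 0 ≤ C₁)
    (hl : ∫⁻ y in Ioo a x, ENNReal.ofReal (|F x - F y| / (x - y) ^ (α + 1)) ≤ ENNReal.ofReal C₁)
    (hb : |F x| * (x - a) ^ (-α) ≤ C₂) :
    |weylLeft α a b F x| ≤ α / Real.Gamma (1 - α) * (C₁ + C₂ / α) := by
  have hΓ := Real.Gamma_pos_of_pos (show 0 < 1 - α by linarith)
  have hC₂ : 0 ≤ C₂ := le_trans (by have := Real.rpow_nonneg (by linarith [hx.1] : 0 ≤ x - a) (-α)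
                                    positivity) hb
  rw [weylLeft_eq_marchaud h0 hF hF0 hx (hl.trans_lt ENNReal.ofReal_lt_top), abs_mul,
    abs_of_nonneg (by positivity)]
  refine mul_le_mul_of_nonneg_left ?_ (by positivity)
  rw [← Real.norm_eq_abs, marchaud]
  refine (norm_integral_le_lintegral_norm _).trans ?_
  refine ENNReal.toReal_le_of_le_ofReal (by positivity) ?_
  have e : ∫⁻ r in Ioi 0, ENNReal.ofReal ‖(F x - F (x - r)) * r ^ (-α - 1)‖ =
      ∫⁻ r in Ioi 0, ENNReal.ofReal (|F x - F (x - r)| * r ^ (-α - 1)) := by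
    refine setLIntegral_congr_fun measurableSet_Ioi fun r hr => ?_
    rw [norm_mul, Real.norm_eq_abs, Real.norm_of_nonneg (Real.rpow_nonneg (le_of_lt hr) _)]
  rw [e, lintegral_marchaud_eq h0 hF0 hx.1, ENNReal.ofReal_add hC₁ (by positivity)]
  refine add_le_add hl (ENNReal.ofReal_le_ofReal ?_)
  rw [← mul_div_assoc]
  exact div_le_div_of_nonneg_right hb h0.le

namespace HasBddMarchaud

variable {α a b C : ℝ} {F : ℝ → ℝ}

lemma abs_weylLeft_le (h : HasBddMarchaud α a b C F) (h0 : 0 < α) (h1 : α < 1) {x : ℝ}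
    (hx : x ∈ Ioo a b) :
    |weylLeft α a b F x| ≤ α / Real.Gamma (1 - α) * (C + C * ((x - a) ^ (-α) / α)) := by
  rw [← mul_div_assoc]
  exact FracEq.abs_weylLeft_le h0 h1 h.meas h.eq_zero_of_le hx h.nonneg (h.lint x hx)
    (mul_le_mul_of_nonneg_right (h.bound x) (Real.rpow_nonneg (by linarith [hx.1]) _))

/-- The singularity `(x - a)^(-α)` is square integrable because `2 * α < 1`. -/
lemma memLp_two_weylLeft (h : HasBddMarchaud α a b C F) (h0 : 0 < α) (h1 : α < 1 / 2) :
    MemLp (weylLeft α a b F) 2 (volume.restrict (Ioo a b)) := by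
  have hr : MemLp (fun x : ℝ => (x - a) ^ (-α)) 2 (volume.restrict (Ioo a b)) := by
    rw [memLp_two_iff_integrable_sq (Measurable.aestronglyMeasurable (by fun_prop))]
    have := (integrableOn_bound (α := 2 * α) (a := a) (b := b) (by linarith) 0 (2 * α))
    refine this.congr_fun (fun x hx => ?_) measurableSet_Ioo
    simp only
    rw [← Real.rpow_natCast, ← Real.rpow_mul (by linarith [hx.1]), zero_add, mul_div_cancel₀]
    · congr 1
      push_cast
      ring
    · positivity
  have hb : MemLp (fun x : ℝ => α / Real.Gamma (1 - α) * (C + C * ((x - a) ^ (-α) / α))) 2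
      (volume.restrict (Ioo a b)) := by
    have := (((hr.const_mul (C / α)).add (memLp_const C)).const_mul (α / Real.Gamma (1 - α)))
    refine this.ae_eq (Eventually.of_forall fun x => ?_)
    simp only [Pi.add_apply]
    ring
  refine hb.of_le (h.measurable_weylLeft h0).aestronglyMeasurable ?_
  filter_upwards [ae_restrict_mem measurableSet_Ioo] with x hx
  rw [Real.norm_eq_abs]
  exact (h.abs_weylLeft_le h0 (by linarith) hx).trans (le_abs_self _)

lemma integral_abs_weylLeft_le (h : HasBddMarchaud α a b C F) (h0 : 0 < α) (h1 : α < 1)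
    (hab : a < b) :
    ∫ x in Ioo a b, |weylLeft α a b F x| ≤
      α / Real.Gamma (1 - α) * (C * (b - a) + C * ((b - a) ^ (1 - α) / (1 - α) / α)) := by
  have hle : ∫ x in Ioo a b, |weylLeft α a b F x| ≤
      ∫ x in Ioo a b, α / Real.Gamma (1 - α) * (C + C * ((x - a) ^ (-α) / α)) :=
    setIntegral_mono_on (h.integrable_weylLeft h0 h1).abs.integrableOn
      ((integrableOn_bound h1 C C).const_mul _) measurableSet_Ioo
      fun x hx => h.abs_weylLeft_le h0 h1 hx
  refine hle.trans (le_of_eq ?_)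
  have hi : IntegrableOn (fun x => C * ((x - a) ^ (-α) / α)) (Ioo a b) := by
    simpa using integrableOn_bound (a := a) (b := b) h1 0 C
  have hc : Integrable (fun _ : ℝ => C) (volume.restrict (Ioo a b)) :=
    integrableOn_const measure_Ioo_lt_top.ne
  rw [integral_const_mul, integral_add hc hi,
    integral_const_mul, integral_div, setIntegral_const, smul_eq_mul, Measure.real,
    Real.volume_Ioo, ENNReal.toReal_ofReal (by linarith)]
  have : ∫ x in Ioo a b, (x - a) ^ (-α) = (b - a) ^ (1 - α) / (1 - α) := by
    rw [← integral_Ioc_eq_integral_Ioo, ← intervalIntegral.integral_of_le hab.le,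
      intervalIntegral.integral_comp_sub_right (fun x => x ^ (-α)), sub_self,
      integral_rpow (Or.inl (by linarith)), Real.zero_rpow (by linarith), sub_zero]
    rw [show -α + 1 = 1 - α by ring]
  rw [this]
  ring

end HasBddMarchaud


/-! ### Hölder continuous integrators -/

/-- `g` is Hölder continuous on `ℝ` with exponent `β` and constant `Λ`. -/
def IsHolder (β Λ : ℝ) (g : ℝ → ℝ) : Prop := ∀ x y, |g x - g y| ≤ Λ * |x - y| ^ β

/-- `∫_c^x |u(y)| (x - y)^(-γ-1) dy` is finite if `|u(y)| ≤ Λ (x - y)^β` with `β > γ`. -/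
lemma lintegral_div_rpow_le {β γ Λ c x : ℝ} {u : ℝ → ℝ} (hγ : γ < β) (hΛ : 0 ≤ Λ)
    (hcx : c ≤ x) (h1 : x - c ≤ 1) (hu : ∀ y ∈ Ioo c x, u y ≤ Λ * (x - y) ^ β) :
    ∫⁻ y in Ioo c x, ENNReal.ofReal (u y / (x - y) ^ (γ + 1)) ≤
      ENNReal.ofReal (Λ / (β - γ)) := by
  have hle : ∫⁻ y in Ioo c x, ENNReal.ofReal (u y / (x - y) ^ (γ + 1)) ≤
      ∫⁻ y in Ioo c x, ENNReal.ofReal (Λ * (x - y) ^ (β - γ - 1)) := by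
    refine setLIntegral_mono' measurableSet_Ioo fun y hy => ENNReal.ofReal_le_ofReal ?_
    have hxy : 0 < x - y := by linarith [hy.2]
    rw [div_le_iff₀ (Real.rpow_pos_of_pos hxy _), mul_assoc, ← Real.rpow_add hxy]
    refine (hu y hy).trans (le_of_eq ?_)
    congr 2
    ring
  refine hle.trans ?_
  have hcx' : 0 ≤ x - c := by linarith
  have hi : IntervalIntegrable (fun r : ℝ => Λ * r ^ (β - γ - 1)) volume 0 (x - c) :=
    (intervalIntegral.intervalIntegrable_rpow' (by linarith)).const_mul Λ
  have e := lintegral_Ioo_sub_left (fun y => ENNReal.ofReal (Λ * (x - y) ^ (β - γ - 1))) c x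
  simp only [sub_sub_cancel] at e
  rw [← e, ← setLIntegral_congr (Ioo_ae_eq_Ioc (μ := volume)).symm,
    ← ofReal_integral_eq_lintegral_ofReal hi.1,
    ← intervalIntegral.integral_of_le hcx', intervalIntegral.integral_const_mul,
    integral_rpow (Or.inl (by linarith)), Real.zero_rpow (by linarith), sub_zero,
    ← mul_div_assoc]
  · refine ENNReal.ofReal_le_ofReal ?_
    rw [show β - γ - 1 + 1 = β - γ by ring]
    refine div_le_div_of_nonneg_right ?_ (by linarith)
    exact mul_le_of_le_one_right hΛ (Real.rpow_le_one hcx' h1 (by linarith))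
  · filter_upwards [ae_restrict_mem measurableSet_Ioc] with r hr
    exact mul_nonneg hΛ (Real.rpow_nonneg hr.1.le _)

/-- The reflection `x ↦ -x` exchanges the two sides, so right-sided facts follow from left-sided
ones for `u ↦ f (-u)` on `(-b, -a)`. -/
lemma weylRight_eq_weylLeft_neg (α a b : ℝ) (f : ℝ → ℝ) (x : ℝ) :
    weylRight α a b f x = weylLeft α (-b) (-a) (fun u => f (-u)) (-x) := by
  by_cases hx : x ∈ Ioo a b
  · rw [weylRight, weylLeft, indicator_of_mem hx, indicator_of_mem
      (show -x ∈ Ioo (-b) (-a) from ⟨neg_lt_neg hx.2, neg_lt_neg hx.1⟩)]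
    have := intervalIntegral.integral_comp_neg (a := -b) (b := -x)
      (fun y => (f x - f y) / (y - x) ^ (α + 1))
    rw [neg_neg, neg_neg] at this
    rw [← this]
    simp only [neg_neg]
    congr 3
    · rw [show -x - -b = b - x by ring]
    · congr 2
      ext y
      rw [show -y - x = -x - y by ring]
  · rw [weylRight, weylLeft, indicator_of_notMem hx, indicator_of_notMem]
    exact fun h => hx ⟨by linarith [h.2], by linarith [h.1]⟩

lemma rlRight_eq_rlLeft_neg (α b : ℝ) (f : ℝ → ℝ) (x : ℝ) :
    rlRight α b f x = rlLeft α (-b) (fun u => f (-u)) (-x) := by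
  rw [rlRight, rlLeft]
  have := intervalIntegral.integral_comp_neg (a := -b) (b := -x)
    (fun y => f y / (y - x) ^ (1 - α))
  rw [neg_neg, neg_neg] at this
  rw [← this]
  congr 2
  ext y
  rw [show -y - x = -x - y by ring]

namespace IsHolder

variable {β Λ : ℝ} {g : ℝ → ℝ}

lemma nonneg (h : IsHolder β Λ g) : 0 ≤ Λ := by
  have := (abs_nonneg _).trans (h 0 1)
  simpa using this

lemma continuous (h : IsHolder β Λ g) (hβ : 0 < β) : Continuous g := by
  rw [continuous_iff_continuousAt]
  intro x
  rw [ContinuousAt, tendsto_iff_dist_tendsto_zero]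
  have hlim : Tendsto (fun y => Λ * |y - x| ^ β) (𝓝 x) (𝓝 0) := by
    have : ContinuousAt (fun y => Λ * |y - x| ^ β) x :=
      (((continuousAt_id.sub continuousAt_const).abs).rpow_const (Or.inr hβ.le)).const_mul Λ
    have h2 := this.tendsto
    rwa [sub_self, abs_zero, Real.zero_rpow hβ.ne', mul_zero] at h2
  exact squeeze_zero (fun _ => dist_nonneg) (fun y => h y x) hlim

lemma limL_eq (h : IsHolder β Λ g) (hβ : 0 < β) (b : ℝ) : limL g b = g b :=
  ((h.continuous hβ).continuousAt.tendsto.mono_left nhdsWithin_le_nhds).limUnder_eq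

lemma limR_eq (h : IsHolder β Λ g) (hβ : 0 < β) (b : ℝ) : limR g b = g b :=
  ((h.continuous hβ).continuousAt.tendsto.mono_left nhdsWithin_le_nhds).limUnder_eq

lemma centerRight_eq (h : IsHolder β Λ g) (hβ : 0 < β) (a b : ℝ) :
    centerRight a b g = (Ioo a b).indicator fun x => g x - g b := by
  rw [centerRight, h.limL_eq hβ]

lemma neg_mem_Ioo {a b u : ℝ} : -u ∈ Ioo a b ↔ u ∈ Ioo (-b) (-a) := by
  constructor <;> intro h <;> constructor <;> linarith [h.1, h.2]

lemma centerRight_neg_of_mem (h : IsHolder β Λ g) (hβ : 0 < β) {a b u : ℝ}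
    (hu : u ∈ Ioo (-b) (-a)) : centerRight a b g (-u) = g (-u) - g b := by
  rw [h.centerRight_eq hβ, indicator_of_mem (neg_mem_Ioo.2 hu)]

lemma lintegral_centerRight_le (h : IsHolder β Λ g) {γ : ℝ} (hγ0 : 0 < γ) (hγ : γ < β)
    {a b : ℝ} (hb : b - a ≤ 1) {u : ℝ} (hu : u ∈ Ioo (-b) (-a)) :
    ∫⁻ v in Ioo (-b) u, ENNReal.ofReal
      (|centerRight a b g (-u) - centerRight a b g (-v)| / (u - v) ^ (γ + 1)) ≤
        ENNReal.ofReal (Λ / (β - γ)) := by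
  refine lintegral_div_rpow_le hγ h.nonneg hu.1.le (by linarith [hu.2]) fun v hv => ?_
  rw [h.centerRight_neg_of_mem (by linarith) hu,
    h.centerRight_neg_of_mem (by linarith) ⟨hv.1, hv.2.trans hu.2⟩, sub_sub_sub_cancel_right]
  refine (h _ _).trans (le_of_eq ?_)
  rw [show -u - -v = -(u - v) by ring, abs_neg, abs_of_pos (by linarith [hv.2])]

lemma hasBddMarchaud (h : IsHolder β Λ g) (hβ : β ≤ 1) {γ : ℝ} (hγ0 : 0 < γ) (hγ : γ < β)
    {a b : ℝ} (hb : b - a ≤ 1) :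
    HasBddMarchaud γ (-b) (-a) (Λ / (β - γ)) (fun u => centerRight a b g (-u)) where
  meas := by
    rw [h.centerRight_eq (by linarith)]
    have := (h.continuous (by linarith)).measurable
    exact (((this.sub_const _).indicator measurableSet_Ioo).comp measurable_neg)
  supp := fun u hu => by
    rw [centerRight, indicator_of_notMem (fun h => hu (neg_mem_Ioo.1 h))]
  bound := fun u => by
    have hΛ := h.nonneg
    have h2 : Λ ≤ Λ / (β - γ) := by
      rw [le_div_iff₀ (by linarith)]
      nlinarith
    by_cases hu : u ∈ Ioo (-b) (-a)
    · rw [h.centerRight_neg_of_mem (by linarith) hu]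
      refine (h _ _).trans (le_trans ?_ h2)
      refine mul_le_of_le_one_right hΛ (Real.rpow_le_one (abs_nonneg _) ?_ (by linarith))
      rw [abs_le]
      constructor <;> linarith [hu.1, hu.2]
    · rw [centerRight, indicator_of_notMem (fun h => hu (neg_mem_Ioo.1 h)), abs_zero]
      exact hΛ.trans h2
  lint := fun u hu => h.lintegral_centerRight_le hγ0 hγ hb hu

/-- The constant in the bound for the right-sided Weyl derivative of a Hölder function. -/
def weylConst (β γ : ℝ) : ℝ := γ / Real.Gamma (1 - γ) * (1 / (β - γ) + 1 / γ)

lemma weylConst_nonneg {β γ : ℝ} (hγ0 : 0 < γ) (hγ1 : γ < 1) (hγ : γ < β) :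
    0 ≤ weylConst β γ := by
  have := Real.Gamma_pos_of_pos (show 0 < 1 - γ by linarith)
  have h2 : 0 < β - γ := by linarith
  unfold weylConst
  positivity

/-- For a Hölder function the boundary term `|g x - g b| (b - x)^(-γ) ≤ Λ (b - x)^(β - γ)` stays
bounded. The derivative is thus bounded and can be paired with an `L¹` left derivative. -/
lemma abs_weylRight_le (h : IsHolder β Λ g) (hβ : β ≤ 1) {γ : ℝ} (hγ0 : 0 < γ) (hγ : γ < β)
    {a b : ℝ} (hb : b - a ≤ 1) (x : ℝ) :
    |weylRight γ a b (centerRight a b g) x| ≤ weylConst β γ * Λ := by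
  have hΛ := h.nonneg
  by_cases hx : x ∈ Ioo a b
  · rw [weylRight_eq_weylLeft_neg]
    have hx' : -x ∈ Ioo (-b) (-a) := neg_mem_Ioo.1 (by simpa using hx)
    have hM := h.hasBddMarchaud hβ hγ0 hγ hb
    have := FracEq.abs_weylLeft_le (C₁ := Λ / (β - γ)) (C₂ := Λ) hγ0 (by linarith)
      hM.meas hM.eq_zero_of_le hx'
      (div_nonneg hΛ (by linarith)) (hM.lint _ hx') ?_
    · refine this.trans (le_of_eq ?_)
      unfold weylConst
      ring
    · have hbx : 0 < b - x := by linarith [hx.2]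
      rw [h.centerRight_neg_of_mem (by linarith) hx', neg_neg, show -x - -b = b - x by ring]
      refine (mul_le_mul_of_nonneg_right (h x b) (Real.rpow_nonneg hbx.le _)).trans ?_
      rw [abs_sub_comm, abs_of_pos hbx, mul_assoc, ← Real.rpow_add hbx]
      exact mul_le_of_le_one_right hΛ (Real.rpow_le_one hbx.le (by linarith [hx.1]) (by linarith))
  · rw [weylRight, indicator_of_notMem hx, abs_zero]
    exact mul_nonneg (weylConst_nonneg hγ0 (by linarith) hγ) hΛ

lemma measurable_weylRight (h : IsHolder β Λ g) (hβ : β ≤ 1) {γ : ℝ} (hγ0 : 0 < γ) (hγ : γ < β)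
    {a b : ℝ} (hb : b - a ≤ 1) : Measurable (weylRight γ a b (centerRight a b g)) := by
  have : weylRight γ a b (centerRight a b g) = fun x =>
      weylLeft γ (-b) (-a) (fun u => centerRight a b g (-u)) (-x) := by
    ext x
    rw [weylRight_eq_weylLeft_neg]
  rw [this]
  exact ((h.hasBddMarchaud hβ hγ0 hγ hb).measurable_weylLeft hγ0).comp measurable_neg

lemma memRlRight (h : IsHolder β Λ g) (hβ : β ≤ 1) {γ : ℝ} (hγ0 : 0 < γ) (hγ : γ < β)
    {a b : ℝ} (hb : b - a ≤ 1) : MemRlRight γ 2 a b (centerRight a b g) := by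
  refine ⟨weylRight γ a b (centerRight a b g), ?_, ?_⟩
  · exact MemLp.of_bound (h.measurable_weylRight hβ hγ0 hγ hb).aestronglyMeasurable
      (weylConst β γ * Λ) (Eventually.of_forall fun x => h.abs_weylRight_le hβ hγ0 hγ hb x)
  · have := (h.hasBddMarchaud hβ hγ0 hγ hb).ae_eq_rlLeft_weylLeft hγ0 (by linarith)
    rw [ae_restrict_iff' measurableSet_Ioo] at this ⊢
    have h2 := (Measure.measurePreserving_neg (volume : Measure ℝ)).quasiMeasurePreserving.ae this
    filter_upwards [h2] with x hx hxab
    have hx' : -x ∈ Ioo (-b) (-a) := neg_mem_Ioo.1 (by simpa using hxab)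
    have h3 := hx hx'
    rw [neg_neg] at h3
    rw [h3, rlRight_eq_rlLeft_neg]
    congr 1
    ext u
    rw [weylRight_eq_weylLeft_neg, neg_neg]

end IsHolder

/-! ### Existence and size of the generalized Stieltjes integral -/

/-- Existence of the generalized Stieltjes integral. -/
theorem stieltjesIntegrable_of_bddW {α β Λ C a b : ℝ} {f g : ℝ → ℝ} (h0 : 0 < α) (h1 : α < 1 / 2)
    (hβ : 1 - α < β) (hβ1 : β ≤ 1) (hf : Measurable f) (hfC : BddW α f C) (hg : IsHolder β Λ g)
    (ha : 0 ≤ a) (hab : a < b) (hb : b ≤ 1) : StieltjesIntegrable α f g a b := by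
  have hgc := hg.continuous (by linarith)
  refine ⟨hfC.exists_tendsto_right hf h0 ha (by linarith),
    ⟨g a, hgc.continuousAt.tendsto.mono_left nhdsWithin_le_nhds⟩,
    ⟨g b, hgc.continuousAt.tendsto.mono_left nhdsWithin_le_nhds⟩, 2, 2, by norm_num, by norm_num,
    by norm_num, ?_, hg.memRlRight hβ1 (by linarith) hβ (by linarith)⟩
  have hM := hfC.hasBddMarchaud hf h0 ha hab hb
  refine ⟨weylLeft α a b (centerLeft a b f), ?_, hM.ae_eq_rlLeft_weylLeft h0 (by linarith)⟩
  simpa using hM.memLp_two_weylLeft h0 h1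

/-- The constant in the bound for the generalized Stieltjes integral. -/
def stieltjesConst (α β : ℝ) : ℝ :=
  IsHolder.weylConst β (1 - α) * (α / Real.Gamma (1 - α) * (2 + 2 / (1 - α) / α)) + 1

lemma stieltjesConst_pos {α β : ℝ} (h0 : 0 < α) (h1 : α < 1) (hβ : 1 - α < β) :
    0 < stieltjesConst α β := by
  have := IsHolder.weylConst_nonneg (β := β) (γ := 1 - α) (by linarith) (by linarith) hβ
  have h2 := Real.Gamma_pos_of_pos (show 0 < 1 - α by linarith)
  have h3 : 0 < 1 - α := by linarith
  unfold stieltjesConst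
  positivity

lemma stieltjes_eq_of_lt {α a b : ℝ} (f g : ℝ → ℝ) (hab : a < b) :
    stieltjes α f g a b = -(∫ x in Ioo a b, weylLeft α a b (centerLeft a b f) x *
        weylRight (1 - α) a b (centerRight a b g) x) + limR f a * (limL g b - limR g a) := by
  rw [stieltjes, if_pos hab, intervalIntegral.integral_of_le hab.le, integral_Ioc_eq_integral_Ioo]

/-- Bound for the generalized Stieltjes integral. -/
theorem abs_stieltjes_le {α β Λ C a b : ℝ} {f g : ℝ → ℝ} (h0 : 0 < α) (h1 : α < 1 / 2)
    (hβ : 1 - α < β) (hβ1 : β ≤ 1) (hf : Measurable f) (hfC : BddW α f C) (hg : IsHolder β Λ g)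
    (ha : 0 ≤ a) (hab : a < b) (hb : b ≤ 1) :
    |stieltjes α f g a b| ≤ stieltjesConst α β * C * Λ * (b - a) ^ (1 - α) := by
  have hM := hfC.hasBddMarchaud hf h0 ha hab hb
  have hΛ := hg.nonneg
  have hC := hfC.nonneg
  have hba : 0 < b - a := by linarith
  have hW := IsHolder.weylConst_nonneg (β := β) (γ := 1 - α) (by linarith) (by linarith) hβ
  have hΓ := Real.Gamma_pos_of_pos (show 0 < 1 - α by linarith)
  have h1α : 0 < 1 - α := by linarith
  rw [stieltjes_eq_of_lt _ _ hab]
  have e1 : |∫ x in Ioo a b, weylLeft α a b (centerLeft a b f) x *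
        weylRight (1 - α) a b (centerRight a b g) x| ≤
      (∫ x in Ioo a b, |weylLeft α a b (centerLeft a b f) x|) *
        (IsHolder.weylConst β (1 - α) * Λ) := by
    rw [← integral_mul_const, ← Real.norm_eq_abs]
    refine norm_integral_le_of_norm_le
      ((hM.integrable_weylLeft h0 (by linarith)).abs.integrableOn.mul_const _)
      (Eventually.of_forall fun x => ?_)
    rw [norm_mul, Real.norm_eq_abs, Real.norm_eq_abs]
    exact mul_le_mul_of_nonneg_left
      (hg.abs_weylRight_le hβ1 (by linarith) hβ (by linarith) x) (abs_nonneg _)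
  have e2 := hM.integral_abs_weylLeft_le h0 (by linarith) hab
  -- As `b - a ≤ 1`, the powers `1` and `β` of the length are dominated by the power `1 - α`, which
  -- comes from integrating the singularity `(x - a)^(-α)`.
  have hpow : b - a ≤ (b - a) ^ (1 - α) := by
    have := Real.rpow_le_rpow_of_exponent_ge hba (by linarith) (show 1 - α ≤ 1 by linarith)
    rwa [Real.rpow_one] at this
  have hp0 : 0 ≤ (b - a) ^ (1 - α) := Real.rpow_nonneg hba.le _
  have e3 : ∫ x in Ioo a b, |weylLeft α a b (centerLeft a b f) x| ≤
      α / Real.Gamma (1 - α) * (2 + 2 / (1 - α) / α) * C * (b - a) ^ (1 - α) := by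
    refine e2.trans ?_
    have : 2 * C * (b - a) + 2 * C * ((b - a) ^ (1 - α) / (1 - α) / α) ≤
        (2 + 2 / (1 - α) / α) * C * (b - a) ^ (1 - α) := by
      have e : (2 + 2 / (1 - α) / α) * C * (b - a) ^ (1 - α) =
        2 * C * (b - a) ^ (1 - α) + 2 * C * ((b - a) ^ (1 - α) / (1 - α) / α) := by ring
      rw [e]
      have := mul_le_mul_of_nonneg_left hpow (show 0 ≤ 2 * C by linarith)
      linarith
    have h' := mul_le_mul_of_nonneg_left this (show 0 ≤ α / Real.Gamma (1 - α) by positivity)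
    refine h'.trans (le_of_eq (by ring))
  have e4 : |limR f a * (limL g b - limR g a)| ≤ C * Λ * (b - a) ^ (1 - α) := by
    rw [abs_mul, hg.limL_eq (by linarith), hg.limR_eq (by linarith), mul_assoc]
    refine mul_le_mul (hfC.abs_limR_le hf h0 ha (by linarith)) ?_ (abs_nonneg _) hC
    refine (hg b a).trans (mul_le_mul_of_nonneg_left ?_ hΛ)
    rw [abs_of_pos hba]
    exact Real.rpow_le_rpow_of_exponent_ge hba (by linarith) hβ.le
  have e5 := mul_le_mul_of_nonneg_right e3 (mul_nonneg hW hΛ)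
  refine (abs_add_le _ _).trans ?_
  rw [abs_neg]
  refine (add_le_add (e1.trans e5) e4).trans (le_of_eq ?_)
  unfold stieltjesConst
  ring


/-! ### Approximation of the generalized Stieltjes integral -/

/-- The Steklov average `h⁻¹ ∫_x^{x+h} g`. -/
def stek (g : ℝ → ℝ) (h x : ℝ) : ℝ := h⁻¹ * ∫ t in x..x + h, g t

/-- The difference quotient, which is the derivative of the Steklov average. -/
def diffQuot (g : ℝ → ℝ) (h x : ℝ) : ℝ := h⁻¹ * (g (x + h) - g x)

lemma hasDerivAt_stek {g : ℝ → ℝ} (hg : Continuous g) (h x : ℝ) :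
    HasDerivAt (stek g h) (diffQuot g h x) x := by
  have e : stek g h = fun x => h⁻¹ * ((∫ t in (0 : ℝ)..x + h, g t) - ∫ t in (0 : ℝ)..x, g t) := by
    ext x
    rw [stek, intervalIntegral.integral_interval_sub_left (hg.intervalIntegrable _ _)
      (hg.intervalIntegrable _ _)]
  rw [e]
  refine HasDerivAt.const_mul _ (HasDerivAt.sub ?_ ?_)
  · have := (intervalIntegral.integral_hasDerivAt_right (hg.intervalIntegrable 0 (x + h))
      (hg.stronglyMeasurableAtFilter _ _) hg.continuousAt)
    exact HasDerivAt.comp_add_const x h this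
  · exact intervalIntegral.integral_hasDerivAt_right (hg.intervalIntegrable 0 x)
      (hg.stronglyMeasurableAtFilter _ _) hg.continuousAt

lemma continuous_diffQuot {g : ℝ → ℝ} (hg : Continuous g) (h : ℝ) :
    Continuous (diffQuot g h) := by
  unfold diffQuot
  fun_prop

lemma integral_diffQuot {g : ℝ → ℝ} (hg : Continuous g) (h a b : ℝ) :
    ∫ x in a..b, diffQuot g h x = stek g h b - stek g h a :=
  intervalIntegral.integral_eq_sub_of_hasDerivAt (fun x _ => hasDerivAt_stek hg h x)
    ((continuous_diffQuot hg h).intervalIntegrable _ _)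

namespace IsHolder

variable {β Λ : ℝ} {g : ℝ → ℝ}

lemma abs_diffQuot_le (hg : IsHolder β Λ g) {h : ℝ} (hh : 0 < h) (x : ℝ) :
    |diffQuot g h x| ≤ h⁻¹ * (Λ * h ^ β) := by
  rw [diffQuot, abs_mul, abs_of_pos (inv_pos.2 hh)]
  refine mul_le_mul_of_nonneg_left ((hg _ _).trans (le_of_eq ?_)) (inv_pos.2 hh).le
  rw [add_sub_cancel_left, abs_of_pos hh]

/-- An average of translates of `g` keeps the constant `Λ`. This uniformity in `h` supplies the
dominating functions when `h → 0`. -/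
lemma stek (hg : IsHolder β Λ g) (hβ : 0 < β) {h : ℝ} (hh : 0 < h) :
    IsHolder β Λ (stek g h) := by
  intro x y
  have hgc := hg.continuous hβ
  have e : ∀ x, FracEq.stek g h x = h⁻¹ * ∫ t in (0 : ℝ)..h, g (x + t) := by
    intro x
    rw [FracEq.stek, intervalIntegral.integral_comp_add_left (fun t => g t), add_zero]
  rw [e, e, ← mul_sub, ← intervalIntegral.integral_sub
    (Continuous.intervalIntegrable (by fun_prop) _ _)
    (Continuous.intervalIntegrable (by fun_prop) _ _), abs_mul, abs_of_pos (inv_pos.2 hh),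
    inv_mul_le_iff₀ hh]
  have := intervalIntegral.norm_integral_le_of_norm_le_const (a := 0) (b := h)
    (f := fun t => g (x + t) - g (y + t)) (C := Λ * |x - y| ^ β) fun t _ => by
      rw [Real.norm_eq_abs]
      refine (hg _ _).trans (le_of_eq ?_)
      rw [add_sub_add_right_eq_sub]
  rw [sub_zero, abs_of_pos hh, Real.norm_eq_abs] at this
  linarith

lemma abs_stek_sub_le (hg : IsHolder β Λ g) (hβ : 0 < β) {h : ℝ} (hh : 0 < h) (x : ℝ) :
    |FracEq.stek g h x - g x| ≤ Λ * h ^ β := by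
  have hgc := hg.continuous hβ
  have e : FracEq.stek g h x - g x = h⁻¹ * ∫ t in x..x + h, (g t - g x) := by
    rw [FracEq.stek, intervalIntegral.integral_sub (hgc.intervalIntegrable _ _)
      (continuous_const.intervalIntegrable _ _), intervalIntegral.integral_const, mul_sub]
    simp only [add_sub_cancel_left, smul_eq_mul]
    rw [inv_mul_cancel_left₀ hh.ne']
  rw [e, abs_mul, abs_of_pos (inv_pos.2 hh), inv_mul_le_iff₀ hh]
  have := intervalIntegral.norm_integral_le_of_norm_le_const (a := x) (b := x + h)
    (f := fun t => g t - g x) (C := Λ * h ^ β) fun t ht => by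
      rw [uIoc_of_le (by linarith)] at ht
      rw [Real.norm_eq_abs]
      refine (hg _ _).trans (mul_le_mul_of_nonneg_left ?_ hg.nonneg)
      refine Real.rpow_le_rpow (abs_nonneg _) ?_ hβ.le
      rw [abs_of_pos (by linarith [ht.1])]
      linarith [ht.2]
  rw [add_sub_cancel_left, abs_of_pos hh, Real.norm_eq_abs] at this
  linarith

/-- The right-sided Weyl derivative of a Steklov average is a fractional integral. -/
lemma weylRight_stek (hg : IsHolder β Λ g) (hβ : β ≤ 1) {α : ℝ} (h1 : α < 1) (h0 : 0 < α)
    (hαβ : 1 - α < β) {a b : ℝ} (hb : b - a ≤ 1) {h : ℝ} (hh : 0 < h) {x : ℝ}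
    (hx : x ∈ Ioo a b) :
    weylRight (1 - α) a b (centerRight a b (FracEq.stek g h)) x =
      -rlRight α b (diffQuot g h) x := by
  have hβ0 : 0 < β := by linarith
  have hgc := hg.continuous hβ0
  have hs : IsHolder β Λ (FracEq.stek g h) := hg.stek hβ0 hh
  have hM := hs.hasBddMarchaud hβ (γ := 1 - α) (by linarith) hαβ hb
  have hx' : -x ∈ Ioo (-b) (-a) := neg_mem_Ioo.1 (by simpa using hx)
  rw [weylRight_eq_weylLeft_neg, hM.weylLeft_eq (by linarith), indicator_of_mem hx',
    rlRight_eq_rlLeft_neg]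
  set u := -x with hu
  set F : ℝ → ℝ := (Ioo (-b) (-a)).indicator fun y => -diffQuot g h (-y) with hF
  have hFm : Measurable F :=
    (((continuous_diffQuot hgc h).measurable.comp measurable_neg).neg).indicator measurableSet_Ioo
  have hF0 : ∀ y ∉ Ioo (-b) (-a), F y = 0 := fun y hy => by rw [hF, indicator_of_notMem hy]
  have hFb : ∀ y, |F y| ≤ h⁻¹ * (Λ * h ^ β) := fun y => by
    by_cases hy : y ∈ Ioo (-b) (-a)
    · rw [hF, indicator_of_mem hy, abs_neg]
      exact hg.abs_diffQuot_le hh _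
    · rw [hF0 y hy, abs_zero]
      have := hg.nonneg
      positivity
  have hFi : Integrable F := integrable_of_abs_le_of_support hFm hF0 hFb
  -- The reflected centred average is the primitive of `F`, including for `w ≤ -b`, where both sides
  -- see zero. Its Marchaud increments are therefore integrals of `F`, and
  -- `integral_Ioi_setIntegral_mul_rpow` turns them into a fractional integral of order `α`.
  have hprim : ∀ v ∈ Ioo (-b) (-a), ∀ w ≤ v,
      centerRight a b (FracEq.stek g h) (-v) - centerRight a b (FracEq.stek g h) (-w) =
        ∫ y in Ico w v, F y := by
    have hprim0 : ∀ v ∈ Ioo (-b) (-a),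
        ∫ y in Iio v, F y = centerRight a b (FracEq.stek g h) (-v) := by
      intro v hv
      rw [hs.centerRight_neg_of_mem hβ0 hv, ← neg_sub, ← integral_diffQuot hgc,
        ← intervalIntegral.integral_neg]
      have e := intervalIntegral.integral_comp_neg (a := -b) (b := v)
        (fun y => -diffQuot g h y)
      rw [neg_neg] at e
      rw [← e, intervalIntegral.integral_of_le hv.1.le, integral_Ioc_eq_integral_Ioo,
        ← integral_indicator measurableSet_Ioo, ← integral_indicator measurableSet_Iio]
      congr 1
      ext y
      by_cases hy : y ∈ Ioo (-b) v
      · rw [indicator_of_mem hy, indicator_of_mem (show y ∈ Iio v from hy.2), hF,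
          indicator_of_mem (show y ∈ Ioo (-b) (-a) from ⟨hy.1, hy.2.trans hv.2⟩)]
      · rw [indicator_of_notMem hy]
        by_cases hyv : y < v
        · rw [indicator_of_mem (show y ∈ Iio v from hyv), hF0]
          exact fun h => hy ⟨h.1, hyv⟩
        · rw [indicator_of_notMem (show y ∉ Iio v from hyv)]
    intro v hv w hw
    have hsplit : ∫ y in Iio v, F y = (∫ y in Iio w, F y) + ∫ y in Ico w v, F y := by
      rw [← setIntegral_union (s := Iio w) (t := Ico w v)
        (Set.disjoint_left.2 fun t h1 h2 => absurd h2.1 (not_le.2 h1))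
        measurableSet_Ico hFi.integrableOn hFi.integrableOn, Iio_union_Ico_eq_Iio hw]
    have ev := hprim0 v hv
    by_cases hwb : -b < w
    · have ew := hprim0 w ⟨hwb, hw.trans_lt hv.2⟩
      rw [← ev, ← ew, hsplit]
      ring
    · have ew : ∫ y in Iio w, F y = 0 := by
        rw [setIntegral_congr_fun (g := fun _ => 0) measurableSet_Iio fun y hy => ?_]
        · simp
        · exact hF0 y fun h => hwb (h.1.trans hy)
      rw [hM.eq_zero_of_le w (not_lt.1 hwb), ← ev, hsplit, ew]
      ring
  have hmarch : marchaud (1 - α) (fun u => centerRight a b (FracEq.stek g h) (-u)) u =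
      1 / (1 - α) * ∫ y in Iio u, F y * (u - y) ^ (-(1 - α)) := by
    rw [← integral_Ioi_setIntegral_mul_rpow (by linarith) (by linarith) hFm hF0 hFb hx'.2.le,
      marchaud]
    refine setIntegral_congr_fun measurableSet_Ioi fun r hr => ?_
    have hr' : 0 < r := hr
    rw [hprim u hx' (u - r) (by linarith)]
  rw [hmarch, rlLeft, intervalIntegral.integral_of_le hx'.1.le, integral_Ioc_eq_integral_Ioo]
  have e : ∫ y in Iio u, F y * (u - y) ^ (-(1 - α)) =
      -∫ y in Ioo (-b) u, diffQuot g h (-y) / (u - y) ^ (1 - α) := by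
    rw [← integral_neg, ← integral_indicator measurableSet_Ioo,
      ← integral_indicator measurableSet_Iio]
    congr 1
    ext y
    by_cases hy : y ∈ Ioo (-b) u
    · rw [indicator_of_mem hy, indicator_of_mem (show y ∈ Iio u from hy.2), hF,
        indicator_of_mem (show y ∈ Ioo (-b) (-a) from ⟨hy.1, hy.2.trans hx'.2⟩),
        Real.rpow_neg (by linarith [hy.2])]
      ring
    · rw [indicator_of_notMem hy]
      by_cases hyv : y < u
      · rw [indicator_of_mem (show y ∈ Iio u from hyv), hF0, zero_mul]
        exact fun h => hy ⟨h.1, hyv⟩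
      · rw [indicator_of_notMem (show y ∉ Iio u from hyv)]
  rw [e, sub_sub_cancel]
  have : 1 - α ≠ 0 := by linarith
  field_simp

end IsHolder

/-- Against a Steklov average the generalized Stieltjes integral is an ordinary integral. -/
lemma stieltjes_stek {α β Λ C a b : ℝ} {f g : ℝ → ℝ} (h0 : 0 < α) (h1 : α < 1 / 2)
    (hβ : 1 - α < β) (hβ1 : β ≤ 1) (hf : Measurable f) (hfC : BddW α f C) (hg : IsHolder β Λ g)
    (ha : 0 ≤ a) (hab : a < b) (hb : b ≤ 1) {h : ℝ} (hh : 0 < h) :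
    stieltjes α f (stek g h) a b = ∫ x in Ioo a b, f x * diffQuot g h x := by
  have hβ0 : 0 < β := by linarith
  have hM := hfC.hasBddMarchaud hf h0 ha hab hb
  have hs : IsHolder β Λ (stek g h) := hg.stek hβ0 hh
  have hgc := hg.continuous hβ0
  have hk := continuous_diffQuot hgc h
  rw [stieltjes_eq_of_lt _ _ hab, hs.limL_eq hβ0, hs.limR_eq hβ0, ← integral_diffQuot hgc,
    intervalIntegral.integral_of_le hab.le, integral_Ioc_eq_integral_Ioo]
  have e1 : ∫ x in Ioo a b, weylLeft α a b (centerLeft a b f) x *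
        weylRight (1 - α) a b (centerRight a b (stek g h)) x =
      -∫ x in Ioo a b, weylLeft α a b (centerLeft a b f) x * rlRight α b (diffQuot g h) x := by
    rw [← integral_neg]
    refine setIntegral_congr_fun measurableSet_Ioo fun x hx => ?_
    rw [hg.weylRight_stek hβ1 (by linarith) h0 hβ (by linarith) hh hx, mul_neg]
  rw [e1, neg_neg, integral_mul_rlRight h0 (hM.integrable_weylLeft h0 (by linarith))
    (fun y hy => by rw [weylLeft, indicator_of_notMem hy]) hk.measurable
    (hg.abs_diffQuot_le hh)]
  -- Inversion gives back `f - f(a+)`; the boundary term of the Stieltjes integral restores the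
  -- missing multiple of `f(a+)`.
  have e2 : ∫ x in Ioo a b, rlLeft α a (weylLeft α a b (centerLeft a b f)) x * diffQuot g h x =
      ∫ x in Ioo a b, (f x - limR f a) * diffQuot g h x := by
    refine integral_congr_ae ?_
    filter_upwards [hM.ae_eq_rlLeft_weylLeft h0 (by linarith), ae_restrict_mem measurableSet_Ioo]
      with x hx hxab
    rw [← hx, centerLeft, indicator_of_mem hxab]
  have hki : IntegrableOn (diffQuot g h) (Ioo a b) :=
    (hk.integrableOn_Icc (a := a) (b := b)).mono_set Ioo_subset_Icc_self
  have hfk : IntegrableOn (fun x => f x * diffQuot g h x) (Ioo a b) := by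
    refine Integrable.bdd_mul (c := C) hki hf.aestronglyMeasurable ?_
    filter_upwards [ae_restrict_mem measurableSet_Ioo] with x hx
    exact hfC.bound x ⟨by linarith [hx.1], by linarith [hx.2]⟩
  rw [e2, ← integral_const_mul, ← integral_add]
  · congr 1
    ext x
    ring
  · refine (hfk.sub (hki.const_mul (limR f a))).congr (Eventually.of_forall fun x => ?_)
    simp only [Pi.sub_apply]
    ring
  · exact hki.const_mul _

/-- The generalized Stieltjes integral is the limit of integrals against difference quotients. -/
theorem tendsto_integral_diffQuot {α β Λ C a b : ℝ} {f g : ℝ → ℝ} (h0 : 0 < α) (h1 : α < 1 / 2)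
    (hβ : 1 - α < β) (hβ1 : β ≤ 1) (hf : Measurable f) (hfC : BddW α f C) (hg : IsHolder β Λ g)
    (ha : 0 ≤ a) (hab : a < b) (hb : b ≤ 1) :
    Tendsto (fun n : ℕ => ∫ x in Ioo a b, f x * diffQuot g (1 / ((n : ℝ) + 1)) x) atTop
      (𝓝 (stieltjes α f g a b)) := by
  have hβ0 : 0 < β := by linarith
  have hM := hfC.hasBddMarchaud hf h0 ha hab hb
  have hn : ∀ n : ℕ, (0 : ℝ) < 1 / ((n : ℝ) + 1) := fun n => Nat.one_div_pos_of_nat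
  have hs : ∀ n : ℕ, IsHolder β Λ (stek g (1 / ((n : ℝ) + 1))) := fun n => hg.stek hβ0 (hn n)
  simp only [← stieltjes_stek h0 h1 hβ hβ1 hf hfC hg ha hab hb (hn _)]
  have hpt : ∀ x, Tendsto (fun n : ℕ => stek g (1 / ((n : ℝ) + 1)) x) atTop (𝓝 (g x)) := by
    intro x
    rw [tendsto_iff_dist_tendsto_zero]
    have hlim : Tendsto (fun n : ℕ => Λ * (1 / ((n : ℝ) + 1)) ^ β) atTop (𝓝 0) := by
      have := (tendsto_one_div_add_atTop_nhds_zero_nat (𝕜 := ℝ)).rpow_const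
        (p := β) (Or.inr hβ0.le)
      rw [Real.zero_rpow hβ0.ne'] at this
      simpa using this.const_mul Λ
    exact squeeze_zero (fun _ => dist_nonneg) (fun n => hg.abs_stek_sub_le hβ0 (hn n) x) hlim
  have hcenter : ∀ x, Tendsto (fun n : ℕ => centerRight a b (stek g (1 / ((n : ℝ) + 1))) x) atTop
      (𝓝 (centerRight a b g x)) := by
    intro x
    rw [hg.centerRight_eq hβ0]
    simp only [(hs _).centerRight_eq hβ0]
    by_cases hx : x ∈ Ioo a b
    · simp only [indicator_of_mem hx]
      exact (hpt x).sub (hpt b)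
    · simp only [indicator_of_notMem hx]
      exact tendsto_const_nhds
  -- The increments are dominated by `Λ (y - x)^(β - (1 - α) - 1)`, uniformly in the averaging
  -- length; this is integrable because `β > 1 - α`.
  have hweyl : ∀ x ∈ Ioo a b, Tendsto (fun n : ℕ => weylRight (1 - α) a b
      (centerRight a b (stek g (1 / ((n : ℝ) + 1)))) x) atTop
      (𝓝 (weylRight (1 - α) a b (centerRight a b g) x)) := by
    intro x hx
    simp only [weylRight, indicator_of_mem hx]
    refine Tendsto.const_mul _ (Tendsto.add ((hcenter x).div_const _) (Tendsto.const_mul _ ?_))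
    refine intervalIntegral.tendsto_integral_filter_of_dominated_convergence
      (fun y => Λ * (y - x) ^ (β - (1 - α) - 1)) ?_ ?_ ?_ ?_
    · refine Eventually.of_forall fun n => ?_
      have hm : Measurable (centerRight a b (stek g (1 / ((n : ℝ) + 1)))) := by
        rw [(hs n).centerRight_eq hβ0]
        exact (((hs n).continuous hβ0).measurable.sub_const _).indicator measurableSet_Ioo
      exact Measurable.aestronglyMeasurable (by fun_prop)
    · refine Eventually.of_forall fun n => ?_
      have hne : ∀ᵐ y : ℝ, y ≠ b := by simp [ae_iff, measure_singleton]
      filter_upwards [hne] with y hyb hy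
      rw [uIoc_of_le hx.2.le] at hy
      have hy' : y ∈ Ioo a b := ⟨hx.1.trans hy.1, lt_of_le_of_ne hy.2 hyb⟩
      have hyx : 0 < y - x := by linarith [hy.1]
      rw [(hs n).centerRight_eq hβ0, indicator_of_mem hx, indicator_of_mem hy',
        sub_sub_sub_cancel_right, norm_div, Real.norm_eq_abs,
        Real.norm_of_nonneg (Real.rpow_nonneg hyx.le _),
        div_le_iff₀ (Real.rpow_pos_of_pos hyx _), mul_assoc, ← Real.rpow_add hyx]
      refine (hs n x y).trans (le_of_eq ?_)
      rw [abs_sub_comm, abs_of_pos hyx]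
      congr 2
      ring
    · have := (intervalIntegral.intervalIntegrable_rpow' (a := 0) (b := b - x)
        (r := β - (1 - α) - 1) (by linarith)).comp_sub_right x
      simp only [zero_add, sub_add_cancel] at this
      exact this.const_mul Λ
    · exact Eventually.of_forall fun y _ => ((hcenter x).sub (hcenter y)).div_const _
  simp only [stieltjes_eq_of_lt _ _ hab]
  refine Tendsto.add (Tendsto.neg ?_) ?_
  · refine tendsto_integral_of_dominated_convergence
      (fun x => |weylLeft α a b (centerLeft a b f) x| * (IsHolder.weylConst β (1 - α) * Λ))
      ?_ ?_ ?_ ?_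
    · intro n
      exact ((hM.measurable_weylLeft h0).mul ((hs n).measurable_weylRight hβ1 (by linarith) hβ
        (by linarith))).aestronglyMeasurable
    · exact (hM.integrable_weylLeft h0 (by linarith)).abs.integrableOn.mul_const _
    · refine fun n => Eventually.of_forall fun x => ?_
      rw [norm_mul, Real.norm_eq_abs, Real.norm_eq_abs]
      exact mul_le_mul_of_nonneg_left
        ((hs n).abs_weylRight_le hβ1 (by linarith) hβ (by linarith) x) (abs_nonneg _)
    · filter_upwards [ae_restrict_mem measurableSet_Ioo] with x hx
      exact (hweyl x hx).const_mul _
  · simp only [(hs _).limL_eq hβ0, (hs _).limR_eq hβ0, hg.limL_eq hβ0, hg.limR_eq hβ0]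
    exact ((hpt b).sub (hpt a)).const_mul _


/-! ### The indefinite integral -/

/-- A measurable version of `ξ ↦ ∫_0^ξ f dg`. -/
def innerInt (f g : ℝ → ℝ) (ξ : ℝ) : ℝ :=
  limsup (fun n : ℕ => ∫ x in Ioo 0 ξ, f x * diffQuot g (1 / ((n : ℝ) + 1)) x) atTop

/-- `u` vanishes at `0` and is Hölder continuous on `[0,1]`. -/
structure IsHolderUnit (γ K : ℝ) (u : ℝ → ℝ) : Prop where
  zero : u 0 = 0
  holder : ∀ ξ ∈ Icc (0 : ℝ) 1, ∀ η ∈ Icc (0 : ℝ) 1, |u ξ - u η| ≤ K * |ξ - η| ^ γ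

lemma IsHolderUnit.nonneg {γ K : ℝ} {u : ℝ → ℝ} (h : IsHolderUnit γ K u) : 0 ≤ K := by
  have := (abs_nonneg _).trans (h.holder 0 (by simp) 1 (by simp))
  simpa using this

lemma IsHolderUnit.abs_le {γ K : ℝ} {u : ℝ → ℝ} (h : IsHolderUnit γ K u) (hγ : 0 ≤ γ) {ξ : ℝ}
    (hξ : ξ ∈ Icc (0 : ℝ) 1) : |u ξ| ≤ K := by
  have := h.holder ξ hξ 0 (by simp)
  rw [h.zero, sub_zero, sub_zero] at this
  refine this.trans (mul_le_of_le_one_right h.nonneg (Real.rpow_le_one (abs_nonneg _) ?_ hγ))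
  rw [abs_of_nonneg hξ.1]
  exact hξ.2

/-- Hölder regularity beyond `α` controls the norm. With `γ = 1 - α`, the condition `α < γ` is `α <
1/2` and the loss is `1 / (1 - 2α)`. -/
lemma IsHolderUnit.bddW {α γ K : ℝ} {u : ℝ → ℝ} (h : IsHolderUnit γ K u) (hα : 0 ≤ α)
    (hαγ : α < γ) (hγ : γ ≤ 1) : BddW α u (K / (γ - α)) where
  bound := fun ξ hξ => by
    refine (h.abs_le (hα.trans hαγ.le) hξ).trans ?_
    rw [le_div_iff₀ (by linarith)]
    exact mul_le_of_le_one_right h.nonneg (by linarith)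
  lint := fun ξ hξ => by
    refine lintegral_div_rpow_le hαγ h.nonneg hξ.1 (by linarith [hξ.2]) fun η hη => ?_
    refine (h.holder ξ hξ η ⟨hη.1.le, hη.2.le.trans hξ.2⟩).trans (le_of_eq ?_)
    rw [abs_of_pos (by linarith [hη.2])]

section

variable {α β Λ : ℝ} {g : ℝ → ℝ}

lemma integrableOn_mul_diffQuot {C : ℝ} {f : ℝ → ℝ} (hf : Measurable f) (hfC : BddW α f C)
    (hg : IsHolder β Λ g) (hβ : 0 < β) (h : ℝ) :
    IntegrableOn (fun x => f x * diffQuot g h x) (Ioc 0 1) := by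
  refine Integrable.bdd_mul (c := C) ((continuous_diffQuot (hg.continuous hβ) h).integrableOn_Ioc)
    hf.aestronglyMeasurable ?_
  filter_upwards [ae_restrict_mem measurableSet_Ioc] with x hx
  exact hfC.bound x ⟨hx.1.le, hx.2⟩

lemma tendsto_innerInt (h0 : 0 < α) (h1 : α < 1 / 2)
    (hβ : 1 - α < β) (hβ1 : β ≤ 1) (hg : IsHolder β Λ g) {C : ℝ} {f : ℝ → ℝ} (hf : Measurable f)
    (hfC : BddW α f C) {ξ : ℝ} (hξ : ξ ∈ Icc (0 : ℝ) 1) :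
    Tendsto (fun n : ℕ => ∫ x in Ioo 0 ξ, f x * diffQuot g (1 / ((n : ℝ) + 1)) x) atTop
      (𝓝 (innerInt f g ξ)) ∧ innerInt f g ξ = stieltjes α f g 0 ξ := by
  have key : Tendsto (fun n : ℕ => ∫ x in Ioo 0 ξ, f x * diffQuot g (1 / ((n : ℝ) + 1)) x) atTop
      (𝓝 (stieltjes α f g 0 ξ)) := by
    rcases hξ.1.eq_or_lt with h | h
    · subst h
      simp [stieltjes]
    · exact tendsto_integral_diffQuot h0 h1 hβ hβ1 hf hfC hg le_rfl h hξ.2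
  have e : innerInt f g ξ = stieltjes α f g 0 ξ := key.limsup_eq
  exact ⟨e ▸ key, e⟩

/-- The point is additivity, `∫_0^ξ - ∫_0^η = ∫_η^ξ`. Weyl derivatives depend on the base points, so
it is obtained as a limit of the same identity for ordinary integrals; the estimate on `[η, ξ]`
finishes. -/
lemma isHolderUnit_innerInt (h0 : 0 < α) (h1 : α < 1 / 2)
    (hβ : 1 - α < β) (hβ1 : β ≤ 1) (hg : IsHolder β Λ g) {C : ℝ} {f : ℝ → ℝ} (hf : Measurable f)
    (hfC : BddW α f C) : IsHolderUnit (1 - α) (stieltjesConst α β * C * Λ) (innerInt f g) := by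
  have hlt : ∀ ξ ∈ Icc (0 : ℝ) 1, ∀ η ∈ Icc (0 : ℝ) 1, η < ξ →
      |innerInt f g ξ - innerInt f g η| ≤ stieltjesConst α β * C * Λ * |ξ - η| ^ (1 - α) := by
    intro ξ hξ η hη hlt
    have t1 := (tendsto_innerInt h0 h1 hβ hβ1 hg hf hfC hξ).1
    have t2 := (tendsto_innerInt h0 h1 hβ hβ1 hg hf hfC hη).1
    have t3 := tendsto_integral_diffQuot h0 h1 hβ hβ1 hf hfC hg hη.1 hlt hξ.2
    have e : innerInt f g ξ - innerInt f g η = stieltjes α f g η ξ := by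
      refine tendsto_nhds_unique (t1.sub t2) (t3.congr fun n => ?_)
      have hi := integrableOn_mul_diffQuot hf hfC hg (by linarith) (1 / ((n : ℝ) + 1))
      rw [← integral_Ioc_eq_integral_Ioo, ← integral_Ioc_eq_integral_Ioo,
        ← integral_Ioc_eq_integral_Ioo, ← Ioc_union_Ioc_eq_Ioc hη.1 hlt.le,
        setIntegral_union (Ioc_disjoint_Ioc_of_le le_rfl) measurableSet_Ioc
          (hi.mono_set (Ioc_subset_Ioc le_rfl hη.2)) (hi.mono_set (Ioc_subset_Ioc hη.1 hξ.2))]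
      ring
    rw [e, abs_of_pos (sub_pos.2 hlt)]
    exact abs_stieltjes_le h0 h1 hβ hβ1 hf hfC hg hη.1 hlt hξ.2
  refine ⟨?_, fun ξ hξ η hη => ?_⟩
  · rw [(tendsto_innerInt h0 h1 hβ hβ1 hg hf hfC (by simp)).2]
    simp [stieltjes]
  · rcases lt_trichotomy η ξ with h | h | h
    · exact hlt ξ hξ η hη h
    · subst h
      rw [sub_self, sub_self, abs_zero, Real.zero_rpow (by linarith), mul_zero]
    · rw [abs_sub_comm, abs_sub_comm ξ η]
      exact hlt η hη ξ hξ h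

lemma innerInt_sub (h0 : 0 < α) (h1 : α < 1 / 2)
    (hβ : 1 - α < β) (hβ1 : β ≤ 1) (hg : IsHolder β Λ g) {C₁ C₂ D : ℝ} {f₁ f₂ : ℝ → ℝ}
    (hf₁ : Measurable f₁) (hf₂ : Measurable f₂) (h₁ : BddW α f₁ C₁) (h₂ : BddW α f₂ C₂)
    (hD : BddW α (fun x => f₁ x - f₂ x) D) {ξ : ℝ} (hξ : ξ ∈ Icc (0 : ℝ) 1) :
    innerInt f₁ g ξ - innerInt f₂ g ξ = innerInt (fun x => f₁ x - f₂ x) g ξ := by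
  have t1 := (tendsto_innerInt h0 h1 hβ hβ1 hg hf₁ h₁ hξ).1
  have t2 := (tendsto_innerInt h0 h1 hβ hβ1 hg hf₂ h₂ hξ).1
  have t3 := (tendsto_innerInt h0 h1 hβ hβ1 hg (hf₁.sub hf₂) hD hξ).1
  refine tendsto_nhds_unique (t1.sub t2) (t3.congr fun n => ?_)
  have hsub : Ioo 0 ξ ⊆ Ioc (0 : ℝ) 1 := fun x hx => ⟨hx.1, hx.2.le.trans hξ.2⟩
  rw [← integral_sub ((integrableOn_mul_diffQuot hf₁ h₁ hg (by linarith) _).mono_set hsub)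
    ((integrableOn_mul_diffQuot hf₂ h₂ hg (by linarith) _).mono_set hsub)]
  congr 1
  ext x
  rw [Pi.sub_apply]
  ring

lemma isHolderUnit_innerInt_sub (h0 : 0 < α) (h1 : α < 1 / 2)
    (hβ : 1 - α < β) (hβ1 : β ≤ 1) (hg : IsHolder β Λ g) {C₁ C₂ D : ℝ} {f₁ f₂ : ℝ → ℝ}
    (hf₁ : Measurable f₁) (hf₂ : Measurable f₂) (h₁ : BddW α f₁ C₁) (h₂ : BddW α f₂ C₂)
    (hD : BddW α (fun x => f₁ x - f₂ x) D) :
    IsHolderUnit (1 - α) (stieltjesConst α β * D * Λ)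
      (fun ξ => innerInt f₁ g ξ - innerInt f₂ g ξ) := by
  have h := isHolderUnit_innerInt h0 h1 hβ hβ1 hg (hf₁.sub hf₂) hD
  have e := fun ξ hξ => innerInt_sub h0 h1 hβ hβ1 hg hf₁ hf₂ h₁ h₂ hD (ξ := ξ) hξ
  refine ⟨?_, fun ξ hξ η hη => ?_⟩
  · simp only [e 0 (by simp)]
    exact h.zero
  · simp only [e ξ hξ, e η hη]
    exact h.holder ξ hξ η hη

end

/-- Integrating a family of Hölder functions in time. -/
lemma isHolderUnit_integral {γ t : ℝ} {u : ℝ → ℝ → ℝ} {k : ℝ → ℝ} {t₀ : ℝ} (ht : t₀ ≤ t)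
    (hk : IntervalIntegrable k volume t₀ t)
    (hu : ∀ᵐ s ∂(volume.restrict (Ioc t₀ t)), IsHolderUnit γ (k s) (u s))
    (hi : ∀ ξ ∈ Icc (0 : ℝ) 1, IntervalIntegrable (fun s => u s ξ) volume t₀ t) :
    IsHolderUnit γ (∫ s in t₀..t, k s) (fun ξ => ∫ s in t₀..t, u s ξ) where
  zero := by
    rw [intervalIntegral.integral_of_le ht]
    refine integral_eq_zero_of_ae ?_
    filter_upwards [hu] with s hs using hs.zero
  holder := fun ξ hξ η hη => by
    rw [← intervalIntegral.integral_sub (hi ξ hξ) (hi η hη), ← intervalIntegral.integral_mul_const,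
      ← Real.norm_eq_abs, intervalIntegral.integral_of_le ht, intervalIntegral.integral_of_le ht]
    refine norm_integral_le_of_norm_le (hk.mul_const _).1 ?_
    filter_upwards [hu] with s hs
    exact hs.holder ξ hξ η hη

/-! ### Operations on `BddW` -/

namespace BddW

variable {α C D : ℝ} {f h : ℝ → ℝ}

lemma mono (hf : BddW α f C) (hCD : C ≤ D) : BddW α f D :=
  ⟨fun ξ hξ => (hf.bound ξ hξ).trans hCD,
    fun ξ hξ => (hf.lint ξ hξ).trans (ENNReal.ofReal_le_ofReal hCD)⟩

lemma congr (hf : BddW α f C) (hfh : ∀ ξ ∈ Icc (0 : ℝ) 1, f ξ = h ξ) : BddW α h C where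
  bound := fun ξ hξ => by rw [← hfh ξ hξ]; exact hf.bound ξ hξ
  lint := fun ξ hξ => by
    refine le_trans (le_of_eq ?_) (hf.lint ξ hξ)
    refine setLIntegral_congr_fun measurableSet_Ioo fun η hη => ?_
    simp only [hfh ξ hξ, hfh η ⟨hη.1.le, hη.2.le.trans hξ.2⟩]

/-- A pointwise bound for increments by a sum of two terms gives `BddW`. -/
lemma of_le_add {C₁ C₂ : ℝ} {u v : ℝ → ℝ → ℝ} (hu : ∀ ξ, Measurable (u ξ)) (hC₁ : 0 ≤ C₁)
    (hC₂ : 0 ≤ C₂) (hb : ∀ ξ ∈ Icc (0 : ℝ) 1, |f ξ| ≤ C₁ + C₂)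
    (huv : ∀ ξ ∈ Icc (0 : ℝ) 1, ∀ η ∈ Ioo (0 : ℝ) ξ, |f ξ - f η| ≤ u ξ η + v ξ η)
    (hu1 : ∀ ξ ∈ Icc (0 : ℝ) 1, ∫⁻ η in Ioo 0 ξ, ENNReal.ofReal (u ξ η / (ξ - η) ^ (α + 1)) ≤
      ENNReal.ofReal C₁)
    (hv1 : ∀ ξ ∈ Icc (0 : ℝ) 1, ∫⁻ η in Ioo 0 ξ, ENNReal.ofReal (v ξ η / (ξ - η) ^ (α + 1)) ≤
      ENNReal.ofReal C₂) : BddW α f (C₁ + C₂) where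
  bound := hb
  lint := fun ξ hξ => by
    rw [ENNReal.ofReal_add hC₁ hC₂]
    refine le_trans ?_ (add_le_add (hu1 ξ hξ) (hv1 ξ hξ))
    have := hu ξ
    rw [← lintegral_add_left (by fun_prop)]
    refine setLIntegral_mono' measurableSet_Ioo fun η hη => ?_
    refine le_trans (ENNReal.ofReal_le_ofReal ?_) ENNReal.ofReal_add_le
    rw [← add_div]
    exact div_le_div_of_nonneg_right (huv ξ hξ η hη) (Real.rpow_nonneg (by linarith [hη.2]) _)

lemma lint_const_mul (hf : BddW α f C) {c : ℝ} (hc : 0 ≤ c) {ξ : ℝ} (hξ : ξ ∈ Icc (0 : ℝ) 1) :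
    ∫⁻ η in Ioo 0 ξ, ENNReal.ofReal (c * |f ξ - f η| / (ξ - η) ^ (α + 1)) ≤
      ENNReal.ofReal (c * C) := by
  rw [ENNReal.ofReal_mul hc]
  refine le_trans ?_ (mul_le_mul_right (hf.lint ξ hξ) _)
  rw [← lintegral_const_mul' _ _ ENNReal.ofReal_ne_top]
  refine lintegral_mono fun η => le_of_eq ?_
  rw [← ENNReal.ofReal_mul hc, mul_div_assoc]

lemma add (hf : BddW α f C) (hh : BddW α h D) (hfm : Measurable f) :
    BddW α (fun x => f x + h x) (C + D) :=
  of_le_add (u := fun ξ η => |f ξ - f η|) (v := fun ξ η => |h ξ - h η|) (fun ξ => by fun_prop)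
    hf.nonneg hh.nonneg
    (fun ξ hξ => (abs_add_le _ _).trans (add_le_add (hf.bound ξ hξ) (hh.bound ξ hξ)))
    (fun ξ _ η _ => by
      rw [add_sub_add_comm]
      exact abs_add_le _ _) hf.lint hh.lint

lemma neg (hf : BddW α f C) : BddW α (fun x => -f x) C where
  bound := fun ξ hξ => by rw [abs_neg]; exact hf.bound ξ hξ
  lint := fun ξ hξ => by
    refine le_trans (le_of_eq ?_) (hf.lint ξ hξ)
    congr 1
    ext η
    rw [← neg_sub', abs_neg]

lemma sub (hf : BddW α f C) (hh : BddW α h D) (hfm : Measurable f) :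
    BddW α (fun x => f x - h x) (C + D) := by
  simpa only [sub_eq_add_neg] using hf.add hh.neg hfm

/-- Growth is affine in `C` and involves no local constant of the derivative of `A`; this lets the a
priori bound for the Picard iterates close. -/
lemma comp {A : ℝ → ℝ} {M₁ M₂ : ℝ} (hA1 : ∀ x y : ℝ, |A x - A y| ≤ M₁ * |x - y|) (hM₁ : 0 ≤ M₁)
    (hA2 : ∀ x, |A x| ≤ M₂) (hf : BddW α f C) : BddW α (fun x => A (f x)) (M₂ + M₁ * C) where
  bound := fun ξ hξ => (hA2 _).trans (by have := mul_nonneg hM₁ hf.nonneg; linarith)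
  lint := fun ξ hξ => by
    have hM₂ : 0 ≤ M₂ := (abs_nonneg _).trans (hA2 0)
    refine le_trans ?_ ((hf.lint_const_mul hM₁ hξ).trans (ENNReal.ofReal_le_ofReal (by linarith)))
    refine setLIntegral_mono' measurableSet_Ioo fun η hη => ENNReal.ofReal_le_ofReal ?_
    exact div_le_div_of_nonneg_right (hA1 _ _) (Real.rpow_nonneg (by linarith [hη.2]) _)

/-- Limits of functions bounded in `W^{α,∞}`. -/
lemma of_tendsto {u : ℕ → ℝ → ℝ} (hu : ∀ n, BddW α (u n) C) (hum : ∀ n, Measurable (u n))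
    (hlim : ∀ ξ ∈ Icc (0 : ℝ) 1, Tendsto (fun n => u n ξ) atTop (𝓝 (f ξ))) : BddW α f C where
  bound := fun ξ hξ => le_of_tendsto (hlim ξ hξ).abs
    (Eventually.of_forall fun n => (hu n).bound ξ hξ)
  lint := fun ξ hξ => by
    -- Fatou's lemma: pointwise convergence on `[0,1]` is enough to keep the bound.
    have hF : ∫⁻ η in Ioo 0 ξ, liminf (fun n => ENNReal.ofReal
        (|u n ξ - u n η| / (ξ - η) ^ (α + 1))) atTop ≤ ENNReal.ofReal C := by
      refine (lintegral_liminf_le fun n => ?_).trans ?_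
      · have := hum n
        fun_prop
      · refine liminf_le_of_le (by isBoundedDefault) fun b hb => ?_
        obtain ⟨n, hn⟩ := hb.exists
        exact hn.trans ((hu n).lint ξ hξ)
    refine le_trans (le_of_eq ?_) hF
    refine setLIntegral_congr_fun measurableSet_Ioo fun η hη => ?_
    refine (Tendsto.liminf_eq ?_).symm
    refine ENNReal.tendsto_ofReal ?_
    exact ((hlim ξ hξ).sub (hlim η ⟨hη.1.le, hη.2.le.trans hξ.2⟩)).abs.div_const _

end BddW

/-! ### The nonlinearity -/

lemma abs_deriv_le_of_lipschitz {A : ℝ → ℝ} {M : ℝ} (hM : 0 ≤ M)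
    (h : ∀ x y : ℝ, |A x - A y| ≤ M * |x - y|) (x : ℝ) : |deriv A x| ≤ M := by
  have hL : LipschitzWith ⟨M, hM⟩ A := LipschitzWith.of_dist_le_mul fun x y => h x y
  exact norm_deriv_le_of_lipschitz hL

/-- Second order increments of a function with Lipschitz derivative. -/
lemma abs_four_point_le {A : ℝ → ℝ} {M₁ M R : ℝ} (hA : Differentiable ℝ A) (hM : 0 ≤ M)
    (hA1 : ∀ x, |deriv A x| ≤ M₁)
    (hA' : ∀ x y : ℝ, |x| ≤ R → |y| ≤ R → |deriv A x - deriv A y| ≤ M * |x - y|)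
    {x₁ x₂ x₃ x₄ : ℝ} (h₁ : |x₁| ≤ R) (h₂ : |x₂| ≤ R) (h₃ : |x₃| ≤ R) (h₄ : |x₄| ≤ R) :
    |(A x₁ - A x₃) - (A x₂ - A x₄)| ≤
      M₁ * |(x₁ - x₃) - (x₂ - x₄)| + M * |x₁ - x₃| * (|x₁ - x₂| + |x₃ - x₄|) := by
  -- Both segments `x₃ → x₁` and `x₄ → x₂` are run with the same parameter, so a single mean value
  -- point `θ` serves both differences.
  let ψ : ℝ → ℝ := fun θ => A (x₃ + θ * (x₁ - x₃)) - A (x₄ + θ * (x₂ - x₄))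
  have hψ : ∀ θ, HasDerivAt ψ (deriv A (x₃ + θ * (x₁ - x₃)) * (x₁ - x₃) -
      deriv A (x₄ + θ * (x₂ - x₄)) * (x₂ - x₄)) θ := by
    intro θ
    have h1 : ∀ p q : ℝ, HasDerivAt (fun θ : ℝ => p + θ * q) q θ := fun p q => by
      simpa using ((hasDerivAt_id θ).mul_const q).const_add p
    exact ((hA _).hasDerivAt.comp θ (h1 _ _)).sub ((hA _).hasDerivAt.comp θ (h1 _ _))
  obtain ⟨θ, hθ, hθ'⟩ := exists_hasDerivAt_eq_slope ψ _ (zero_lt_one)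
    (fun θ _ => (hψ θ).continuousAt.continuousWithinAt) (fun θ _ => hψ θ)
  have e : ψ 1 - ψ 0 = (A x₁ - A x₃) - (A x₂ - A x₄) := by
    simp only [ψ, one_mul, zero_mul, add_zero, add_sub_cancel]
    ring
  rw [sub_zero, div_one, e] at hθ'
  set p := x₃ + θ * (x₁ - x₃) with hp
  set q := x₄ + θ * (x₂ - x₄) with hq
  have conv : ∀ u v : ℝ, |u| ≤ R → |v| ≤ R → |v + θ * (u - v)| ≤ R := by
    intro u v hu hv
    rw [abs_le] at *
    constructor <;> nlinarith [hθ.1, hθ.2]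
  have hpq : |p - q| ≤ |x₁ - x₂| + |x₃ - x₄| := by
    have : p - q = θ * (x₁ - x₂) + (1 - θ) * (x₃ - x₄) := by rw [hp, hq]; ring
    rw [this]
    refine (abs_add_le _ _).trans ?_
    rw [abs_mul, abs_mul, abs_of_pos hθ.1, abs_of_pos (sub_pos.2 hθ.2)]
    have := abs_nonneg (x₁ - x₂)
    have := abs_nonneg (x₃ - x₄)
    nlinarith [hθ.1, hθ.2]
  rw [← hθ']
  have e2 : deriv A p * (x₁ - x₃) - deriv A q * (x₂ - x₄) =
      deriv A q * ((x₁ - x₃) - (x₂ - x₄)) + (deriv A p - deriv A q) * (x₁ - x₃) := by ring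
  rw [e2]
  refine (abs_add_le _ _).trans (add_le_add ?_ ?_)
  · rw [abs_mul]
    exact mul_le_mul_of_nonneg_right (hA1 q) (abs_nonneg _)
  · rw [abs_mul, mul_right_comm]
    refine mul_le_mul_of_nonneg_right ?_ (abs_nonneg _)
    exact (hA' p q (conv _ _ h₁ h₃) (conv _ _ h₂ h₄)).trans (mul_le_mul_of_nonneg_left hpq hM)

/-- `y ↦ A ∘ y` is locally Lipschitz in `W^{α,∞}`. -/
lemma BddW.comp_sub {α R D M₁ M : ℝ} {A y z : ℝ → ℝ} (hA : Differentiable ℝ A) (hM : 0 ≤ M)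
    (hM₁ : 0 ≤ M₁) (hA1 : ∀ x y : ℝ, |A x - A y| ≤ M₁ * |x - y|)
    (hA' : ∀ x y : ℝ, |x| ≤ R → |y| ≤ R → |deriv A x - deriv A y| ≤ M * |x - y|)
    (hym : Measurable y) (hzm : Measurable z) (hy : BddW α y R) (hz : BddW α z R)
    (hD : BddW α (fun x => y x - z x) D) :
    BddW α (fun x => A (y x) - A (z x)) ((M₁ + 2 * M * R) * D) := by
  have hD0 := hD.nonneg
  have hR0 := hy.nonneg
  -- The three terms come from the seminorm of `y - z`, and from the supremum of `y - z` times the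
  -- seminorms of `y` and of `z`.
  have e : (M₁ + 2 * M * R) * D = (M₁ * D + M * D * R) + M * D * R := by ring
  rw [e]
  refine of_le_add (u := fun ξ η => M₁ * |(y ξ - z ξ) - (y η - z η)| + M * D * |y ξ - y η|)
    (v := fun ξ η => M * D * |z ξ - z η|) (fun ξ => by fun_prop) (by positivity) (by positivity)
    (fun ξ hξ => ?_) (fun ξ hξ η hη => ?_) (fun ξ hξ => ?_) (fun ξ hξ => ?_)
  · refine (hA1 _ _).trans ((mul_le_mul_of_nonneg_left (hD.bound ξ hξ) hM₁).trans ?_)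
    have : 0 ≤ M * D * R := by positivity
    linarith
  · have hη' : η ∈ Icc (0 : ℝ) 1 := ⟨hη.1.le, hη.2.le.trans hξ.2⟩
    have := abs_four_point_le hA hM (abs_deriv_le_of_lipschitz hM₁ hA1) hA' (hy.bound ξ hξ)
      (hy.bound η hη') (hz.bound ξ hξ) (hz.bound η hη')
    refine this.trans ?_
    have h2 : M * |y ξ - z ξ| * (|y ξ - y η| + |z ξ - z η|) ≤
        M * D * (|y ξ - y η| + |z ξ - z η|) :=
      mul_le_mul_of_nonneg_right (mul_le_mul_of_nonneg_left (hD.bound ξ hξ) hM)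
        (add_nonneg (abs_nonneg _) (abs_nonneg _))
    linarith
  · rw [ENNReal.ofReal_add (by positivity) (by positivity)]
    refine le_trans ?_ (add_le_add (hD.lint_const_mul hM₁ hξ)
      (hy.lint_const_mul (c := M * D) (by positivity) hξ))
    rw [← lintegral_add_left (by fun_prop)]
    refine lintegral_mono fun η => ?_
    rw [add_div]
    exact ENNReal.ofReal_add_le
  · exact hz.lint_const_mul (by positivity) hξ

/-! ### Exponential weights -/

/-- For an integrable `Λ ≥ 0` there is a weight `e^{λ t}` for which integration against `Λ` is
small. -/
lemma exists_exp_weight {T κ : ℝ} {Λ : ℝ → ℝ} (hT : 0 ≤ T) (hκ : 0 ≤ κ) (hΛ : ∀ s, 0 ≤ Λ s)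
    (hi : IntervalIntegrable Λ volume 0 T) :
    ∃ l : ℝ, 0 ≤ l ∧ ∀ t ∈ Icc (0 : ℝ) T,
      κ * ∫ s in (0 : ℝ)..t, Λ s * Real.exp (l * s) ≤ 1 / 2 * Real.exp (l * t) := by
  have hI : IntegrableOn Λ (Ioc 0 T) := hi.1
  obtain ⟨Λ', hΛ'm, hΛ'⟩ := hI.1
  -- With `Λ` merely integrable there is no rate to exploit; instead the mass of `Λ` above level `n`
  -- tends to zero. The measurable version `Λ'` makes the superlevel sets measurable.
  have hlim : Tendsto (fun n : ℕ => ∫ s in Ioc 0 T, {s | (n : ℝ) < Λ' s}.indicator Λ s) atTop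
      (𝓝 0) := by
    have hset : ∀ n : ℕ, MeasurableSet {s | (n : ℝ) < Λ' s} := fun n =>
      measurableSet_lt measurable_const hΛ'm.measurable
    rw [show 𝓝 (0 : ℝ) = 𝓝 (∫ s in Ioc (0 : ℝ) T, (fun _ => (0 : ℝ)) s) by simp]
    refine tendsto_integral_of_dominated_convergence Λ ?_ hI ?_ ?_
    · exact fun n => hI.1.indicator (hset n)
    · refine fun n => Eventually.of_forall fun s => ?_
      refine (norm_indicator_le_norm_self _ _).trans ?_
      rw [Real.norm_of_nonneg (hΛ s)]
    · refine Eventually.of_forall fun s => ?_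
      refine tendsto_const_nhds.congr' ?_
      obtain ⟨N, hN⟩ := exists_nat_ge (Λ' s)
      filter_upwards [eventually_ge_atTop N] with n hn
      rw [indicator_of_notMem]
      intro h
      have h' : (n : ℝ) < Λ' s := h
      have : (N : ℝ) ≤ n := by exact_mod_cast hn
      linarith
  have hev : ∀ᶠ n : ℕ in atTop,
      κ * ∫ s in Ioc 0 T, {s | (n : ℝ) < Λ' s}.indicator Λ s < 1 / 4 := by
    have := hlim.const_mul κ
    rw [mul_zero] at this
    exact this.eventually (gt_mem_nhds (by norm_num))
  obtain ⟨N, hN⟩ := hev.exists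
  -- Below level `N` the integral of `N e^{ls}` is at most `N e^{lt} / l`, so this choice makes that
  -- part at most `1/4`. The summand `1` keeps `l` positive even if `κ N = 0`.
  set l : ℝ := 4 * κ * N + 1 with hl
  have hκN : 0 ≤ κ * N := by positivity
  have hl0 : 0 < l := by rw [hl]; linarith
  refine ⟨l, hl0.le, fun t ht => ?_⟩
  have hIt : IntervalIntegrable Λ volume 0 t := hi.mono_set (by
    rw [uIcc_of_le ht.1, uIcc_of_le hT]
    exact Icc_subset_Icc le_rfl ht.2)
  have hset : MeasurableSet {s | (N : ℝ) < Λ' s} :=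
    measurableSet_lt measurable_const hΛ'm.measurable
  have hind : IntegrableOn ({s | (N : ℝ) < Λ' s}.indicator Λ) (Ioc 0 T) := hI.indicator hset
  have hexp : Continuous fun s => Real.exp (l * s) := by fun_prop
  have hcont : IntervalIntegrable (fun s => N * Real.exp (l * s)) volume 0 t :=
    (hexp.const_mul _).intervalIntegrable _ _
  have hsub : Ioc 0 t ⊆ Ioc 0 T := Ioc_subset_Ioc le_rfl ht.2
  have hbig : IntervalIntegrable (fun s => {s | (N : ℝ) < Λ' s}.indicator Λ s * Real.exp (l * t))
      volume 0 t := by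
    rw [intervalIntegrable_iff_integrableOn_Ioc_of_le ht.1]
    exact (hind.mono_set hsub).mul_const _
  have hle : ∫ s in (0 : ℝ)..t, Λ s * Real.exp (l * s) ≤
      ∫ s in (0 : ℝ)..t, (N * Real.exp (l * s) +
        {s | (N : ℝ) < Λ' s}.indicator Λ s * Real.exp (l * t)) := by
    rw [intervalIntegral.integral_of_le ht.1, intervalIntegral.integral_of_le ht.1]
    refine integral_mono_ae (hIt.mul_continuousOn hexp.continuousOn).1 (hcont.add hbig).1 ?_
    filter_upwards [ae_restrict_of_ae_restrict_of_subset hsub hΛ',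
      ae_restrict_mem measurableSet_Ioc] with s hs hst
    have he : 0 < Real.exp (l * s) := Real.exp_pos _
    have het : Real.exp (l * s) ≤ Real.exp (l * t) :=
      Real.exp_le_exp.2 (mul_le_mul_of_nonneg_left hst.2 hl0.le)
    by_cases h : (N : ℝ) < Λ' s
    · rw [indicator_of_mem (show s ∈ {s | (N : ℝ) < Λ' s} from h)]
      have h1 := mul_le_mul_of_nonneg_left het (hΛ s)
      have h2 : 0 ≤ N * Real.exp (l * s) := by positivity
      linarith
    · rw [indicator_of_notMem (show s ∉ {s | (N : ℝ) < Λ' s} from h), zero_mul, add_zero, hs]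
      exact mul_le_mul_of_nonneg_right (not_lt.1 h) he.le
  have hexpint : ∫ s in (0 : ℝ)..t, N * Real.exp (l * s) ≤ N * (Real.exp (l * t) / l) := by
    rw [intervalIntegral.integral_const_mul, intervalIntegral.integral_comp_mul_left
      (fun s => Real.exp s) hl0.ne', integral_exp, smul_eq_mul]
    refine mul_le_mul_of_nonneg_left ?_ (Nat.cast_nonneg N)
    rw [mul_zero, Real.exp_zero, inv_mul_eq_div]
    exact div_le_div_of_nonneg_right (by linarith) hl0.le
  have hbigint : ∫ s in (0 : ℝ)..t, {s | (N : ℝ) < Λ' s}.indicator Λ s * Real.exp (l * t) ≤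
      (∫ s in Ioc 0 T, {s | (N : ℝ) < Λ' s}.indicator Λ s) * Real.exp (l * t) := by
    rw [intervalIntegral.integral_mul_const, intervalIntegral.integral_of_le ht.1]
    refine mul_le_mul_of_nonneg_right ?_ (Real.exp_pos _).le
    exact setIntegral_mono_set hind (Eventually.of_forall fun s =>
      indicator_nonneg (fun s _ => hΛ s) s) hsub.eventuallyLE
  rw [intervalIntegral.integral_add hcont hbig] at hle
  have h1 := mul_le_mul_of_nonneg_left (hle.trans (add_le_add hexpint hbigint)) hκ
  refine h1.trans ?_
  have h2 : κ * N / l ≤ 1 / 4 := by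
    rw [div_le_iff₀ hl0, hl]
    linarith
  have he := Real.exp_pos (l * t)
  have e : κ * (N * (Real.exp (l * t) / l) +
      (∫ s in Ioc 0 T, {s | (N : ℝ) < Λ' s}.indicator Λ s) * Real.exp (l * t)) =
      (κ * N / l + κ * ∫ s in Ioc 0 T, {s | (N : ℝ) < Λ' s}.indicator Λ s) *
        Real.exp (l * t) := by ring
  rw [e]
  refine mul_le_mul_of_nonneg_right ?_ he.le
  linarith


/-! ### The deterministic equation -/

/-- Admissible exponents. -/
structure Exponents (α β : ℝ) : Prop where
  pos : 0 < α
  lt_half : α < 1 / 2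
  lt : 1 - α < β
  le_one : β ≤ 1

/-- Assumptions on the nonlinearity. -/
structure Nonlinearity (A : ℝ → ℝ) (M₁ M₂ : ℝ) : Prop where
  diff : Differentiable ℝ A
  pos : 0 < M₁
  lip : ∀ x y : ℝ, |A x - A y| ≤ M₁ * |x - y|
  bdd : ∀ x : ℝ, |A x| ≤ M₂
  loc : ∀ N : ℝ, ∃ M > 0, ∀ x y : ℝ, |x| ≤ N → |y| ≤ N → |deriv A x - deriv A y| ≤ M * |x - y|

/-- Assumptions on the driving function: Hölder continuity in space with a constant which is
integrable in time. -/
structure Driver (T β : ℝ) (g : ℝ → ℝ → ℝ) (Λ : ℝ → ℝ) : Prop where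
  meas : Measurable (Function.uncurry g)
  holder : ∀ s, IsHolder β (Λ s) (g s)
  int : IntervalIntegrable Λ volume 0 T

/-- Joint measurability in the parameter and the endpoint is immediate for a limsup of ordinary
parameter integrals, without assuming that the Stieltjes integral exists. -/
lemma measurable_innerInt {X : Type*} [MeasurableSpace X] {f g : X → ℝ → ℝ}
    (hf : Measurable (Function.uncurry f)) (hg : Measurable (Function.uncurry g)) :
    Measurable (fun p : X × ℝ => innerInt (f p.1) (g p.1) p.2) := by
  refine Measurable.limsup fun n => ?_
  set h : ℝ := 1 / ((n : ℝ) + 1)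
  have hm : Measurable (fun q : (X × ℝ) × ℝ =>
      {q : (X × ℝ) × ℝ | 0 < q.2 ∧ q.2 < q.1.2}.indicator
        (fun q => f q.1.1 q.2 * (h⁻¹ * (g q.1.1 (q.2 + h) - g q.1.1 q.2))) q) := by
    refine Measurable.indicator ?_ ?_
    · have h1 : Measurable fun q : (X × ℝ) × ℝ => f q.1.1 q.2 :=
        hf.comp (by fun_prop : Measurable fun q : (X × ℝ) × ℝ => (q.1.1, q.2))
      have h2 : Measurable fun q : (X × ℝ) × ℝ => g q.1.1 q.2 :=
        hg.comp (by fun_prop : Measurable fun q : (X × ℝ) × ℝ => (q.1.1, q.2))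
      have h3 : Measurable fun q : (X × ℝ) × ℝ => g q.1.1 (q.2 + h) :=
        hg.comp (by fun_prop : Measurable fun q : (X × ℝ) × ℝ => (q.1.1, q.2 + h))
      exact h1.mul ((h3.sub h2).const_mul _)
    · exact (measurableSet_lt measurable_const measurable_snd).inter
        (measurableSet_lt measurable_snd measurable_fst.snd)
  have := (hm.stronglyMeasurable.integral_prod_right' (ν := (volume : Measure ℝ))).measurable
  convert this using 2 with p
  rw [← integral_indicator measurableSet_Ioo]
  rfl

attribute [local irreducible] innerInt

section

variable {T α β M₁ M₂ : ℝ} {A : ℝ → ℝ} {g : ℝ → ℝ → ℝ} {Λ : ℝ → ℝ}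

lemma Driver.nonneg (hg : Driver T β g Λ) (s : ℝ) : 0 ≤ Λ s := (hg.holder s).nonneg

lemma Nonlinearity.measurable (hA : Nonlinearity A M₁ M₂) : Measurable A :=
  hA.diff.continuous.measurable

lemma Nonlinearity.nonneg (hA : Nonlinearity A M₁ M₂) : 0 ≤ M₂ := (abs_nonneg _).trans (hA.bdd 0)

lemma Driver.intervalIntegrable_mul_exp (hg : Driver T β g Λ) {t₀ t : ℝ} (ht₀ : 0 ≤ t₀)
    (ht₀t : t₀ ≤ t) (htT : t ≤ T) (l : ℝ) :
    IntervalIntegrable (fun s => Λ s * Real.exp (l * s)) volume t₀ t := by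
  refine IntervalIntegrable.mul_continuousOn (hg.int.mono_set ?_) (by fun_prop)
  rw [uIcc_of_le ht₀t, uIcc_of_le (ht₀.trans (ht₀t.trans htT))]
  exact Icc_subset_Icc ht₀ htT

lemma isHolderUnit_innerInt_comp (he : Exponents α β) (hA : Nonlinearity A M₁ M₂)
    (hg : Driver T β g Λ) {y : ℝ → ℝ} (hym : Measurable y) {s R : ℝ} (hy : BddW α y R) :
    IsHolderUnit (1 - α) (stieltjesConst α β * (M₂ + M₁ * R) * Λ s)
      (innerInt (fun η => A (y η)) (g s)) :=
  isHolderUnit_innerInt he.pos he.lt_half he.lt he.le_one (hg.holder s) (hA.measurable.comp hym)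
    (hy.comp hA.lip hA.pos.le hA.bdd)

/-- Integrability in time of the inner integral. -/
lemma intervalIntegrable_innerInt (he : Exponents α β) (hA : Nonlinearity A M₁ M₂)
    (hg : Driver T β g Λ) (hT : 0 ≤ T) {y : ℝ → ℝ → ℝ} (hym : Measurable (Function.uncurry y))
    {R : ℝ} (hy : ∀ s ∈ Icc (0 : ℝ) T, BddW α (y s) R) {ξ : ℝ} (hξ : ξ ∈ Icc (0 : ℝ) 1) :
    IntervalIntegrable (fun s => innerInt (fun η => A (y s η)) (g s) ξ) volume 0 T := by
  have hAy : Measurable (Function.uncurry fun s η => A (y s η)) := hA.measurable.comp hym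
  have hm2 : Measurable fun p : ℝ × ℝ => innerInt (fun η => A (y p.1 η)) (g p.1) p.2 :=
    measurable_innerInt hAy hg.meas
  have hm : Measurable fun s => innerInt (fun η => A (y s η)) (g s) ξ :=
    hm2.comp (by fun_prop : Measurable fun s : ℝ => (s, ξ))
  refine (hg.int.const_mul (stieltjesConst α β * (M₂ + M₁ * R))).mono_fun'
    hm.aestronglyMeasurable ?_
  rw [uIoc_of_le hT]
  filter_upwards [ae_restrict_mem measurableSet_Ioc] with s hs
  rw [Real.norm_eq_abs]
  exact (isHolderUnit_innerInt_comp he hA hg hym.of_uncurry_left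
    (hy s ⟨hs.1.le, hs.2⟩)).abs_le (by linarith [he.lt_half]) hξ

lemma intervalIntegrable_mono {f : ℝ → ℝ} {t₀ t : ℝ} (hf : IntervalIntegrable f volume 0 T)
    (ht₀ : 0 ≤ t₀) (ht₀t : t₀ ≤ t) (htT : t ≤ T) : IntervalIntegrable f volume t₀ t := by
  refine hf.mono_set ?_
  rw [uIcc_of_le ht₀t, uIcc_of_le (ht₀.trans (ht₀t.trans htT))]
  exact Icc_subset_Icc ht₀ htT

/-- Hölder regularity of the time integral. -/
lemma isHolderUnit_timeIntegral (he : Exponents α β) (hA : Nonlinearity A M₁ M₂)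
    (hg : Driver T β g Λ) {y : ℝ → ℝ → ℝ} (hym : Measurable (Function.uncurry y))
    {R l : ℝ} (hl : 0 ≤ l) (hy : ∀ s ∈ Icc (0 : ℝ) T, BddW α (y s) (R * Real.exp (l * s)))
    {t₀ t : ℝ} (ht₀ : 0 ≤ t₀) (ht₀t : t₀ ≤ t) (htT : t ≤ T) :
    IsHolderUnit (1 - α)
      (stieltjesConst α β * (M₂ + M₁ * R) * ∫ s in t₀..t, Λ s * Real.exp (l * s))
      (fun ξ => ∫ s in t₀..t, innerInt (fun η => A (y s η)) (g s) ξ) := by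
  have hc := stieltjesConst_pos he.pos (by linarith [he.lt_half]) he.lt
  have hR : ∀ s ∈ Icc (0 : ℝ) T, BddW α (y s) (|R| * Real.exp (l * T)) := fun s hs =>
    (hy s hs).mono (mul_le_mul (le_abs_self R) (Real.exp_le_exp.2
      (mul_le_mul_of_nonneg_left hs.2 hl)) (Real.exp_pos _).le (abs_nonneg _))
  rw [← intervalIntegral.integral_const_mul]
  refine isHolderUnit_integral ht₀t ((hg.intervalIntegrable_mul_exp ht₀ ht₀t htT l).const_mul _)
    ?_ fun ξ hξ => intervalIntegrable_mono (intervalIntegrable_innerInt he hA hg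
      (ht₀.trans (ht₀t.trans htT)) hym hR hξ) ht₀ ht₀t htT
  filter_upwards [ae_restrict_mem measurableSet_Ioc] with s hs
  have hsT : s ∈ Icc (0 : ℝ) T := ⟨ht₀.trans hs.1.le, hs.2.trans htT⟩
  have h := isHolderUnit_innerInt_comp he hA hg (s := s)
    hym.of_uncurry_left (hy s hsT)
  refine ⟨h.zero, fun ξ hξ η hη => (h.holder ξ hξ η hη).trans ?_⟩
  refine mul_le_mul_of_nonneg_right ?_ (Real.rpow_nonneg (abs_nonneg _) _)
  have h1 : 1 ≤ Real.exp (l * s) := Real.one_le_exp (mul_nonneg hl hsT.1)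
  have h2 : M₂ + M₁ * (R * Real.exp (l * s)) ≤ (M₂ + M₁ * R) * Real.exp (l * s) := by
    nlinarith [hA.nonneg]
  have h3 := mul_le_mul_of_nonneg_left h2 hc.le
  have h4 := mul_le_mul_of_nonneg_right h3 (hg.nonneg s)
  linarith

/-- The contraction estimate. -/
lemma bddW_timeIntegral_sub (he : Exponents α β) (hA : Nonlinearity A M₁ M₂)
    (hg : Driver T β g Λ) {y z : ℝ → ℝ → ℝ} (hym : ∀ s, Measurable (y s))
    (hzm : ∀ s, Measurable (z s)) {R D l M : ℝ} (hM : 0 ≤ M)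
    (hA' : ∀ x y : ℝ, |x| ≤ R → |y| ≤ R → |deriv A x - deriv A y| ≤ M * |x - y|)
    (hl : ∀ t ∈ Icc (0 : ℝ) T, stieltjesConst α β * (M₁ + 2 * M * R) / (1 - 2 * α) *
      ∫ s in (0 : ℝ)..t, Λ s * Real.exp (l * s) ≤ 1 / 2 * Real.exp (l * t))
    (hy : ∀ s ∈ Icc (0 : ℝ) T, BddW α (y s) R) (hz : ∀ s ∈ Icc (0 : ℝ) T, BddW α (z s) R)
    (hyi : ∀ ξ ∈ Icc (0 : ℝ) 1,
      IntervalIntegrable (fun s => innerInt (fun η => A (y s η)) (g s) ξ) volume 0 T)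
    (hzi : ∀ ξ ∈ Icc (0 : ℝ) 1,
      IntervalIntegrable (fun s => innerInt (fun η => A (z s η)) (g s) ξ) volume 0 T)
    (hD : ∀ s ∈ Icc (0 : ℝ) T, BddW α (fun ξ => y s ξ - z s ξ) (D * Real.exp (l * s)))
    {t : ℝ} (ht : t ∈ Icc (0 : ℝ) T) :
    BddW α (fun ξ => (∫ s in (0 : ℝ)..t, innerInt (fun η => A (y s η)) (g s) ξ) -
      ∫ s in (0 : ℝ)..t, innerInt (fun η => A (z s η)) (g s) ξ) (D / 2 * Real.exp (l * t)) := by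
  have hα := he.lt_half
  have hD0 : 0 ≤ D := by
    have := (hD 0 ⟨le_rfl, ht.1.trans ht.2⟩).nonneg
    simpa using this
  have hyi' := fun ξ hξ => intervalIntegrable_mono (hyi ξ hξ) le_rfl ht.1 ht.2
  have hzi' := fun ξ hξ => intervalIntegrable_mono (hzi ξ hξ) le_rfl ht.1 ht.2
  -- At time `s` the difference of the integrands has norm at most `(M₁ + 2MR) D e^{ls}`.
  -- Integration in space gains Hölder regularity `1 - α`; returning to the `α`-norm costs `1 / (1 -
  -- 2α)`, already included in `hl`.
  have key : IsHolderUnit (1 - α) (∫ s in (0 : ℝ)..t,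
        stieltjesConst α β * (M₁ + 2 * M * R) * D * (Λ s * Real.exp (l * s)))
      (fun ξ => ∫ s in (0 : ℝ)..t, (innerInt (fun η => A (y s η)) (g s) ξ -
        innerInt (fun η => A (z s η)) (g s) ξ)) := by
    refine isHolderUnit_integral ht.1
      ((hg.intervalIntegrable_mul_exp le_rfl ht.1 ht.2 l).const_mul _) ?_
      fun ξ hξ => (hyi' ξ hξ).sub (hzi' ξ hξ)
    filter_upwards [ae_restrict_mem measurableSet_Ioc] with s hs
    have hsT : s ∈ Icc (0 : ℝ) T := ⟨hs.1.le, hs.2.trans ht.2⟩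
    have := isHolderUnit_innerInt_sub he.pos he.lt_half he.lt he.le_one (hg.holder s)
      (f₁ := fun η => A (y s η)) (f₂ := fun η => A (z s η))
      (hA.measurable.comp (hym s)) (hA.measurable.comp (hzm s))
      ((hy s hsT).comp hA.lip hA.pos.le hA.bdd) ((hz s hsT).comp hA.lip hA.pos.le hA.bdd)
      (BddW.comp_sub hA.diff hM hA.pos.le hA.lip hA' (hym s) (hzm s) (hy s hsT) (hz s hsT)
        (hD s hsT))
    convert this using 1
    ring
  have hb := key.bddW he.pos.le (by linarith) (by linarith [he.pos])
  rw [intervalIntegral.integral_const_mul] at hb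
  refine (hb.congr fun ξ hξ => intervalIntegral.integral_sub (hyi' ξ hξ) (hzi' ξ hξ)).mono ?_
  have := mul_le_mul_of_nonneg_left (hl t ht) hD0
  rw [show 1 - α - α = 1 - 2 * α by ring]
  refine le_trans (le_of_eq ?_) (this.trans (le_of_eq ?_)) <;> ring

/-- Two solutions which are bounded in `W^{α,∞}` coincide. -/
theorem eq_of_solutions (he : Exponents α β) (hA : Nonlinearity A M₁ M₂)
    (hg : Driver T β g Λ) {y z : ℝ → ℝ → ℝ} {φ : ℝ → ℝ} (hym : ∀ s, Measurable (y s))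
    (hzm : ∀ s, Measurable (z s)) {R : ℝ}
    (hy : ∀ s ∈ Icc (0 : ℝ) T, BddW α (y s) R) (hz : ∀ s ∈ Icc (0 : ℝ) T, BddW α (z s) R)
    (hyi : ∀ ξ ∈ Icc (0 : ℝ) 1,
      IntervalIntegrable (fun s => innerInt (fun η => A (y s η)) (g s) ξ) volume 0 T)
    (hzi : ∀ ξ ∈ Icc (0 : ℝ) 1,
      IntervalIntegrable (fun s => innerInt (fun η => A (z s η)) (g s) ξ) volume 0 T)
    (hyeq : ∀ t ∈ Icc (0 : ℝ) T, ∀ ξ ∈ Icc (0 : ℝ) 1,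
      y t ξ = φ ξ + ∫ s in (0 : ℝ)..t, innerInt (fun η => A (y s η)) (g s) ξ)
    (hzeq : ∀ t ∈ Icc (0 : ℝ) T, ∀ ξ ∈ Icc (0 : ℝ) 1,
      z t ξ = φ ξ + ∫ s in (0 : ℝ)..t, innerInt (fun η => A (z s η)) (g s) ξ) :
    ∀ t ∈ Icc (0 : ℝ) T, ∀ ξ ∈ Icc (0 : ℝ) 1, y t ξ = z t ξ := by
  intro t ht ξ hξ
  have hα := he.lt_half
  have hT : 0 ≤ T := ht.1.trans ht.2
  have hR : 0 ≤ R := (hy t ht).nonneg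
  have hc := stieltjesConst_pos he.pos (by linarith [he.lt_half]) he.lt
  obtain ⟨M, hM, hA'⟩ := hA.loc R
  have h12 : 0 < 1 - 2 * α := by linarith
  have hM₁ := hA.pos
  obtain ⟨l, hl0, hl⟩ := exists_exp_weight (κ := stieltjesConst α β * (M₁ + 2 * M * R) /
    (1 - 2 * α)) hT (by positivity) hg.nonneg hg.int
  -- Starting from the trivial bound `2R`, each application of the equation halves the weighted norm
  -- of `y - z`.
  have hD : ∀ n : ℕ, ∀ s ∈ Icc (0 : ℝ) T,
      BddW α (fun ξ => y s ξ - z s ξ) (2 * R * (1 / 2) ^ n * Real.exp (l * s)) := by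
    intro n
    induction n with
    | zero =>
      intro s hs
      refine ((hy s hs).sub (hz s hs) (hym s)).mono ?_
      have : 1 ≤ Real.exp (l * s) := Real.one_le_exp (mul_nonneg hl0 hs.1)
      rw [pow_zero, mul_one]
      nlinarith
    | succ n ih =>
      intro s hs
      have := bddW_timeIntegral_sub he hA hg hym hzm hM.le hA' hl hy hz hyi hzi ih hs
      refine (this.congr fun ξ hξ => ?_).mono (le_of_eq ?_)
      · rw [hyeq s hs ξ hξ, hzeq s hs ξ hξ, add_sub_add_left_eq_sub]
      · rw [pow_succ]
        ring
  have hlim : Tendsto (fun n : ℕ => 2 * R * (1 / 2) ^ n * Real.exp (l * t)) atTop (𝓝 0) := by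
    have := ((tendsto_pow_atTop_nhds_zero_of_lt_one (r := (1 / 2 : ℝ)) (by norm_num)
      (by norm_num)).const_mul (2 * R)).mul_const (Real.exp (l * t))
    simpa using this
  have h0 : |y t ξ - z t ξ| ≤ 0 :=
    ge_of_tendsto hlim (Eventually.of_forall fun n => (hD n t ht).bound ξ hξ)
  exact sub_eq_zero.1 (abs_nonpos_iff.1 h0)

/-! ### Picard iteration -/

/-- The Picard iterates. -/
def picard (φ A : ℝ → ℝ) (g : ℝ → ℝ → ℝ) : ℕ → ℝ → ℝ → ℝ
  | 0 => fun _ ξ => φ ξ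
  | n + 1 => fun t ξ =>
      φ ξ + ∫ s in Ioc 0 t, innerInt (fun η => A (picard φ A g n s η)) (g s) ξ

/-- The limit of the Picard iterates. -/
def picardLim (φ A : ℝ → ℝ) (g : ℝ → ℝ → ℝ) (t ξ : ℝ) : ℝ :=
  limsup (fun n => picard φ A g n t ξ) atTop

/-- The parameter space is arbitrary: `Ω` gives a jointly measurable random field, `Unit` gives the
deterministic statement. -/
lemma measurable_picard {X : Type*} [MeasurableSpace X] {φ A : ℝ → ℝ} {g : X → ℝ → ℝ → ℝ}
    (hφ : Measurable φ) (hA : Measurable A)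
    (hg : Measurable fun p : X × ℝ × ℝ => g p.1 p.2.1 p.2.2) (n : ℕ) :
    Measurable fun p : X × ℝ × ℝ => picard φ A (g p.1) n p.2.1 p.2.2 := by
  induction n with
  | zero => exact hφ.comp measurable_snd.snd
  | succ n ih =>
    refine (hφ.comp measurable_snd.snd).add ?_
    have hp : Measurable (fun q : (X × ℝ) × ℝ => picard φ A (g q.1.1) n q.1.2 q.2) :=
      ih.comp (by fun_prop : Measurable fun q : (X × ℝ) × ℝ => (q.1.1, q.1.2, q.2))
    have hq : Measurable (fun q : (X × ℝ) × ℝ => g q.1.1 q.1.2 q.2) :=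
      hg.comp (by fun_prop : Measurable fun q : (X × ℝ) × ℝ => (q.1.1, q.1.2, q.2))
    have h1 : Measurable (fun q : (X × ℝ) × ℝ =>
        innerInt (fun η => A (picard φ A (g q.1.1) n q.1.2 η)) (g q.1.1 q.1.2) q.2) :=
      measurable_innerInt (X := X × ℝ)
        (f := fun q η => A (picard φ A (g q.1) n q.2 η)) (g := fun q => g q.1 q.2)
        (hA.comp hp) hq
    have h1' : Measurable (fun q : (X × ℝ × ℝ) × ℝ =>
        innerInt (fun η => A (picard φ A (g q.1.1) n q.2 η)) (g q.1.1 q.2) q.1.2.2) :=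
      h1.comp (by fun_prop : Measurable fun q : (X × ℝ × ℝ) × ℝ => ((q.1.1, q.2), q.1.2.2))
    have h2 : Measurable (fun q : (X × ℝ × ℝ) × ℝ =>
        {q : (X × ℝ × ℝ) × ℝ | 0 < q.2 ∧ q.2 ≤ q.1.2.1}.indicator (fun q =>
          innerInt (fun η => A (picard φ A (g q.1.1) n q.2 η)) (g q.1.1 q.2) q.1.2.2) q) :=
      h1'.indicator ((measurableSet_lt measurable_const measurable_snd).inter
          (measurableSet_le measurable_snd measurable_fst.snd.fst))
    have h3 := (h2.stronglyMeasurable.integral_prod_right' (ν := (volume : Measure ℝ))).measurable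
    convert h3 using 2 with p
    rw [← integral_indicator measurableSet_Ioc]
    rfl

lemma measurable_picardLim {X : Type*} [MeasurableSpace X] {φ A : ℝ → ℝ} {g : X → ℝ → ℝ → ℝ}
    (hφ : Measurable φ) (hA : Measurable A)
    (hg : Measurable fun p : X × ℝ × ℝ => g p.1 p.2.1 p.2.2) :
    Measurable fun p : X × ℝ × ℝ => picardLim φ A (g p.1) p.2.1 p.2.2 :=
  Measurable.limsup fun n => measurable_picard hφ hA hg n

lemma picardLim_eq_of_tendsto {φ : ℝ → ℝ} {t ξ x : ℝ}
    (h : Tendsto (fun n => picard φ A g n t ξ) atTop (𝓝 x)) : picardLim φ A g t ξ = x :=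
  h.limsup_eq

attribute [local irreducible] picardLim

lemma measurable_uncurry_picard {φ : ℝ → ℝ} (hφ : Measurable φ) (hA : Measurable A)
    (hg : Measurable (Function.uncurry g)) (n : ℕ) :
    Measurable (Function.uncurry (picard φ A g n)) :=
  have h : Measurable fun p : Unit × ℝ × ℝ => picard φ A g n p.2.1 p.2.2 :=
    measurable_picard (X := Unit) (g := fun _ => g) hφ hA (hg.comp measurable_snd) n
  h.comp (by fun_prop : Measurable fun p : ℝ × ℝ => (((), p) : Unit × ℝ × ℝ))

lemma measurable_uncurry_picardLim {φ : ℝ → ℝ} (hφ : Measurable φ) (hA : Measurable A)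
    (hg : Measurable (Function.uncurry g)) :
    Measurable (Function.uncurry (picardLim φ A g)) :=
  have h : Measurable fun p : Unit × ℝ × ℝ => picardLim φ A g p.2.1 p.2.2 :=
    measurable_picardLim (X := Unit) (g := fun _ => g) hφ hA (hg.comp measurable_snd)
  h.comp (by fun_prop : Measurable fun p : ℝ × ℝ => (((), p) : Unit × ℝ × ℝ))

/-- Existence of a solution which is bounded in `W^{α,∞}`. -/
theorem picardLim_spec (he : Exponents α β) (hA : Nonlinearity A M₁ M₂) (hg : Driver T β g Λ)
    (hT : 0 ≤ T) {φ : ℝ → ℝ} (hφm : Measurable φ) {Rφ : ℝ} (hφ : BddW α φ Rφ) :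
    ∃ R, (∀ t ∈ Icc (0 : ℝ) T, BddW α (picardLim φ A g t) R) ∧
      ∀ t ∈ Icc (0 : ℝ) T, ∀ ξ ∈ Icc (0 : ℝ) 1, picardLim φ A g t ξ =
        φ ξ + ∫ s in (0 : ℝ)..t, innerInt (fun η => A (picardLim φ A g s η)) (g s) ξ := by
  have hα := he.lt_half
  have hα0 := he.pos
  have h12 : 0 < 1 - 2 * α := by linarith
  have hM₁ := hA.pos
  have hM₂ := hA.nonneg
  have hRφ := hφ.nonneg
  have hc := stieltjesConst_pos he.pos (by linarith [he.lt_half]) he.lt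
  have hm := measurable_uncurry_picard hφm hA.measurable hg.meas
  have hms : ∀ n s, Measurable (picard φ A g n s) := fun n s =>
    (hm n).of_uncurry_left
  have hstep : ∀ n, ∀ t ∈ Icc (0 : ℝ) T, ∀ ξ, picard φ A g (n + 1) t ξ =
      φ ξ + ∫ s in (0 : ℝ)..t, innerInt (fun η => A (picard φ A g n s η)) (g s) ξ := by
    intro n t ht ξ
    rw [intervalIntegral.integral_of_le ht.1]
    rfl
  -- uniform bound
  obtain ⟨l, hl0, hl⟩ := exists_exp_weight (κ := stieltjesConst α β * M₁ / (1 - 2 * α)) hT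
    (by positivity) hg.nonneg hg.int
  -- The fixed point of `R ↦ Rφ + (M₂ / M₁ + R) / 2`, the bound that one Picard step produces under
  -- the chosen weight.
  set R₀ := 2 * Rφ + M₂ / M₁ with hR₀
  have hbd0 : ∀ n, ∀ t ∈ Icc (0 : ℝ) T, BddW α (picard φ A g n t) (R₀ * Real.exp (l * t)) := by
    intro n
    induction n with
    | zero =>
      intro t ht
      have h1 : 1 ≤ Real.exp (l * t) := Real.one_le_exp (mul_nonneg hl0 ht.1)
      have h2 : 0 ≤ M₂ / M₁ := by positivity
      exact hφ.mono (by nlinarith)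
    | succ n ih =>
      intro t ht
      have h1 : 1 ≤ Real.exp (l * t) := Real.one_le_exp (mul_nonneg hl0 ht.1)
      have h2 : 0 ≤ M₂ / M₁ := by positivity
      have hH := isHolderUnit_timeIntegral he hA hg (hm n) hl0 ih le_rfl ht.1 ht.2
      have hB := hH.bddW hα0.le (by linarith) (by linarith)
      refine ((hφ.add hB hφm).congr fun ξ _ => (hstep n t ht ξ).symm).mono ?_
      have h3 := mul_le_mul_of_nonneg_left (hl t ht) (show 0 ≤ M₂ / M₁ + R₀ by positivity)
      have e : stieltjesConst α β * (M₂ + M₁ * R₀) * (∫ s in (0 : ℝ)..t, Λ s * Real.exp (l * s)) /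
          (1 - α - α) = (M₂ / M₁ + R₀) * (stieltjesConst α β * M₁ / (1 - 2 * α) *
            ∫ s in (0 : ℝ)..t, Λ s * Real.exp (l * s)) := by
        rw [show 1 - α - α = 1 - 2 * α by ring]
        field_simp
      rw [e]
      have h4 : Rφ ≤ Rφ * Real.exp (l * t) := by nlinarith
      have h5 : Rφ * Real.exp (l * t) + (M₂ / M₁ + R₀) * (1 / 2 * Real.exp (l * t)) =
          R₀ * Real.exp (l * t) := by rw [hR₀]; ring
      linarith
  -- An unweighted radius is needed before the Lipschitz constant of `deriv A` on `[-R, R]` can be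
  -- fixed. A second weight, depending on that constant, is chosen afterwards.
  set R := R₀ * Real.exp (l * T) with hR
  have hR₀0 : 0 ≤ R₀ := by positivity
  have hbd : ∀ n, ∀ t ∈ Icc (0 : ℝ) T, BddW α (picard φ A g n t) R := fun n t ht =>
    (hbd0 n t ht).mono (mul_le_mul_of_nonneg_left
      (Real.exp_le_exp.2 (mul_le_mul_of_nonneg_left ht.2 hl0)) hR₀0)
  have hRn : 0 ≤ R := by positivity
  have hint := fun n ξ hξ => intervalIntegrable_innerInt he hA hg hT (hm n) (hbd n) (ξ := ξ) hξ
  -- geometric decay of the increments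
  obtain ⟨M, hM, hA'⟩ := hA.loc R
  obtain ⟨k, hk0, hk⟩ := exists_exp_weight (κ := stieltjesConst α β * (M₁ + 2 * M * R) /
    (1 - 2 * α)) hT (by positivity) hg.nonneg hg.int
  have hinc : ∀ n, ∀ t ∈ Icc (0 : ℝ) T,
      BddW α (fun ξ => picard φ A g (n + 1) t ξ - picard φ A g n t ξ)
        (2 * R * (1 / 2) ^ n * Real.exp (k * t)) := by
    intro n
    induction n with
    | zero =>
      intro t ht
      refine ((hbd 1 t ht).sub (hbd 0 t ht) (hms 1 t)).mono ?_
      have : 1 ≤ Real.exp (k * t) := Real.one_le_exp (mul_nonneg hk0 ht.1)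
      rw [pow_zero, mul_one]
      nlinarith
    | succ n ih =>
      intro t ht
      have := bddW_timeIntegral_sub he hA hg (hms (n + 1)) (hms n) hM.le hA' hk (hbd (n + 1))
        (hbd n) (hint (n + 1)) (hint n) ih ht
      refine (this.congr fun ξ _ => ?_).mono (le_of_eq ?_)
      · rw [hstep (n + 1) t ht ξ, hstep n t ht ξ, add_sub_add_left_eq_sub]
      · rw [pow_succ]
        ring
  -- The factor `1 - (1/2)^m` is the exact partial geometric sum, which makes the induction on `m`
  -- an identity of constants.
  have hinc2 : ∀ n m, ∀ t ∈ Icc (0 : ℝ) T,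
      BddW α (fun ξ => picard φ A g (n + m) t ξ - picard φ A g n t ξ)
        (4 * R * (1 / 2) ^ n * (1 - (1 / 2) ^ m) * Real.exp (k * t)) := by
    intro n m
    induction m with
    | zero =>
      intro t _
      refine ⟨fun ξ _ => by simp, fun ξ _ => by simp⟩
    | succ m ih =>
      intro t ht
      refine (((hinc (n + m) t ht).add (ih t ht) ((hms _ t).sub (hms _ t))).congr
        fun ξ _ => ?_).mono (le_of_eq ?_)
      · rw [← add_assoc]
        ring
      · rw [pow_add, pow_succ]
        ring
  have htend : ∀ t ∈ Icc (0 : ℝ) T, ∀ ξ ∈ Icc (0 : ℝ) 1,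
      Tendsto (fun n => picard φ A g n t ξ) atTop (𝓝 (picardLim φ A g t ξ)) := by
    intro t ht ξ hξ
    have hcauchy : CauchySeq fun n => picard φ A g n t ξ := by
      refine cauchySeq_of_le_geometric (1 / 2) (2 * R * Real.exp (k * t)) (by norm_num) fun n => ?_
      rw [dist_comm, Real.dist_eq]
      refine ((hinc n t ht).bound ξ hξ).trans (le_of_eq ?_)
      ring
    obtain ⟨x, hx⟩ := cauchySeq_tendsto_of_complete hcauchy
    rwa [picardLim_eq_of_tendsto hx]
  have hlimR : ∀ t ∈ Icc (0 : ℝ) T, BddW α (picardLim φ A g t) R := fun t ht =>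
    BddW.of_tendsto (fun n => hbd n t ht) (fun n => hms n t) (htend t ht)
  have hmL := measurable_uncurry_picardLim (g := g) hφm hA.measurable hg.meas
  have hmLs : ∀ s, Measurable (picardLim φ A g s) := fun s =>
    hmL.of_uncurry_left
  have hdiff : ∀ n, ∀ t ∈ Icc (0 : ℝ) T,
      BddW α (fun ξ => picardLim φ A g t ξ - picard φ A g n t ξ)
        (4 * R * (1 / 2) ^ n * Real.exp (k * t)) := by
    intro n t ht
    refine BddW.of_tendsto (u := fun m ξ => picard φ A g (n + m) t ξ - picard φ A g n t ξ)
      (fun m => (hinc2 n m t ht).mono ?_) (fun m => (hms _ t).sub (hms _ t)) fun ξ hξ => ?_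
    · refine mul_le_mul_of_nonneg_right ?_ (Real.exp_pos _).le
      refine mul_le_of_le_one_right (by positivity) ?_
      have : (0 : ℝ) ≤ (1 / 2) ^ m := by positivity
      linarith
    · have h1 : Tendsto (fun m => picard φ A g (n + m) t ξ) atTop (𝓝 (picardLim φ A g t ξ)) := by
        have := (tendsto_add_atTop_iff_nat n).2 (htend t ht ξ hξ)
        simpa only [add_comm n] using this
      exact h1.sub_const _
  have hintL := fun ξ hξ => intervalIntegrable_innerInt he hA hg hT hmL hlimR (ξ := ξ) hξ
  refine ⟨R, hlimR, fun t ht ξ hξ => ?_⟩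
  have h1 : Tendsto (fun n => picard φ A g (n + 1) t ξ) atTop (𝓝 (picardLim φ A g t ξ)) :=
    (htend t ht ξ hξ).comp (tendsto_add_atTop_nat 1)
  refine tendsto_nhds_unique h1 ?_
  rw [tendsto_iff_dist_tendsto_zero]
  have hlim : Tendsto (fun n : ℕ => 4 * R * (1 / 2) ^ n / 2 * Real.exp (k * t)) atTop (𝓝 0) := by
    have := (((tendsto_pow_atTop_nhds_zero_of_lt_one (r := (1 / 2 : ℝ)) (by norm_num)
      (by norm_num)).const_mul (4 * R)).div_const 2).mul_const (Real.exp (k * t))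
    simpa using this
  refine squeeze_zero (fun _ => dist_nonneg) (fun n => ?_) hlim
  -- The contraction estimate between the limit and the `n`-th iterate allows passing to the limit
  -- inside the equation.
  have := (bddW_timeIntegral_sub he hA hg hmLs (hms n) hM.le hA' hk hlimR (hbd n) hintL (hint n)
    (hdiff n) ht).bound ξ hξ
  rw [dist_comm, Real.dist_eq, hstep n t ht ξ, add_sub_add_left_eq_sub]
  exact this

end


/-! ### Dyadic chaining -/

/-- The dyadic floors of `x` at levels `m` and `m + 1` coincide or are neighbours at level `m + 1`.
Telescoping gives a geometric series, and continuity identifies its limit as `f x`. -/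
lemma abs_sub_floor_le {f : ℝ → ℝ} {K δ : ℝ} (hδ0 : 0 ≤ δ) (hδ1 : δ < 1)
    (hf : ContinuousOn f (Icc 0 1)) (hK : 0 ≤ K)
    (hd : ∀ n k : ℕ, k < 2 ^ n → |f (((k : ℝ) + 1) / 2 ^ n) - f ((k : ℝ) / 2 ^ n)| ≤ K * δ ^ n)
    {x : ℝ} (hx : x ∈ Icc (0 : ℝ) 1) (n : ℕ) :
    |f ((⌊2 ^ n * x⌋₊ : ℝ) / 2 ^ n) - f x| ≤ K * δ * δ ^ n / (1 - δ) := by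
  have hmem : ∀ n : ℕ, (⌊2 ^ n * x⌋₊ : ℝ) / 2 ^ n ∈ Icc (0 : ℝ) 1 := by
    intro n
    have h2 : (0 : ℝ) < 2 ^ n := by positivity
    refine ⟨by positivity, ?_⟩
    rw [div_le_one h2]
    exact (Nat.floor_le (mul_nonneg h2.le hx.1)).trans (mul_le_of_le_one_right h2.le hx.2)
  have hlim : Tendsto (fun n : ℕ => (⌊2 ^ n * x⌋₊ : ℝ) / 2 ^ n) atTop (𝓝 x) := by
    have h1 : Tendsto (fun n : ℕ => x - (1 / 2 : ℝ) ^ n) atTop (𝓝 x) := by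
      have := (tendsto_pow_atTop_nhds_zero_of_lt_one (r := (1 / 2 : ℝ)) (by norm_num)
        (by norm_num)).const_sub x
      rwa [sub_zero] at this
    refine tendsto_of_tendsto_of_tendsto_of_le_of_le h1 tendsto_const_nhds (fun n => ?_)
      (fun n => ?_)
    · have h2 : (0 : ℝ) < 2 ^ n := by positivity
      simp only
      rw [le_div_iff₀ h2, sub_mul, ← mul_pow]
      have := Nat.lt_floor_add_one (2 ^ n * x)
      norm_num
      linarith
    · have h2 : (0 : ℝ) < 2 ^ n := by positivity
      simp only
      rw [div_le_iff₀ h2, mul_comm x]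
      exact Nat.floor_le (mul_nonneg h2.le hx.1)
  have hflim : Tendsto (fun n : ℕ => f ((⌊2 ^ n * x⌋₊ : ℝ) / 2 ^ n)) atTop (𝓝 (f x)) :=
    (hf x hx).tendsto.comp (tendsto_nhdsWithin_iff.2 ⟨hlim, Eventually.of_forall hmem⟩)
  refine dist_le_of_le_geometric_of_tendsto (r := δ) (C := K * δ) hδ1 (fun m => ?_) hflim n
  rw [dist_comm, Real.dist_eq]
  have h2 : (0 : ℝ) < 2 ^ m := by positivity
  have hy0 : 0 ≤ 2 ^ m * x := mul_nonneg h2.le hx.1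
  set k := ⌊2 ^ m * x⌋₊ with hk
  have hk1 : (k : ℝ) ≤ 2 ^ m * x := Nat.floor_le hy0
  have hk2 : 2 ^ m * x < k + 1 := Nat.lt_floor_add_one _
  have e : ⌊2 ^ (m + 1) * x⌋₊ = 2 * k ∨ ⌊2 ^ (m + 1) * x⌋₊ = 2 * k + 1 := by
    have hpow : (2 : ℝ) ^ (m + 1) * x = 2 * (2 ^ m * x) := by rw [pow_succ]; ring
    rw [hpow]
    rcases lt_or_ge (2 * (2 ^ m * x)) (2 * k + 1) with h | h
    · left
      rw [Nat.floor_eq_iff (by linarith)]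
      push_cast
      constructor <;> linarith
    · right
      rw [Nat.floor_eq_iff (by linarith)]
      push_cast
      constructor <;> linarith
  have e2 : ((2 * k : ℕ) : ℝ) / 2 ^ (m + 1) = (k : ℝ) / 2 ^ m := by
    rw [pow_succ]
    push_cast
    field_simp
  have hδn : 0 ≤ K * δ * δ ^ m := by positivity
  rcases e with e | e
  · rw [e, e2, sub_self, abs_zero]
    exact hδn
  · rw [e, ← e2]
    have hlt : 2 * k < 2 ^ (m + 1) := by
      have h3 : ((⌊2 ^ (m + 1) * x⌋₊ : ℕ) : ℝ) ≤ 2 ^ (m + 1) * x :=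
        Nat.floor_le (mul_nonneg (by positivity) hx.1)
      rw [e] at h3
      have h4 : ((2 * k + 1 : ℕ) : ℝ) ≤ 2 ^ (m + 1) :=
        h3.trans (mul_le_of_le_one_right (by positivity) hx.2)
      have h5 : 2 * k + 1 ≤ 2 ^ (m + 1) := by exact_mod_cast h4
      omega
    have := hd (m + 1) (2 * k) hlt
    rw [pow_succ δ] at this
    push_cast at this ⊢
    linarith

/-- The constant in the chaining estimate. -/
def chainConst (β : ℝ) : ℝ := 2 * (1 + 2 * ((1 / 2) ^ β / (1 - (1 / 2) ^ β)))

/-- A continuous function with small dyadic increments is Hölder continuous. -/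
lemma abs_sub_le_of_dyadic {f : ℝ → ℝ} {K β : ℝ} (hβ : 0 < β) (hβ1 : β ≤ 1)
    (hf : ContinuousOn f (Icc 0 1)) (hK : 0 ≤ K)
    (hd : ∀ n k : ℕ, k < 2 ^ n →
      |f (((k : ℝ) + 1) / 2 ^ n) - f ((k : ℝ) / 2 ^ n)| ≤ K * ((1 / 2) ^ β) ^ n)
    {x y : ℝ} (hx : x ∈ Icc (0 : ℝ) 1) (hy : y ∈ Icc (0 : ℝ) 1) :
    |f x - f y| ≤ chainConst β * K * |x - y| ^ β := by
  have hδ0 : 0 ≤ ((1 / 2 : ℝ)) ^ β := Real.rpow_nonneg (by norm_num) _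
  have hδ1 : ((1 / 2 : ℝ)) ^ β < 1 := Real.rpow_lt_one (by norm_num) (by norm_num) hβ
  set δ : ℝ := (1 / 2) ^ β with hδ
  have hmain : ∀ x ∈ Icc (0 : ℝ) 1, ∀ y ∈ Icc (0 : ℝ) 1, x < y →
      |f x - f y| ≤ chainConst β * K * |x - y| ^ β := by
    intro x hx y hy hxy
    -- The scale `2^(-n-1) < y - x ≤ 2^(-n)`: the level-`n` floors of `x` and `y` are then equal or
    -- adjacent.
    obtain ⟨n, hn1, hn2⟩ := exists_nat_pow_near_of_lt_one (sub_pos.2 hxy)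
      (by linarith [hx.1, hy.2]) (show (0 : ℝ) < 1 / 2 by norm_num) (by norm_num)
    have h2 : (0 : ℝ) < 2 ^ n := by positivity
    have ex := abs_sub_floor_le hδ0 hδ1 hf hK hd hx n
    have ey := abs_sub_floor_le hδ0 hδ1 hf hK hd hy n
    set kx := ⌊2 ^ n * x⌋₊ with hkx
    set ky := ⌊2 ^ n * y⌋₊ with hky
    have hdn : 2 ^ n * (y - x) ≤ 1 := by
      have : (1 / 2 : ℝ) ^ n = 1 / 2 ^ n := by rw [one_div_pow]
      rw [this, le_div_iff₀ h2] at hn2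
      linarith
    have hle : kx ≤ ky := Nat.floor_mono (mul_le_mul_of_nonneg_left hxy.le h2.le)
    have hle2 : ky ≤ kx + 1 := by
      have : ky ≤ ⌊2 ^ n * x + 1⌋₊ := Nat.floor_mono (by linarith)
      rwa [Nat.floor_add_one (mul_nonneg h2.le hx.1)] at this
    have em : |f ((ky : ℝ) / 2 ^ n) - f ((kx : ℝ) / 2 ^ n)| ≤ K * δ ^ n := by
      rcases Nat.eq_or_lt_of_le hle with h | h
      · rw [h, sub_self, abs_zero]
        positivity
      · have hk : ky = kx + 1 := by omega
        have hlt : kx < 2 ^ n := by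
          have h3 : ((ky : ℕ) : ℝ) ≤ 2 ^ n * y := Nat.floor_le (mul_nonneg h2.le hy.1)
          have h4 : ((ky : ℕ) : ℝ) ≤ 2 ^ n := h3.trans (mul_le_of_le_one_right h2.le hy.2)
          have h5 : ky ≤ 2 ^ n := by exact_mod_cast h4
          omega
        have := hd n kx hlt
        rw [hk]
        push_cast
        exact this
    have htri : |f x - f y| ≤ |f ((kx : ℝ) / 2 ^ n) - f x| +
        |f ((ky : ℝ) / 2 ^ n) - f ((kx : ℝ) / 2 ^ n)| + |f ((ky : ℝ) / 2 ^ n) - f y| := by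
      have : f x - f y = -(f ((kx : ℝ) / 2 ^ n) - f x) -
        (f ((ky : ℝ) / 2 ^ n) - f ((kx : ℝ) / 2 ^ n)) + (f ((ky : ℝ) / 2 ^ n) - f y) := by ring
      rw [this]
      refine (abs_add_le _ _).trans (add_le_add ((abs_sub _ _).trans (le_of_eq ?_)) le_rfl)
      rw [abs_neg]
    have hpow : δ ^ n ≤ 2 * |x - y| ^ β := by
      have h3 : (1 / 2 : ℝ) ^ n ≤ 2 * (y - x) := by
        rw [pow_succ] at hn1
        linarith
      have e1 : δ ^ n = ((1 / 2 : ℝ) ^ n) ^ β := by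
        rw [hδ, ← Real.rpow_natCast, ← Real.rpow_natCast, ← Real.rpow_mul (by norm_num),
          ← Real.rpow_mul (by norm_num), mul_comm]
      rw [e1, abs_sub_comm, abs_of_pos (sub_pos.2 hxy)]
      refine (Real.rpow_le_rpow (by positivity) h3 hβ.le).trans ?_
      rw [Real.mul_rpow (by norm_num) (by linarith)]
      refine mul_le_mul_of_nonneg_right ?_ (Real.rpow_nonneg (by linarith) _)
      have := Real.rpow_le_rpow_of_exponent_le (show (1 : ℝ) ≤ 2 by norm_num) hβ1
      rwa [Real.rpow_one] at this
    have h1δ : 0 < 1 - δ := by linarith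
    have hfac : 0 ≤ K * (1 + 2 * (δ / (1 - δ))) := by positivity
    calc |f x - f y| ≤ K * δ * δ ^ n / (1 - δ) + K * δ ^ n + K * δ * δ ^ n / (1 - δ) := by
          linarith
      _ = K * (1 + 2 * (δ / (1 - δ))) * δ ^ n := by ring
      _ ≤ K * (1 + 2 * (δ / (1 - δ))) * (2 * |x - y| ^ β) :=
          mul_le_mul_of_nonneg_left hpow hfac
      _ = chainConst β * K * |x - y| ^ β := by
          rw [chainConst, ← hδ]
          ring
  rcases lt_trichotomy x y with h | h | h
  · exact hmain x hx y hy h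
  · subst h
    rw [sub_self, sub_self, abs_zero, Real.zero_rpow hβ.ne', mul_zero]
  · rw [abs_sub_comm, abs_sub_comm x]
    exact hmain y hy x hx h

lemma chainConst_nonneg {β : ℝ} (hβ : 0 < β) : 0 ≤ chainConst β := by
  have hδ0 : 0 ≤ ((1 / 2 : ℝ)) ^ β := Real.rpow_nonneg (by norm_num) _
  have hδ1 : ((1 / 2 : ℝ)) ^ β < 1 := Real.rpow_lt_one (by norm_num) (by norm_num) hβ
  have : 0 < 1 - ((1 / 2 : ℝ)) ^ β := by linarith
  unfold chainConst
  positivity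

/-! ### Moments of the increments -/

/-- Absolute moments of the standard Gaussian law. -/
def gaussMoment (p : ℕ) : ℝ≥0∞ := ∫⁻ x, ENNReal.ofReal (|x| ^ p) ∂(gaussianReal 0 1)

lemma gaussMoment_lt_top (p : ℕ) : gaussMoment p < ⊤ := by
  have h : MemLp id (p : ℝ≥0∞) (gaussianReal 0 1) :=
    memLp_id_gaussianReal' (p : ℝ≥0∞) (ENNReal.natCast_ne_top p)
  have h2 := h.integrable_norm_pow'
  simpa [gaussMoment] using h2.lintegral_lt_top

/-- By the covariance, the increment is centred Gaussian with variance `|γ - η|^(2H)`, that is, `|γ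
- η|^H` times a standard Gaussian in law. -/
lemma IsFBM.lintegral_abs_sub_pow {Ω : Type*} [MeasurableSpace Ω] {P : Measure Ω}
    {H : ℝ} (hH : 0 < H) {X : Icc (0 : ℝ) 1 → Ω → ℝ} (hX : IsFBM H X P) (γ η : Icc (0 : ℝ) 1)
    (p : ℕ) :
    ∫⁻ ω, ENNReal.ofReal (|X γ ω - X η ω| ^ p) ∂P =
      ENNReal.ofReal ((|(γ : ℝ) - η| ^ H) ^ p) * gaussMoment p := by
  have := hX.gaussian.isProbabilityMeasure
  have hg : HasGaussianLaw (fun ω => X γ ω - X η ω) P := hX.gaussian.hasGaussianLaw_fun_sub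
  have hγ := hX.gaussian.hasGaussianLaw_eval γ
  have hη := hX.gaussian.hasGaussianLaw_eval η
  have hmean : ∫ ω, (X γ ω - X η ω) ∂P = 0 := by
    rw [integral_sub hγ.integrable hη.integrable, hX.centered, hX.centered, sub_zero]
  set c := |(γ : ℝ) - η| ^ H with hc
  have hc0 : 0 ≤ c := Real.rpow_nonneg (abs_nonneg _) _
  have hvar : Var[fun ω => X γ ω - X η ω; P] = c ^ 2 := by
    rw [variance_of_integral_eq_zero hg.aemeasurable hmean]
    have e : ∀ ω, (X γ ω - X η ω) ^ 2 = X γ ω * X γ ω - 2 * (X γ ω * X η ω) + X η ω * X η ω :=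
      fun ω => by ring
    have i1 : Integrable (fun ω => X γ ω * X γ ω) P := hγ.memLp_two.integrable_mul hγ.memLp_two
    have i2 : Integrable (fun ω => X γ ω * X η ω) P := hγ.memLp_two.integrable_mul hη.memLp_two
    have i3 : Integrable (fun ω => X η ω * X η ω) P := hη.memLp_two.integrable_mul hη.memLp_two
    have i12 : Integrable (fun ω => X γ ω * X γ ω - 2 * (X γ ω * X η ω)) P :=
      i1.sub (i2.const_mul 2)
    simp only [e]
    rw [integral_add i12 i3, integral_sub i1 (i2.const_mul 2),
      integral_const_mul, hX.covariance, hX.covariance, hX.covariance, sub_self, sub_self,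
      abs_zero, Real.zero_rpow (by positivity), hc, ← Real.rpow_natCast,
      ← Real.rpow_mul (abs_nonneg _), abs_sub_comm (η : ℝ)]
    push_cast
    rw [mul_comm H 2]
    ring
  have hlaw : P.map (fun ω => X γ ω - X η ω) = (gaussianReal 0 1).map (c * ·) := by
    rw [hg.map_eq_gaussianReal, gaussianReal_map_const_mul, hmean, hvar, mul_zero, mul_one]
    congr 1
    ext
    simp [sq_nonneg]
  have hmeas : Measurable fun x : ℝ => ENNReal.ofReal (|x| ^ p) := by fun_prop
  calc ∫⁻ ω, ENNReal.ofReal (|X γ ω - X η ω| ^ p) ∂P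
      = ∫⁻ x, ENNReal.ofReal (|x| ^ p) ∂(P.map (fun ω => X γ ω - X η ω)) :=
        (lintegral_map' hmeas.aemeasurable hg.aemeasurable).symm
    _ = ∫⁻ x, ENNReal.ofReal (|c * x| ^ p) ∂(gaussianReal 0 1) := by
        rw [hlaw, lintegral_map hmeas (by fun_prop)]
    _ = ∫⁻ x, ENNReal.ofReal (c ^ p) * ENNReal.ofReal (|x| ^ p) ∂(gaussianReal 0 1) := by
        congr 1
        ext x
        rw [abs_mul, mul_pow, abs_of_nonneg hc0, ENNReal.ofReal_mul (by positivity)]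
    _ = ENNReal.ofReal (c ^ p) * gaussMoment p := by
        rw [lintegral_const_mul _ hmeas, gaussMoment]

/-! ### The Hölder modulus -/

/-- The sum of all weighted dyadic increments of a path. -/
def dyadicSum (β : ℝ) (p : ℕ) (f : ℝ → ℝ) : ℝ≥0∞ :=
  ∑' n : ℕ, ∑ k ∈ Finset.range (2 ^ n), ENNReal.ofReal
    (((2 : ℝ) ^ n) ^ (β * p) * |f (((k : ℝ) + 1) / 2 ^ n) - f ((k : ℝ) / 2 ^ n)| ^ p)

/-- Each weighted increment is at most the whole sum `q`. Using `q ≤ (1 + q)^p` in place of a `p`-th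
root keeps the Hölder constant affine in `q`, so integrability of `q` in time passes to it. -/
lemma abs_sub_le_of_dyadicSum {f : ℝ → ℝ} {β : ℝ} {p : ℕ} (hβ : 0 < β) (hβ1 : β ≤ 1)
    (hp : p ≠ 0) (hf : ContinuousOn f (Icc 0 1)) (hfin : dyadicSum β p f < ⊤)
    {x y : ℝ} (hx : x ∈ Icc (0 : ℝ) 1) (hy : y ∈ Icc (0 : ℝ) 1) :
    |f x - f y| ≤ chainConst β * (1 + (dyadicSum β p f).toReal) * |x - y| ^ β := by
  set q := (dyadicSum β p f).toReal with hq
  have hq0 : 0 ≤ q := ENNReal.toReal_nonneg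
  refine abs_sub_le_of_dyadic hβ hβ1 hf (by linarith) (fun n k hk => ?_) hx hy
  set Δ := |f (((k : ℝ) + 1) / 2 ^ n) - f ((k : ℝ) / 2 ^ n)| with hΔ
  have hΔ0 : 0 ≤ Δ := abs_nonneg _
  have h1 : ENNReal.ofReal (((2 : ℝ) ^ n) ^ (β * p) * Δ ^ p) ≤ dyadicSum β p f := by
    refine le_trans ?_ (ENNReal.le_tsum n)
    exact Finset.single_le_sum (f := fun k : ℕ => ENNReal.ofReal
      (((2 : ℝ) ^ n) ^ (β * p) * |f (((k : ℝ) + 1) / 2 ^ n) - f ((k : ℝ) / 2 ^ n)| ^ p))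
      (fun _ _ => zero_le) (Finset.mem_range.2 hk)
  have h2 : ((2 : ℝ) ^ n) ^ (β * p) * Δ ^ p ≤ q :=
    (ENNReal.ofReal_le_iff_le_toReal hfin.ne).1 h1
  have h3 : (((2 : ℝ) ^ n) ^ β * Δ) ^ p ≤ (1 + q) ^ p := by
    rw [mul_pow, ← Real.rpow_natCast (((2 : ℝ) ^ n) ^ β), ← Real.rpow_mul (by positivity)]
    refine h2.trans ?_
    have := le_self_pow₀ (show 1 ≤ 1 + q by linarith) hp
    linarith
  have h4 : ((2 : ℝ) ^ n) ^ β * Δ ≤ 1 + q :=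
    (pow_le_pow_iff_left₀ (by positivity) (by linarith) hp).1 h3
  have e : ((1 / 2 : ℝ) ^ β) ^ n = (((2 : ℝ) ^ n) ^ β)⁻¹ := by
    rw [← Real.rpow_natCast, ← Real.rpow_mul (by norm_num), mul_comm, Real.rpow_mul (by norm_num),
      Real.rpow_natCast, one_div_pow, one_div, Real.inv_rpow (by positivity)]
  rw [e, ← div_eq_mul_inv, le_div_iff₀ (by positivity), mul_comm]
  exact h4

/-- Level `n` has `2^n` increments, each contributing `2^(nβp) 2^(-nHp)` times a Gaussian moment: a
geometric series. Only the law of the single process enters, so the value is the same at every time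
of the field. -/
lemma IsFBM.lintegral_dyadicSum {Ω : Type*} [MeasurableSpace Ω] {P : Measure Ω}
    {H : ℝ} (hH : 0 < H) {X : Ω → ℝ → ℝ} (hX : IsFBM H (fun ξ ω => X ω ξ) P)
    (hm : ∀ ξ ∈ Icc (0 : ℝ) 1, Measurable fun ω => X ω ξ) (β : ℝ) (p : ℕ) :
    ∫⁻ ω, dyadicSum β p (X ω) ∂P =
      ∑' n : ℕ, ENNReal.ofReal ((2 : ℝ) ^ (1 - p * (H - β))) ^ n * gaussMoment p := by
  have hmem : ∀ n k : ℕ, k < 2 ^ n → (k : ℝ) / 2 ^ n ∈ Icc (0 : ℝ) 1 ∧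
      ((k : ℝ) + 1) / 2 ^ n ∈ Icc (0 : ℝ) 1 := by
    intro n k hk
    have h2 : (0 : ℝ) < 2 ^ n := by positivity
    have h3 : (k : ℝ) + 1 ≤ 2 ^ n := by exact_mod_cast hk
    refine ⟨⟨by positivity, ?_⟩, ⟨by positivity, ?_⟩⟩
    · rw [div_le_one h2]
      linarith
    · rw [div_le_one h2]
      exact h3
  have hmeas : ∀ n k : ℕ, k < 2 ^ n → Measurable fun ω => ENNReal.ofReal
      (((2 : ℝ) ^ n) ^ (β * p) * |X ω (((k : ℝ) + 1) / 2 ^ n) - X ω ((k : ℝ) / 2 ^ n)| ^ p) := by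
    intro n k hk
    have h1 := hm _ (hmem n k hk).1
    have h2 := hm _ (hmem n k hk).2
    fun_prop
  unfold dyadicSum
  rw [lintegral_tsum fun n => (Finset.measurable_sum _ fun k hk =>
    hmeas n k (Finset.mem_range.1 hk)).aemeasurable]
  congr 1
  ext n
  rw [lintegral_finsetSum' _ fun k hk => (hmeas n k (Finset.mem_range.1 hk)).aemeasurable]
  have h2 : (0 : ℝ) < 2 ^ n := by positivity
  have hterm : ∀ k ∈ Finset.range (2 ^ n), ∫⁻ ω, ENNReal.ofReal
      (((2 : ℝ) ^ n) ^ (β * p) * |X ω (((k : ℝ) + 1) / 2 ^ n) - X ω ((k : ℝ) / 2 ^ n)| ^ p) ∂P =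
      ENNReal.ofReal (((2 : ℝ) ^ n) ^ (β * p) * ((2 : ℝ) ^ n) ^ (-(H * p))) * gaussMoment p := by
    intro k hk
    have hk' := hmem n k (Finset.mem_range.1 hk)
    have := hX.lintegral_abs_sub_pow hH ⟨_, hk'.2⟩ ⟨_, hk'.1⟩ p
    simp only at this
    have e0 : ∀ ω, ENNReal.ofReal (((2 : ℝ) ^ n) ^ (β * p) *
        |X ω (((k : ℝ) + 1) / 2 ^ n) - X ω ((k : ℝ) / 2 ^ n)| ^ p) =
        ENNReal.ofReal (((2 : ℝ) ^ n) ^ (β * p)) *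
        ENNReal.ofReal (|X ω (((k : ℝ) + 1) / 2 ^ n) - X ω ((k : ℝ) / 2 ^ n)| ^ p) :=
      fun ω => ENNReal.ofReal_mul (by positivity)
    simp only [e0]
    rw [lintegral_const_mul' _ _ ENNReal.ofReal_ne_top, this, ← mul_assoc,
      ← ENNReal.ofReal_mul (by positivity)]
    congr 3
    rw [← sub_div, add_sub_cancel_left, abs_of_pos (by positivity), ← Real.rpow_natCast,
      ← Real.rpow_mul (by positivity), one_div, Real.inv_rpow h2.le, Real.rpow_neg h2.le]
  rw [Finset.sum_congr rfl hterm, Finset.sum_const, Finset.card_range, nsmul_eq_mul, ← mul_assoc]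
  congr 1
  rw [← ENNReal.ofReal_pow (by positivity)]
  have e1 : ((2 ^ n : ℕ) : ℝ≥0∞) = ENNReal.ofReal ((2 : ℝ) ^ n) := by
    rw [ENNReal.ofReal_pow (by norm_num)]
    simp
  rw [e1, ← ENNReal.ofReal_mul (by positivity)]
  congr 1
  rw [← Real.rpow_add h2]
  have e2 : (2 : ℝ) ^ n * (2 ^ n) ^ (β * p + -(H * p)) = ((2 : ℝ) ^ n) ^ (1 - p * (H - β)) := by
    rw [show 1 - p * (H - β) = 1 + (β * p + -(H * p)) by ring, Real.rpow_add h2 1, Real.rpow_one]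
  rw [e2, ← Real.rpow_natCast, ← Real.rpow_natCast, ← Real.rpow_mul (by norm_num),
    ← Real.rpow_mul (by norm_num), mul_comm]

lemma tsum_geometric_mul_lt_top {r : ℝ} (hr : r < 0) {c : ℝ≥0∞} (hc : c < ⊤) :
    ∑' n : ℕ, ENNReal.ofReal ((2 : ℝ) ^ r) ^ n * c < ⊤ := by
  rw [ENNReal.tsum_mul_right, ENNReal.tsum_geometric]
  refine ENNReal.mul_lt_top ?_ hc
  rw [ENNReal.inv_lt_top, tsub_pos_iff_lt, ENNReal.ofReal_lt_one]
  exact Real.rpow_lt_one_of_one_lt_of_neg (by norm_num) hr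


/-! ### The random driver -/

lemma measurable_dyadicSum {X : Type*} [MeasurableSpace X] {f : X → ℝ → ℝ}
    (hf : ∀ ξ, Measurable fun x => f x ξ) (β : ℝ) (p : ℕ) :
    Measurable fun x => dyadicSum β p (f x) := by
  refine Measurable.tsum fun n => Finset.measurable_sum _ fun k _ => ?_
  have h1 := hf (((k : ℝ) + 1) / 2 ^ n)
  have h2 := hf ((k : ℝ) / 2 ^ n)
  fun_prop

/-- The restriction of `f` to the rectangle `[0,T] × [0,1]`, extended constantly. -/
def clampRect {T : ℝ} (hT : 0 ≤ T) (f : ℝ → ℝ → ℝ) (s ξ : ℝ) : ℝ :=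
  f (projIcc 0 T hT s) (projIcc 0 1 zero_le_one ξ)

lemma clampRect_of_mem {T : ℝ} (hT : 0 ≤ T) (f : ℝ → ℝ → ℝ) {s ξ : ℝ} (hs : s ∈ Icc 0 T)
    (hξ : ξ ∈ Icc (0 : ℝ) 1) : clampRect hT f s ξ = f s ξ := by
  rw [clampRect, projIcc_of_mem _ hs, projIcc_of_mem _ hξ]

lemma measurable_clampRect {X : Type*} [MeasurableSpace X] {T : ℝ} (hT : 0 ≤ T)
    {f : X → ℝ → ℝ → ℝ}
    (hf : Measurable fun p : X × Icc (0 : ℝ) T × Icc (0 : ℝ) 1 => f p.1 p.2.1 p.2.2) :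
    Measurable fun p : X × ℝ × ℝ => clampRect hT (f p.1) p.2.1 p.2.2 := by
  have h1 : Measurable (projIcc 0 T hT) := continuous_projIcc.measurable
  have h2 : Measurable (projIcc (0 : ℝ) 1 zero_le_one) := continuous_projIcc.measurable
  have h3 : Measurable fun p : X × ℝ × ℝ =>
      ((p.1, projIcc 0 T hT p.2.1, projIcc (0 : ℝ) 1 zero_le_one p.2.2) :
        X × Icc (0 : ℝ) T × Icc (0 : ℝ) 1) := by fun_prop
  exact hf.comp h3

lemma measurable_uncurry_clampRect {T : ℝ} (hT : 0 ≤ T) {f : ℝ → ℝ → ℝ}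
    (hf : Measurable fun p : Icc (0 : ℝ) T × Icc (0 : ℝ) 1 => f p.1 p.2) :
    Measurable (Function.uncurry (clampRect hT f)) := by
  have h : Measurable fun p : Unit × ℝ × ℝ => clampRect hT f p.2.1 p.2.2 :=
    measurable_clampRect (X := Unit) (f := fun _ => f) hT (hf.comp measurable_snd)
  exact h.comp (by fun_prop : Measurable fun p : ℝ × ℝ => (((), p) : Unit × ℝ × ℝ))

/-- Almost every path of the noise agrees, at almost every time, with a driver; the drivers can be
chosen jointly measurable. -/
theorem IsFBMField.exists_driver {Ω : Type*} [MeasurableSpace Ω] {P : Measure Ω}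
    [IsProbabilityMeasure P] {T H β : ℝ} {B : Ω → ℝ → ℝ → ℝ} (hB : IsFBMField T H B P)
    (hT : 0 ≤ T) (hβ : 0 < β) (hβH : β < H) (hβ1 : β ≤ 1) :
    ∃ (g : Ω → ℝ → ℝ → ℝ) (Λ : Ω → ℝ → ℝ),
      (Measurable fun p : Ω × ℝ × ℝ => g p.1 p.2.1 p.2.2) ∧
      (∀ ω, Driver T β (g ω) (Λ ω)) ∧
      ∀ᵐ ω ∂P, ∀ᵐ s ∂(volume.restrict (Icc 0 T)), ∀ ξ ∈ Icc (0 : ℝ) 1, g ω s ξ = B ω s ξ := by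
  -- For such `p` the geometric ratio `2^(1 - p(H - β))` is less than `1`.
  obtain ⟨p, hp⟩ := exists_nat_gt (1 / (H - β))
  have hHβ : 0 < H - β := by linarith
  have hp1 : 1 - p * (H - β) < 0 := by
    rw [div_lt_iff₀ hHβ] at hp
    linarith
  have hp0 : p ≠ 0 := by
    rintro rfl
    norm_num at hp1
  set C : Ω → ℝ → ℝ → ℝ := fun ω => clampRect hT (B ω) with hC
  have hCm : Measurable fun q : Ω × ℝ × ℝ => C q.1 q.2.1 q.2.2 :=
    measurable_clampRect hT hB.measurable
  have hQm : Measurable fun q : Ω × ℝ => dyadicSum β p (C q.1 q.2) :=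
    measurable_dyadicSum (f := fun q : Ω × ℝ => C q.1 q.2) (fun ξ => hCm.comp
      (by fun_prop : Measurable fun q : Ω × ℝ => (q.1, q.2, ξ))) β p
  set κ : ℝ≥0∞ := ∑' n : ℕ, ENNReal.ofReal ((2 : ℝ) ^ (1 - p * (H - β))) ^ n * gaussMoment p
  have hκ : κ < ⊤ := tsum_geometric_mul_lt_top hp1 (gaussMoment_lt_top p)
  have hmom : ∀ s, ∫⁻ ω, dyadicSum β p (C ω s) ∂P = κ := by
    intro s
    refine IsFBM.lintegral_dyadicSum (by linarith) (X := fun ω => C ω s) ?_ (fun ξ _ => hCm.comp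
      (by fun_prop : Measurable fun ω : Ω => (ω, s, ξ))) β p
    have h := hB.fbm _ (projIcc 0 T hT s).2
    simpa only [hC, clampRect, projIcc_val] using h
  -- Fubini exchanges "for every time, finite expectation" for "almost surely, integrable in time";
  -- no relation between different times is used.
  have hfin : ∀ᵐ ω ∂P, ∫⁻ s in Icc 0 T, dyadicSum β p (C ω s) < ⊤ := by
    refine ae_lt_top hQm.lintegral_prod_right' ?_
    rw [lintegral_lintegral_swap hQm.aemeasurable]
    simp only [hmom]
    rw [setLIntegral_const, Real.volume_Icc]
    exact ENNReal.mul_ne_top hκ.ne ENNReal.ofReal_ne_top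
  obtain ⟨N, hN, hNm, hNP⟩ := exists_measurable_superset_of_null
    (ae_iff.1 (hB.continuous.and hfin))
  have hcont : ∀ ω, ω ∉ N → ∀ s, ContinuousOn (C ω s) (Icc 0 1) := by
    intro ω hω s
    have h := (not_not.1 fun h => hω (hN h)).1 _ (projIcc 0 T hT s).2
    refine h.congr fun ξ hξ => ?_
    simp only [hC, clampRect, projIcc_of_mem _ hξ]
  have hint : ∀ ω, ω ∉ N → ∫⁻ s in Icc 0 T, dyadicSum β p (C ω s) < ⊤ := fun ω hω =>
    (not_not.1 fun h => hω (hN h)).2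
  -- Off `G` both the noise and its Hölder constant are replaced by `0`. The driver conditions then
  -- hold for every `ω`, and joint measurability is kept because `N` is a measurable null set.
  set G : Set (Ω × ℝ) := {q | q.1 ∉ N ∧ dyadicSum β p (C q.1 q.2) < ⊤} with hG
  have hGm : MeasurableSet G :=
    (measurable_fst hNm).compl.inter (measurableSet_lt hQm measurable_const)
  refine ⟨fun ω s ξ => G.indicator (fun q => C q.1 q.2 ξ) (ω, s),
    fun ω s => G.indicator
      (fun q => chainConst β * (1 + (dyadicSum β p (C q.1 q.2)).toReal)) (ω, s), ?_, ?_, ?_⟩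
  · have hG' : MeasurableSet {q : Ω × ℝ × ℝ | (q.1, q.2.1) ∈ G} :=
      (by fun_prop : Measurable fun q : Ω × ℝ × ℝ => (q.1, q.2.1)) hGm
    exact hCm.indicator hG'
  · intro ω
    have hΛm : Measurable fun s => G.indicator
        (fun q => chainConst β * (1 + (dyadicSum β p (C q.1 q.2)).toReal)) (ω, s) :=
      (((hQm.ennreal_toReal.const_add 1).const_mul _).indicator hGm).comp
        (by fun_prop : Measurable fun s : ℝ => (ω, s))
    refine ⟨?_, fun s x y => ?_, ?_⟩
    · have hG' : MeasurableSet {q : ℝ × ℝ | (ω, q.1) ∈ G} :=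
        (by fun_prop : Measurable fun q : ℝ × ℝ => (ω, q.1)) hGm
      exact (hCm.comp (by fun_prop : Measurable fun q : ℝ × ℝ => (ω, q))).indicator hG'
    · by_cases hs : (ω, s) ∈ G
      · simp only [indicator_of_mem hs]
        have h := abs_sub_le_of_dyadicSum hβ hβ1 hp0 (hcont ω hs.1 s) hs.2
          (projIcc (0 : ℝ) 1 zero_le_one x).2 (projIcc (0 : ℝ) 1 zero_le_one y).2
        have e : ∀ z, C ω s (projIcc (0 : ℝ) 1 zero_le_one z) = C ω s z := fun z => by
          simp only [hC, clampRect, projIcc_val]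
        rw [e, e] at h
        refine h.trans (mul_le_mul_of_nonneg_left ?_ (mul_nonneg (chainConst_nonneg hβ)
          (by positivity)))
        refine Real.rpow_le_rpow (abs_nonneg _) ?_ hβ.le
        exact abs_projIcc_sub_projIcc zero_le_one
      · simp only [indicator_of_notMem hs]
        simp
    · rw [intervalIntegrable_iff_integrableOn_Icc_of_le hT]
      by_cases hω : ω ∈ N
      · have : ∀ s, (ω, s) ∉ G := fun s h => h.1 hω
        simp only [indicator_of_notMem (this _)]
        exact integrableOn_zero
      · have hQ : IntegrableOn (fun s => (dyadicSum β p (C ω s)).toReal) (Icc 0 T) :=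
          integrable_toReal_of_lintegral_ne_top
            (hQm.comp (by fun_prop : Measurable fun s : ℝ => (ω, s))).aemeasurable
            (hint ω hω).ne
        have h1 : IntegrableOn (fun s => chainConst β * (1 + (dyadicSum β p (C ω s)).toReal))
            (Icc 0 T) := ((integrable_const 1).add hQ).const_mul _
        refine h1.mono' hΛm.aestronglyMeasurable (ae_of_all _ fun s => ?_)
        have h0 : 0 ≤ chainConst β * (1 + (dyadicSum β p (C ω s)).toReal) :=
          mul_nonneg (chainConst_nonneg hβ) (by positivity)
        beta_reduce
        by_cases hs : (ω, s) ∈ G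
        · rw [indicator_of_mem hs, Real.norm_of_nonneg h0]
        · rw [indicator_of_notMem hs, norm_zero]
          exact h0
  · have hNae : ∀ᵐ ω ∂P, ω ∉ N := by
      rw [ae_iff]
      simpa using hNP
    filter_upwards [hNae] with ω hω
    have h1 := ae_lt_top (hQm.comp (by fun_prop : Measurable fun s : ℝ => (ω, s))) (hint ω hω).ne
    filter_upwards [h1, ae_restrict_mem measurableSet_Icc] with s hs hsT ξ hξ
    have hmem : (ω, s) ∈ G := ⟨hω, hs⟩
    rw [indicator_of_mem hmem]
    exact clampRect_of_mem hT _ hsT hξ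


/-! ### Norms and bounds -/

lemma normW_le_of_bddW {α C : ℝ} {f : ℝ → ℝ} (h : BddW α f C) :
    normW α f ≤ ENNReal.ofReal (2 * C) := by
  refine iSup₂_le fun ξ hξ => ?_
  rw [two_mul, ENNReal.ofReal_add h.nonneg h.nonneg]
  exact add_le_add (ENNReal.ofReal_le_ofReal (h.bound ξ hξ)) (h.lint ξ hξ)

lemma bddW_of_normW_le {α C : ℝ} (hC : 0 ≤ C) {f : ℝ → ℝ} (h : normW α f ≤ ENNReal.ofReal C) :
    BddW α f C := by
  have h' : ∀ ξ ∈ Icc (0 : ℝ) 1, ENNReal.ofReal |f ξ| +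
      ∫⁻ η in Ioo 0 ξ, ENNReal.ofReal (|f ξ - f η| / (ξ - η) ^ (α + 1)) ≤ ENNReal.ofReal C :=
    fun ξ hξ => (le_iSup₂ (f := fun ξ (_ : ξ ∈ Icc (0 : ℝ) 1) => ENNReal.ofReal |f ξ| +
      ∫⁻ η in Ioo 0 ξ, ENNReal.ofReal (|f ξ - f η| / (ξ - η) ^ (α + 1))) ξ hξ).trans h
  exact ⟨fun ξ hξ => (ENNReal.ofReal_le_ofReal_iff hC).1 (le_self_add.trans (h' ξ hξ)),
    fun ξ hξ => le_add_self.trans (h' ξ hξ)⟩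

lemma normCW_le {T α C : ℝ} {f : ℝ → ℝ → ℝ} (h : ∀ t ∈ Icc (0 : ℝ) T, BddW α (f t) C) :
    normCW T α f ≤ ENNReal.ofReal (2 * C) :=
  iSup₂_le fun t ht => normW_le_of_bddW (h t ht)

lemma MemCW.bddW {T α : ℝ} {f : ℝ → ℝ → ℝ} (h : MemCW T α f) :
    ∀ t ∈ Icc (0 : ℝ) T, BddW α (f t) (normCW T α f).toReal := fun t ht => by
  refine bddW_of_normW_le ENNReal.toReal_nonneg ?_
  rw [ENNReal.ofReal_toReal h.2.ne]
  exact le_iSup₂ (f := fun t (_ : t ∈ Icc (0 : ℝ) T) => normW α (f t)) t ht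

/-! ### Approximation by simple random fields -/

/-- Write an increment as its powers `1 - θ` and `θ`, bounding one by the supremum and the other by
the Hölder constant. Uniform smallness under a fixed Hölder bound becomes smallness in a weaker
Hölder norm. -/
lemma IsHolderUnit.interpolate {γ K δ θ : ℝ} {u : ℝ → ℝ} (h : IsHolderUnit γ K u)
    (hδ : ∀ ξ ∈ Icc (0 : ℝ) 1, |u ξ| ≤ δ) (h0 : 0 ≤ θ) (h1 : θ ≤ 1) :
    IsHolderUnit (γ * θ) ((2 * δ) ^ (1 - θ) * K ^ θ) u where
  zero := h.zero
  holder := fun ξ hξ η hη => by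
    have hx : |u ξ - u η| ≤ 2 * δ := by
      have := abs_sub (u ξ) (u η)
      linarith [hδ ξ hξ, hδ η hη]
    have e : |u ξ - u η| = |u ξ - u η| ^ (1 - θ) * |u ξ - u η| ^ θ := by
      rw [← Real.rpow_add_of_nonneg (abs_nonneg _) (by linarith) h0, sub_add_cancel, Real.rpow_one]
    rw [e, mul_assoc, Real.rpow_mul (abs_nonneg _),
      ← Real.mul_rpow h.nonneg (Real.rpow_nonneg (abs_nonneg _) _)]
    refine mul_le_mul (Real.rpow_le_rpow (abs_nonneg _) hx (by linarith))
      (Real.rpow_le_rpow (abs_nonneg _) (h.holder ξ hξ η hη) h0)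
      (Real.rpow_nonneg (abs_nonneg _) _) (Real.rpow_nonneg ((abs_nonneg _).trans hx) _)

lemma IsHolderUnit.sub {γ K L : ℝ} {u v : ℝ → ℝ} (hu : IsHolderUnit γ K u)
    (hv : IsHolderUnit γ L v) : IsHolderUnit γ (K + L) (fun ξ => u ξ - v ξ) where
  zero := by rw [hu.zero, hv.zero, sub_zero]
  holder := fun ξ hξ η hη => by
    rw [sub_sub_sub_comm, add_mul]
    exact (abs_sub _ _).trans (add_le_add (hu.holder ξ hξ η hη) (hv.holder ξ hξ η hη))

/-- The spatial Hölder seminorm of `D`, computed along a sequence of points. -/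
def seqHolder {T : ℝ} (γ : ℝ) (q : ℕ → Icc (0 : ℝ) T × Icc (0 : ℝ) 1 × Icc (0 : ℝ) 1)
    (D : ℝ → ℝ → ℝ) : ℝ≥0∞ :=
  ⨆ k, ENNReal.ofReal (|D (q k).1 (q k).2.1 - D (q k).1 (q k).2.2| /
    |((q k).2.1 : ℝ) - (q k).2.2| ^ γ)

section

variable {T γ K : ℝ} {q : ℕ → Icc (0 : ℝ) T × Icc (0 : ℝ) 1 × Icc (0 : ℝ) 1} {D : ℝ → ℝ → ℝ}

lemma seqHolder_le (h : ∀ t ∈ Icc (0 : ℝ) T, IsHolderUnit γ K (D t)) :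
    seqHolder γ q D ≤ ENNReal.ofReal K := by
  refine iSup_le fun k => ENNReal.ofReal_le_ofReal ?_
  have h' := h _ (q k).1.2
  exact div_le_of_le_mul₀ (Real.rpow_nonneg (abs_nonneg _) _) h'.nonneg
    (h'.holder _ (q k).2.1.2 _ (q k).2.2.2)

/-- For continuous `D` the Hölder inequality is a closed condition on `(t, ξ, η)`, so countably many
evaluations decide it; this is what makes the distance used below measurable in `ω`. -/
lemma isHolderUnit_of_seqHolder_le (hγ : 0 < γ) (hq : DenseRange q)
    (hD : ContinuousOn (Function.uncurry D) (Icc 0 T ×ˢ Icc 0 1))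
    (hD0 : ∀ t ∈ Icc (0 : ℝ) T, D t 0 = 0) (hK : 0 ≤ K)
    (h : seqHolder γ q D ≤ ENNReal.ofReal K) {t : ℝ} (ht : t ∈ Icc (0 : ℝ) T) :
    IsHolderUnit γ K (D t) where
  zero := hD0 t ht
  holder := fun ξ hξ η hη => by
    have hc : Continuous fun p : Icc (0 : ℝ) T × Icc (0 : ℝ) 1 => D p.1 p.2 :=
      hD.comp_continuous (f := fun p : Icc (0 : ℝ) T × Icc (0 : ℝ) 1 => ((p.1 : ℝ), (p.2 : ℝ)))
        (by fun_prop) fun p => ⟨p.1.2, p.2.2⟩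
    have h1 : Continuous fun p : Icc (0 : ℝ) T × Icc (0 : ℝ) 1 × Icc (0 : ℝ) 1 =>
        |D p.1 p.2.1 - D p.1 p.2.2| :=
      ((hc.comp (by fun_prop : Continuous fun p : Icc (0 : ℝ) T × Icc (0 : ℝ) 1 × Icc (0 : ℝ) 1 =>
        (p.1, p.2.1))).sub (hc.comp (by fun_prop : Continuous
          fun p : Icc (0 : ℝ) T × Icc (0 : ℝ) 1 × Icc (0 : ℝ) 1 => (p.1, p.2.2)))).abs
    have h2 : Continuous fun p : Icc (0 : ℝ) T × Icc (0 : ℝ) 1 × Icc (0 : ℝ) 1 =>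
        K * |(p.2.1 : ℝ) - p.2.2| ^ γ := by
      refine continuous_const.mul (Continuous.rpow_const (by fun_prop) fun _ => Or.inr hγ.le)
    refine hq.induction_on (p := fun p : Icc (0 : ℝ) T × Icc (0 : ℝ) 1 × Icc (0 : ℝ) 1 =>
      |D p.1 p.2.1 - D p.1 p.2.2| ≤ K * |(p.2.1 : ℝ) - p.2.2| ^ γ) (⟨t, ht⟩, ⟨ξ, hξ⟩, ⟨η, hη⟩)
      (isClosed_le h1 h2) fun k => ?_
    by_cases hk : ((q k).2.1 : ℝ) - (q k).2.2 = 0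
    · rw [sub_eq_zero] at hk
      rw [hk, sub_self, sub_self, abs_zero, Real.zero_rpow hγ.ne', mul_zero]
    · have h3 := (ENNReal.ofReal_le_ofReal_iff hK).1 ((le_iSup (fun k =>
        ENNReal.ofReal (|D (q k).1 (q k).2.1 - D (q k).1 (q k).2.2| /
          |((q k).2.1 : ℝ) - (q k).2.2| ^ γ)) k).trans h)
      rwa [div_le_iff₀ (Real.rpow_pos_of_pos (abs_pos.2 hk) _)] at h3

end

/-- The index of the first minimum among `c 0, …, c n`. -/
def argminUpTo (c : ℕ → ℝ≥0∞) : ℕ → ℕ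
  | 0 => 0
  | n + 1 => if c (n + 1) < c (argminUpTo c n) then n + 1 else argminUpTo c n

lemma argminUpTo_le (c : ℕ → ℝ≥0∞) (n : ℕ) : argminUpTo c n ≤ n := by
  induction n with
  | zero => exact le_rfl
  | succ n ih =>
    rw [argminUpTo]
    split_ifs <;> omega

lemma apply_argminUpTo_le (c : ℕ → ℝ≥0∞) {j n : ℕ} (h : j ≤ n) : c (argminUpTo c n) ≤ c j := by
  induction n with
  | zero =>
    obtain rfl : j = 0 := by omega
    exact le_rfl
  | succ n ih =>
    rw [argminUpTo]
    rcases Nat.le_succ_iff.1 h with h | rfl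
    · split_ifs with hc
      · exact hc.le.trans (ih h)
      · exact ih h
    · split_ifs with hc
      · exact le_rfl
      · exact not_lt.1 hc

lemma measurable_argminUpTo {Ω : Type*} [MeasurableSpace Ω] {c : ℕ → Ω → ℝ≥0∞}
    (hc : ∀ j, Measurable (c j)) (n : ℕ) : Measurable fun ω => argminUpTo (fun j => c j ω) n := by
  induction n with
  | zero => exact measurable_const
  | succ n ih =>
    have h1 : Measurable fun ω => c (argminUpTo (fun j => c j ω) n) ω :=
      (measurable_from_prod_countable_right (f := fun p : ℕ × Ω => c p.1 p.2) hc).comp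
        (ih.prodMk measurable_id)
    exact Measurable.ite (measurableSet_lt (hc (n + 1)) h1) measurable_const ih

/-- The space of Hölder functions is separable in a weaker Hölder norm. -/
lemma exists_dense_holder {T γ γ' : ℝ} (hT : 0 ≤ T) (hγ' : 0 < γ') (hγγ' : γ' < γ) :
    ∃ f : ℕ → ℝ → ℝ → ℝ, (∀ j, Continuous (Function.uncurry (f j)) ∧
        ∃ K, ∀ t ∈ Icc (0 : ℝ) T, IsHolderUnit γ K (f j t)) ∧
      ∀ (u : ℝ → ℝ → ℝ) (K : ℝ), ContinuousOn (Function.uncurry u) (Icc 0 T ×ˢ Icc 0 1) →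
        (∀ t ∈ Icc (0 : ℝ) T, IsHolderUnit γ K (u t)) → ∀ ε > 0, ∃ j, ∀ t ∈ Icc (0 : ℝ) T,
          IsHolderUnit γ' ε (fun ξ => f j t ξ - u t ξ) := by
  let ext : C(Icc (0 : ℝ) T × Icc (0 : ℝ) 1, ℝ) → ℝ → ℝ → ℝ := fun F t ξ =>
    F (projIcc 0 T hT t, projIcc 0 1 zero_le_one ξ)
  let X : ℕ → Set C(Icc (0 : ℝ) T × Icc (0 : ℝ) 1, ℝ) := fun m =>
    {F | ∀ t ∈ Icc (0 : ℝ) T, IsHolderUnit γ m (ext F t)}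
  -- The dense set is taken inside `X m`, so the approximants share the Hölder bound `m`, as
  -- interpolation requires.
  have hsep : ∀ m, ∃ D ⊆ X m, D.Countable ∧ X m ⊆ closure D := fun m =>
    (TopologicalSpace.IsSeparable.of_separableSpace (X m)).exists_countable_dense_subset
  choose D hDX hDc hD using hsep
  have hne : (⋃ m, D m).Nonempty := by
    have h0 : (0 : C(Icc (0 : ℝ) T × Icc (0 : ℝ) 1, ℝ)) ∈ X 0 := fun t _ =>
      ⟨rfl, fun ξ _ η _ => by simp [ext]⟩
    have h1 : (D 0).Nonempty := closure_nonempty_iff.1 ⟨_, hD 0 h0⟩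
    exact h1.mono (subset_iUnion D 0)
  obtain ⟨F, hF⟩ := (countable_iUnion hDc).exists_eq_range hne
  have hγ : 0 < γ := hγ'.trans hγγ'
  refine ⟨fun j => ext (F j), fun j => ⟨?_, ?_⟩, fun u K hu hK ε hε => ?_⟩
  · have h1 : Continuous (projIcc 0 T hT) := continuous_projIcc
    have h2 : Continuous (projIcc (0 : ℝ) 1 zero_le_one) := continuous_projIcc
    exact (F j).continuous.comp (by fun_prop : Continuous fun p : ℝ × ℝ =>
      (projIcc 0 T hT p.1, projIcc (0 : ℝ) 1 zero_le_one p.2))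
  · have : F j ∈ ⋃ m, D m := hF ▸ mem_range_self j
    obtain ⟨m, hm⟩ := mem_iUnion.1 this
    exact ⟨m, hDX m hm⟩
  · obtain ⟨m, hm⟩ := exists_nat_ge K
    let U : C(Icc (0 : ℝ) T × Icc (0 : ℝ) 1, ℝ) := ⟨fun p => u p.1 p.2,
      hu.comp_continuous (f := fun p : Icc (0 : ℝ) T × Icc (0 : ℝ) 1 => ((p.1 : ℝ), (p.2 : ℝ)))
        (by fun_prop) fun p => ⟨p.1.2, p.2.2⟩⟩
    have hext : ∀ t ∈ Icc (0 : ℝ) T, ∀ ξ ∈ Icc (0 : ℝ) 1, ext U t ξ = u t ξ := fun t ht ξ hξ => by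
      simp only [ext, projIcc_of_mem _ ht, projIcc_of_mem _ hξ]
      rfl
    have hu' : ∀ t ∈ Icc (0 : ℝ) T, IsHolderUnit γ m (u t) := fun t ht =>
      ⟨(hK t ht).zero, fun ξ hξ η hη => ((hK t ht).holder ξ hξ η hη).trans
        (mul_le_mul_of_nonneg_right hm (Real.rpow_nonneg (abs_nonneg _) _))⟩
    have hU : U ∈ X m := fun t ht => by
      refine ⟨?_, fun ξ hξ η hη => ?_⟩
      · rw [hext t ht 0 (by simp), (hK t ht).zero]
      · rw [hext t ht ξ hξ, hext t ht η hη]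
        exact (hu' t ht).holder ξ hξ η hη
    set θ := γ' / γ with hθ
    have hθ0 : 0 < θ := div_pos hγ' hγ
    have hθ1 : θ < 1 := (div_lt_one hγ).2 hγγ'
    have hlim : Tendsto (fun δ : ℝ => (2 * δ) ^ (1 - θ) * ((m : ℝ) + m) ^ θ) (𝓝[>] 0) (𝓝 0) := by
      have : ContinuousAt (fun δ : ℝ => (2 * δ) ^ (1 - θ) * ((m : ℝ) + m) ^ θ) 0 :=
        (ContinuousAt.rpow_const (by fun_prop) (Or.inr (by linarith))).mul continuousAt_const
      have h2 := this.tendsto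
      rw [mul_zero, Real.zero_rpow (by linarith), zero_mul] at h2
      exact h2.mono_left nhdsWithin_le_nhds
    obtain ⟨δ, hδε, hδ⟩ := ((hlim.eventually_lt_const hε).and self_mem_nhdsWithin).exists
    obtain ⟨V, hV, hUV⟩ := Metric.mem_closure_iff.1 (hD m hU) δ hδ
    have : V ∈ range F := hF ▸ mem_iUnion_of_mem m hV
    obtain ⟨j, rfl⟩ := this
    refine ⟨j, fun t ht => ?_⟩
    have h1 := (hDX m hV t ht).sub (hu' t ht)
    have h2 := h1.interpolate (δ := δ) (fun ξ hξ => ?_) hθ0.le hθ1.le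
    · rw [hθ, mul_div_cancel₀ _ hγ.ne', ← hθ] at h2
      exact ⟨h2.zero, fun ξ hξ η hη => (h2.holder ξ hξ η hη).trans
        (mul_le_mul_of_nonneg_right hδε.le (Real.rpow_nonneg (abs_nonneg _) _))⟩
    · rw [← hext t ht ξ hξ, ← Real.dist_eq, dist_comm]
      exact (ContinuousMap.dist_apply_le_dist _).trans hUV.le

/-- A measurable random field with Hölder continuous paths is a limit in `W^{α,∞}`, uniformly in
time, of simple random fields. -/
theorem exists_simple_approx {Ω : Type*} [MeasurableSpace Ω] {T α γ : ℝ} (hT : 0 ≤ T)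
    (hα : 0 < α) (hαγ : α < γ) (hγ : γ ≤ 1) {U : Ω → ℝ → ℝ → ℝ}
    (hUm : Measurable fun p : Ω × ℝ × ℝ => U p.1 p.2.1 p.2.2)
    (hUc : ∀ ω, ContinuousOn (Function.uncurry (U ω)) (Icc 0 T ×ˢ Icc 0 1))
    (hU : ∀ ω, ∃ K, ∀ t ∈ Icc (0 : ℝ) T, IsHolderUnit γ K (U ω t)) :
    ∃ (f : ℕ → ℝ → ℝ → ℝ) (J : ℕ → Ω → ℕ),
      (∀ j, Continuous (Function.uncurry (f j)) ∧
        ∃ K, ∀ t ∈ Icc (0 : ℝ) T, IsHolderUnit γ K (f j t)) ∧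
      (∀ n, Measurable (J n) ∧ ∀ ω, J n ω ≤ n) ∧
      ∀ ω, ∀ ε > 0, ∀ᶠ n in atTop, ∀ t ∈ Icc (0 : ℝ) T,
        BddW α (fun ξ => f (J n ω) t ξ - U ω t ξ) ε := by
  set γ' := (α + γ) / 2 with hγ'
  have h1 : α < γ' := by rw [hγ']; linarith
  have h2 : γ' < γ := by rw [hγ']; linarith
  have h0 : 0 < γ' := hα.trans h1
  obtain ⟨f, hf, hdense⟩ := exists_dense_holder (T := T) hT h0 h2
  have : Nonempty (Icc (0 : ℝ) T) := ⟨⟨0, le_rfl, hT⟩⟩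
  set q := TopologicalSpace.denseSeq (Icc (0 : ℝ) T × Icc (0 : ℝ) 1 × Icc (0 : ℝ) 1)
  have hq : DenseRange q := TopologicalSpace.denseRange_denseSeq _
  -- The `γ'`-Hölder distance from the path to the `j`-th candidate. Selecting its minimiser among
  -- the first `n` candidates depends measurably on `ω`.
  set c : ℕ → Ω → ℝ≥0∞ := fun j ω => seqHolder γ' q (fun t ξ => f j t ξ - U ω t ξ) with hc
  have hcm : ∀ j, Measurable (c j) := fun j => by
    refine Measurable.iSup fun k => ?_
    have hU' : ∀ t ξ, Measurable fun ω => U ω t ξ := fun t ξ =>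
      hUm.comp (by fun_prop : Measurable fun ω : Ω => (ω, t, ξ))
    have m1 := hU' (q k).1 (q k).2.1
    have m2 := hU' (q k).1 (q k).2.2
    fun_prop
  refine ⟨f, fun n ω => argminUpTo (fun j => c j ω) n, hf, fun n =>
    ⟨measurable_argminUpTo hcm n, fun ω => argminUpTo_le _ n⟩, fun ω ε hε => ?_⟩
  obtain ⟨K, hK⟩ := hU ω
  obtain ⟨j, hj⟩ := hdense (U ω) K (hUc ω) hK (ε * (γ' - α)) (by nlinarith)
  filter_upwards [eventually_ge_atTop j] with n hn t ht
  have h3 := (apply_argminUpTo_le (fun j => c j ω) hn).trans (seqHolder_le (q := q) hj)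
  have h4 : IsHolderUnit γ' (ε * (γ' - α))
      (fun ξ => f (argminUpTo (fun j => c j ω) n) t ξ - U ω t ξ) := by
    obtain ⟨hcont, L, hL⟩ := hf (argminUpTo (fun j => c j ω) n)
    refine isHolderUnit_of_seqHolder_le (T := T) h0 hq
      (D := fun t ξ => f (argminUpTo (fun j => c j ω) n) t ξ - U ω t ξ)
      (hcont.continuousOn.sub (hUc ω)) (fun s hs => ?_) (by nlinarith) h3 ht
    rw [(hL s hs).zero, (hK s hs).zero, sub_zero]
  have h5 := h4.bddW hα.le h1 (by linarith)
  rwa [mul_div_cancel_right₀ _ (by linarith)] at h5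


attribute [local irreducible] picardLim

/-! ### Locality of the generalized Stieltjes integral -/

lemma limR_congr {f h : ℝ → ℝ} {a b : ℝ} (hab : a < b) (hfh : ∀ x ∈ Ioo a b, f x = h x) :
    limR f a = limR h a := by
  have : f =ᶠ[𝓝[>] a] h := by
    filter_upwards [Ioo_mem_nhdsGT hab] with x hx using hfh x hx
  rw [limR, limR, limUnder, limUnder, map_congr this]

lemma limL_congr {f h : ℝ → ℝ} {a b : ℝ} (hab : a < b) (hfh : ∀ x ∈ Ioo a b, f x = h x) :
    limL f b = limL h b := by
  have : f =ᶠ[𝓝[<] b] h := by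
    filter_upwards [Ioo_mem_nhdsLT hab] with x hx using hfh x hx
  rw [limL, limL, limUnder, limUnder, map_congr this]

lemma centerLeft_congr {f h : ℝ → ℝ} {a b : ℝ} (hab : a < b) (hfh : ∀ x ∈ Ioo a b, f x = h x) :
    centerLeft a b f = centerLeft a b h := by
  rw [centerLeft, centerLeft, limR_congr hab hfh]
  exact indicator_congr fun x hx => by rw [hfh x hx]

lemma centerRight_congr {f h : ℝ → ℝ} {a b : ℝ} (hab : a < b) (hfh : ∀ x ∈ Ioo a b, f x = h x) :
    centerRight a b f = centerRight a b h := by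
  rw [centerRight, centerRight, limL_congr hab hfh]
  exact indicator_congr fun x hx => by rw [hfh x hx]

/-- Only values on the open interval matter: centring cuts off outside it, and the endpoint data are
one-sided limits. -/
lemma stieltjes_congr {α a b : ℝ} {f f' g g' : ℝ → ℝ} (hf : ∀ x ∈ Ioo a b, f x = f' x)
    (hg : ∀ x ∈ Ioo a b, g x = g' x) : stieltjes α f g a b = stieltjes α f' g' a b := by
  by_cases hab : a < b
  · rw [stieltjes, stieltjes, if_pos hab, if_pos hab, centerLeft_congr hab hf,
      centerRight_congr hab hg, limR_congr hab hf, limR_congr hab hg, limL_congr hab hg]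
  · rw [stieltjes, stieltjes, if_neg hab, if_neg hab]

lemma StieltjesIntegrable.congr {α a b : ℝ} {f f' g g' : ℝ → ℝ}
    (h : StieltjesIntegrable α f g a b) (hab : a < b) (hf : ∀ x ∈ Ioo a b, f x = f' x)
    (hg : ∀ x ∈ Ioo a b, g x = g' x) : StieltjesIntegrable α f' g' a b := by
  have e1 : f =ᶠ[𝓝[>] a] f' := by
    filter_upwards [Ioo_mem_nhdsGT hab] with x hx using hf x hx
  have e2 : g =ᶠ[𝓝[>] a] g' := by
    filter_upwards [Ioo_mem_nhdsGT hab] with x hx using hg x hx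
  have e3 : g =ᶠ[𝓝[<] b] g' := by
    filter_upwards [Ioo_mem_nhdsLT hab] with x hx using hg x hx
  obtain ⟨⟨l₁, h1⟩, ⟨l₂, h2⟩, ⟨l₃, h3⟩, h4⟩ := h
  rw [centerLeft_congr hab hf, centerRight_congr hab hg] at h4
  exact ⟨⟨l₁, h1.congr' e1⟩, ⟨l₂, h2.congr' e2⟩, ⟨l₃, h3.congr' e3⟩, h4⟩

/-! ### Solutions driven by a path which agrees with a driver at almost every time -/

section

variable {T α β M₁ M₂ : ℝ} {A : ℝ → ℝ} {g b : ℝ → ℝ → ℝ} {Λ : ℝ → ℝ}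

/-- Bridge from the driver `g` to the actual path `b`. One null set of times serves all `ξ`. -/
lemma ae_stieltjes_eq_innerInt (he : Exponents α β) (hA : Nonlinearity A M₁ M₂)
    (hg : Driver T β g Λ)
    (hb : ∀ᵐ s ∂(volume.restrict (Icc 0 T)), ∀ ξ ∈ Icc (0 : ℝ) 1, g s ξ = b s ξ)
    {y y' : ℝ → ℝ → ℝ} (hym : ∀ s, Measurable (y s)) {R : ℝ}
    (hy : ∀ s ∈ Icc (0 : ℝ) T, BddW α (y s) R)
    (hyy' : ∀ s ∈ Icc (0 : ℝ) T, ∀ ξ ∈ Icc (0 : ℝ) 1, y s ξ = y' s ξ) :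
    ∀ᵐ s ∂(volume.restrict (Icc 0 T)), ∀ ξ ∈ Icc (0 : ℝ) 1,
      innerInt (fun η => A (y s η)) (g s) ξ = stieltjes α (fun η => A (y' s η)) (b s) 0 ξ := by
  filter_upwards [hb, ae_restrict_mem measurableSet_Icc] with s hs hsT ξ hξ
  rw [(tendsto_innerInt (f := fun η => A (y s η)) he.pos he.lt_half he.lt he.le_one (hg.holder s)
    (hA.measurable.comp (hym s)) ((hy s hsT).comp hA.lip hA.pos.le hA.bdd) hξ).2]
  have hsub : ∀ x ∈ Ioo 0 ξ, x ∈ Icc (0 : ℝ) 1 := fun x hx => ⟨hx.1.le, hx.2.le.trans hξ.2⟩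
  exact stieltjes_congr (fun x hx => by rw [hyy' s hsT x (hsub x hx)]) fun x hx => hs x (hsub x hx)

lemma integral_congr_of_ae_Icc {f h : ℝ → ℝ} (hfh : ∀ᵐ s ∂(volume.restrict (Icc 0 T)), f s = h s)
    {t : ℝ} (ht : t ∈ Icc (0 : ℝ) T) : ∫ s in (0 : ℝ)..t, f s = ∫ s in (0 : ℝ)..t, h s := by
  refine intervalIntegral.integral_congr_ae ?_
  rw [uIoc_of_le ht.1]
  filter_upwards [(ae_restrict_iff' measurableSet_Icc).1 hfh] with s hs hst
  exact hs ⟨hst.1.le, hst.2.trans ht.2⟩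

lemma intervalIntegrable_congr_of_ae_Icc {f h : ℝ → ℝ} (hT : 0 ≤ T)
    (hfh : ∀ᵐ s ∂(volume.restrict (Icc 0 T)), f s = h s) :
    IntervalIntegrable f volume 0 T ↔ IntervalIntegrable h volume 0 T := by
  rw [intervalIntegrable_iff_integrableOn_Icc_of_le hT,
    intervalIntegrable_iff_integrableOn_Icc_of_le hT]
  exact integrable_congr hfh

variable {φ : ℝ → ℝ}

lemma isSolution_picardLim (he : Exponents α β) (hA : Nonlinearity A M₁ M₂)
    (hg : Driver T β g Λ) (hT : 0 ≤ T)
    (hb : ∀ᵐ s ∂(volume.restrict (Icc 0 T)), ∀ ξ ∈ Icc (0 : ℝ) 1, g s ξ = b s ξ)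
    (hφm : Measurable φ) {Rφ : ℝ} (hφ : BddW α φ Rφ) :
    IsSolution T α A φ b (picardLim φ A g) := by
  obtain ⟨R, hR, heq⟩ := picardLim_spec he hA hg hT hφm hφ
  have hm := measurable_uncurry_picardLim hφm hA.measurable hg.meas
  have hms : ∀ s, Measurable (picardLim φ A g s) := fun s => hm.of_uncurry_left
  have hst := ae_stieltjes_eq_innerInt he hA hg hb hms hR fun _ _ _ _ => rfl
  have hst' : ∀ ξ ∈ Icc (0 : ℝ) 1, ∀ᵐ s ∂(volume.restrict (Icc 0 T)),
      innerInt (fun η => A (picardLim φ A g s η)) (g s) ξ =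
        stieltjes α (fun η => A (picardLim φ A g s η)) (b s) 0 ξ := fun ξ hξ => by
    filter_upwards [hst] with s hs using hs ξ hξ
  refine ⟨?_, fun ξ hξ => ?_, fun t ht ξ hξ => ?_⟩
  · filter_upwards [hb, ae_restrict_mem measurableSet_Icc] with s hs hsT ξ hξ
    exact (stieltjesIntegrable_of_bddW (f := fun η => A (picardLim φ A g s η)) he.pos he.lt_half
      he.lt he.le_one
      (hA.measurable.comp (hms s)) ((hR s hsT).comp hA.lip hA.pos.le hA.bdd) (hg.holder s) le_rfl
      hξ.1 hξ.2).congr hξ.1 (fun _ _ => rfl) fun x hx => hs x ⟨hx.1.le, hx.2.le.trans hξ.2⟩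
  · exact (intervalIntegrable_congr_of_ae_Icc hT (hst' ξ hξ)).1
      (intervalIntegrable_innerInt he hA hg hT hm hR hξ)
  · rw [heq t ht ξ hξ, integral_congr_of_ae_Icc (hst' ξ hξ) ht]

lemma IsSolution.congr_initial {φ' : ℝ → ℝ} {y : ℝ → ℝ → ℝ} (h : IsSolution T α A φ b y)
    (hφ : ∀ ξ ∈ Icc (0 : ℝ) 1, φ ξ = φ' ξ) : IsSolution T α A φ' b y :=
  ⟨h.exists_inner, h.integrable, fun t ht ξ hξ => by rw [h.eqn t ht ξ hξ, hφ ξ hξ]⟩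

/-- A competitor is measurable only on the rectangle, so its clamped extension is compared with the
Picard limit, with the larger of the two norm bounds as radius. -/
lemma IsSolution.eq_picardLim (he : Exponents α β) (hA : Nonlinearity A M₁ M₂)
    (hg : Driver T β g Λ) (hT : 0 ≤ T)
    (hb : ∀ᵐ s ∂(volume.restrict (Icc 0 T)), ∀ ξ ∈ Icc (0 : ℝ) 1, g s ξ = b s ξ)
    (hφm : Measurable φ) {Rφ : ℝ} (hφ : BddW α φ Rφ) {z : ℝ → ℝ → ℝ} (hz : MemCW T α z)
    (hsol : IsSolution T α A φ b z) :
    ∀ t ∈ Icc (0 : ℝ) T, ∀ ξ ∈ Icc (0 : ℝ) 1, z t ξ = picardLim φ A g t ξ := by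
  obtain ⟨R, hR, heq⟩ := picardLim_spec he hA hg hT hφm hφ
  have hm := measurable_uncurry_picardLim hφm hA.measurable hg.meas
  have hzm := measurable_uncurry_clampRect hT hz.1
  have hzms : ∀ s, Measurable (clampRect hT z s) := fun s => hzm.of_uncurry_left
  have hzR : ∀ s ∈ Icc (0 : ℝ) T, BddW α (clampRect hT z s) (normCW T α z).toReal := fun s hs =>
    (hz.bddW s hs).congr fun ξ hξ => (clampRect_of_mem hT z hs hξ).symm
  have hst := ae_stieltjes_eq_innerInt he hA hg hb hzms hzR
    fun s hs ξ hξ => clampRect_of_mem hT z hs hξ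
  intro t ht ξ hξ
  rw [← clampRect_of_mem hT z ht hξ]
  refine eq_of_solutions he hA hg hzms (fun s => hm.of_uncurry_left) (φ := φ)
    (R := max (normCW T α z).toReal R) (fun s hs => (hzR s hs).mono (le_max_left _ _))
    (fun s hs => (hR s hs).mono (le_max_right _ _))
    (fun ξ hξ => intervalIntegrable_innerInt he hA hg hT hzm hzR hξ)
    (fun ξ hξ => intervalIntegrable_innerInt he hA hg hT hm hR hξ) (fun t ht ξ hξ => ?_) heq t ht ξ hξ
  rw [clampRect_of_mem hT z ht hξ, hsol.eqn t ht ξ hξ]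
  refine congrArg _ (integral_congr_of_ae_Icc ?_ ht).symm
  filter_upwards [hst] with s hs using hs ξ hξ

/-- Lebesgue differentiation of the integrated equation. The null endpoints are dropped since the
equation holds only on one side of them. -/
lemma IsSolution.ae_hasDerivAt {y : ℝ → ℝ → ℝ} (hT : 0 ≤ T) (h : IsSolution T α A φ b y) {ξ : ℝ}
    (hξ : ξ ∈ Icc (0 : ℝ) 1) :
    ∀ᵐ t ∂(volume.restrict (Icc 0 T)), HasDerivAt (fun τ => y τ ξ)
      (stieltjes α (fun η => A (y t η)) (b t) 0 ξ) t := by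
  rw [← restrict_Ioo_eq_restrict_Icc, ae_restrict_iff' measurableSet_Ioo]
  filter_upwards [_root_.IntervalIntegrable.ae_hasDerivAt_integral (h.integrable ξ hξ)]
    with t ht htT
  rw [uIcc_of_le hT] at ht
  refine ((ht ⟨htT.1.le, htT.2.le⟩ 0 ⟨le_rfl, hT⟩).const_add (φ ξ)).congr_of_eventuallyEq ?_
  filter_upwards [Icc_mem_nhds htT.1 htT.2] with τ hτ using h.eqn τ hτ ξ hξ

/-- Increments in time of the solution. -/
lemma isHolderUnit_picardLim_sub (he : Exponents α β) (hA : Nonlinearity A M₁ M₂)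
    (hg : Driver T β g Λ) (hT : 0 ≤ T) (hφm : Measurable φ) {Rφ : ℝ} (hφ : BddW α φ Rφ) :
    ∃ κ, ∀ t ∈ Icc (0 : ℝ) T, ∀ t₀ ∈ Icc (0 : ℝ) T,
      IsHolderUnit (1 - α) (κ * |(∫ s in (0 : ℝ)..t, Λ s) - ∫ s in (0 : ℝ)..t₀, Λ s|)
        (fun ξ => picardLim φ A g t ξ - picardLim φ A g t₀ ξ) := by
  obtain ⟨R, hR, heq⟩ := picardLim_spec he hA hg hT hφm hφ
  have hm := measurable_uncurry_picardLim hφm hA.measurable hg.meas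
  have hi : ∀ {f : ℝ → ℝ}, IntervalIntegrable f volume 0 T → ∀ t ∈ Icc (0 : ℝ) T,
      IntervalIntegrable f volume 0 t := fun hf t ht => intervalIntegrable_mono hf le_rfl ht.1 ht.2
  refine ⟨stieltjesConst α β * (M₂ + M₁ * R), ?_⟩
  have key : ∀ t ∈ Icc (0 : ℝ) T, ∀ t₀ ∈ Icc (0 : ℝ) T, t₀ ≤ t →
      IsHolderUnit (1 - α) (stieltjesConst α β * (M₂ + M₁ * R) *
        |(∫ s in (0 : ℝ)..t, Λ s) - ∫ s in (0 : ℝ)..t₀, Λ s|)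
        (fun ξ => picardLim φ A g t ξ - picardLim φ A g t₀ ξ) := by
    intro t ht t₀ ht₀ htt
    have h := isHolderUnit_timeIntegral he hA hg hm (R := R) (l := 0) le_rfl
      (by simpa using hR) ht₀.1 htt ht.2
    have e : ∀ ξ ∈ Icc (0 : ℝ) 1, picardLim φ A g t ξ - picardLim φ A g t₀ ξ =
        ∫ s in t₀..t, innerInt (fun η => A (picardLim φ A g s η)) (g s) ξ := fun ξ hξ => by
      have hI := intervalIntegrable_innerInt he hA hg hT hm hR hξ
      rw [heq t ht ξ hξ, heq t₀ ht₀ ξ hξ, add_sub_add_left_eq_sub,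
        intervalIntegral.integral_interval_sub_left (hi hI t ht) (hi hI t₀ ht₀)]
    rw [intervalIntegral.integral_interval_sub_left (hi hg.int t ht) (hi hg.int t₀ ht₀),
      abs_of_nonneg (intervalIntegral.integral_nonneg htt fun s _ => hg.nonneg s)]
    simp only [zero_mul, Real.exp_zero, mul_one] at h
    refine ⟨?_, fun ξ hξ η hη => ?_⟩
    · rw [e 0 (by simp)]
      exact h.zero
    · rw [e ξ hξ, e η hη]
      exact h.holder ξ hξ η hη
  intro t ht t₀ ht₀
  rcases le_total t₀ t with h | h
  · exact key t ht t₀ ht₀ h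
  · have h' := key t₀ ht₀ t ht h
    refine ⟨?_, fun ξ hξ η hη => ?_⟩
    · rw [← neg_sub, h'.zero, neg_zero]
    · rw [abs_sub_comm (∫ s in (0 : ℝ)..t, Λ s)]
      refine (le_of_eq ?_).trans (h'.holder ξ hξ η hη)
      rw [← abs_neg]
      congr 1
      ring

lemma Driver.continuousOn_primitive (hg : Driver T β g Λ) (hT : 0 ≤ T) :
    ContinuousOn (fun t => ∫ s in (0 : ℝ)..t, Λ s) (Icc 0 T) := by
  have := intervalIntegral.continuousOn_primitive_interval' hg.int left_mem_uIcc
  rwa [uIcc_of_le hT] at this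

lemma continuousInW_picardLim (he : Exponents α β) (hA : Nonlinearity A M₁ M₂)
    (hg : Driver T β g Λ) (hT : 0 ≤ T) (hφm : Measurable φ) {Rφ : ℝ} (hφ : BddW α φ Rφ) :
    ContinuousInW T α (picardLim φ A g) := by
  obtain ⟨κ, hκ⟩ := isHolderUnit_picardLim_sub he hA hg hT hφm hφ
  intro t ht
  have hc := (hg.continuousOn_primitive hT) t ht
  have h1 : Tendsto (fun s => ENNReal.ofReal (2 * (κ * |(∫ r in (0 : ℝ)..s, Λ r) -
      ∫ r in (0 : ℝ)..t, Λ r| / (1 - α - α)))) (𝓝[Icc 0 T] t) (𝓝 0) := by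
    have := ENNReal.tendsto_ofReal
      ((((hc.tendsto.sub_const (∫ r in (0 : ℝ)..t, Λ r)).abs.const_mul κ).div_const
        (1 - α - α)).const_mul 2)
    simpa using this
  refine tendsto_of_tendsto_of_tendsto_of_le_of_le' tendsto_const_nhds h1
    (Eventually.of_forall fun _ => zero_le) ?_
  filter_upwards [self_mem_nhdsWithin] with s hs
  exact normW_le_of_bddW ((hκ s hs t ht).bddW he.pos.le (by linarith [he.lt_half])
    (by linarith [he.pos]))

/-- The initial value is subtracted because no Hölder continuity of `φ` is available. Time
increments are controlled by the primitive of `Λ`, space increments by the exponent `1 - α`. -/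
lemma continuousOn_picardLim_sub (he : Exponents α β) (hA : Nonlinearity A M₁ M₂)
    (hg : Driver T β g Λ) (hT : 0 ≤ T) (hφm : Measurable φ) {Rφ : ℝ} (hφ : BddW α φ Rφ) :
    ContinuousOn (Function.uncurry fun t ξ => picardLim φ A g t ξ - picardLim φ A g 0 ξ)
      (Icc 0 T ×ˢ Icc 0 1) := by
  obtain ⟨κ, hκ⟩ := isHolderUnit_picardLim_sub he hA hg hT hφm hφ
  have hα := he.lt_half
  rintro ⟨t₀, ξ₀⟩ ⟨ht₀, hξ₀⟩
  set F : ℝ → ℝ := fun t => ∫ s in (0 : ℝ)..t, Λ s with hF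
  have hc : ContinuousWithinAt (fun p : ℝ × ℝ => F p.1) (Icc 0 T ×ˢ Icc 0 1) (t₀, ξ₀) :=
    ContinuousWithinAt.comp (f := Prod.fst) (s := Icc 0 T ×ˢ Icc 0 1) (x := (t₀, ξ₀)) (t := Icc 0 T)
      (hg.continuousOn_primitive hT t₀ ht₀) continuousWithinAt_fst fun p hp => hp.1
  have h1 : ContinuousWithinAt (fun p : ℝ × ℝ => κ * |F p.1 - F t₀| +
      κ * |F t₀ - F 0| * |p.2 - ξ₀| ^ (1 - α)) (Icc 0 T ×ˢ Icc 0 1) (t₀, ξ₀) := by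
    refine (continuousWithinAt_const.mul (hc.sub continuousWithinAt_const).abs).add
      (continuousWithinAt_const.mul (ContinuousWithinAt.rpow_const ?_ (Or.inr (by linarith))))
    exact ((continuousWithinAt_snd).sub continuousWithinAt_const).abs
  have h2 := h1.tendsto
  simp only [sub_self, abs_zero, mul_zero, zero_add,
    Real.zero_rpow (show 1 - α ≠ 0 by linarith)] at h2
  rw [ContinuousWithinAt, tendsto_iff_dist_tendsto_zero]
  refine tendsto_of_tendsto_of_tendsto_of_le_of_le' tendsto_const_nhds h2
    (Eventually.of_forall fun _ => dist_nonneg) ?_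
  filter_upwards [self_mem_nhdsWithin] with p hp
  have h3 := (hκ p.1 hp.1 t₀ ht₀).abs_le (by linarith) hp.2
  have h4 := (hκ t₀ ht₀ 0 ⟨le_rfl, hT⟩).holder p.2 hp.2 ξ₀ hξ₀
  rw [Real.dist_eq]
  refine le_trans (le_of_eq ?_) ((abs_add_le _ _).trans (add_le_add h3 h4))
  congr 1
  simp only [Function.uncurry]
  ring

end

/-- The random solution belongs to `L⁰`. -/
lemma memL0_picardLim {Ω : Type*} [MeasurableSpace Ω] {P : Measure Ω} {T α β M₁ M₂ : ℝ}
    {A φ : ℝ → ℝ} {g : Ω → ℝ → ℝ → ℝ} {Λ : Ω → ℝ → ℝ} (he : Exponents α β)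
    (hA : Nonlinearity A M₁ M₂) (hgm : Measurable fun p : Ω × ℝ × ℝ => g p.1 p.2.1 p.2.2)
    (hg : ∀ ω, Driver T β (g ω) (Λ ω)) (hT : 0 ≤ T) (hφm : Measurable φ) {Rφ : ℝ}
    (hφ : BddW α φ Rφ) : MemL0 T α (fun ω => picardLim φ A (g ω)) P := by
  have hα := he.lt_half
  have hα0 := he.pos
  have hm := measurable_picardLim hφm hA.measurable hgm
  have hm0 : Measurable fun p : Ω × ℝ × ℝ => picardLim φ A (g p.1) 0 p.2.2 :=
    hm.comp (by fun_prop : Measurable fun p : Ω × ℝ × ℝ => (p.1, (0 : ℝ), p.2.2))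
  refine ⟨?_, ae_of_all _ fun ω => ⟨?_, ?_⟩, ?_⟩
  · exact hm.comp (by fun_prop : Measurable fun p : Ω × Icc (0 : ℝ) T × Icc (0 : ℝ) 1 =>
      (p.1, (p.2.1 : ℝ), (p.2.2 : ℝ)))
  · exact hm.comp (by fun_prop : Measurable fun p : Icc (0 : ℝ) T × Icc (0 : ℝ) 1 =>
      (ω, (p.1 : ℝ), (p.2 : ℝ)))
  · obtain ⟨R, hR, -⟩ := picardLim_spec he hA (hg ω) hT hφm hφ
    exact (normCW_le hR).trans_lt ENNReal.ofReal_lt_top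
  · obtain ⟨f, J, hf, hJ, hlim⟩ := exists_simple_approx (T := T) (α := α) (γ := 1 - α) hT hα0
      (by linarith) (by linarith)
      (U := fun ω t ξ => picardLim φ A (g ω) t ξ - picardLim φ A (g ω) 0 ξ) (hm.sub hm0)
      (fun ω => continuousOn_picardLim_sub he hA (hg ω) hT hφm hφ) (fun ω => by
        obtain ⟨κ, hκ⟩ := isHolderUnit_picardLim_sub he hA (hg ω) hT hφm hφ
        obtain ⟨C, hC⟩ := isCompact_Icc.exists_bound_of_continuousOn
          ((hg ω).continuousOn_primitive hT)
        refine ⟨|κ| * C, fun t ht => ?_⟩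
        have h := hκ t ht 0 ⟨le_rfl, hT⟩
        refine ⟨h.zero, fun ξ hξ η hη => (h.holder ξ hξ η hη).trans ?_⟩
        refine mul_le_mul_of_nonneg_right ?_ (Real.rpow_nonneg (abs_nonneg _) _)
        rw [intervalIntegral.integral_same, sub_zero]
        exact mul_le_mul (le_abs_self κ) (hC t ht) (abs_nonneg _) (abs_nonneg _))
    -- Finitely many values because `J n ω ≤ n`; every preimage is measurable because it is the
    -- preimage under `J n` of a set of natural numbers.
    refine ⟨fun n ω t ξ => φ ξ + f (J n ω) t ξ, fun n => ⟨?_, fun F => ?_, fun ω => ⟨?_, ?_⟩⟩,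
      ae_of_all _ fun ω => ?_⟩
    · refine ((finite_Iic n).image fun j => fun t ξ => φ ξ + f j t ξ).subset ?_
      rintro _ ⟨ω, rfl⟩
      exact ⟨J n ω, (hJ n).2 ω, rfl⟩
    · exact (hJ n).1 (t := {j | (fun t ξ => φ ξ + f j t ξ) = F}) trivial
    · have h1 := (hf (J n ω)).1.measurable
      exact (hφm.comp (by fun_prop)).add (h1.comp (by fun_prop :
        Measurable fun p : Icc (0 : ℝ) T × Icc (0 : ℝ) 1 => ((p.1 : ℝ), (p.2 : ℝ))))
    · obtain ⟨K, hK⟩ := (hf (J n ω)).2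
      exact (normCW_le fun t ht => hφ.add ((hK t ht).bddW hα0.le (by linarith) (by linarith))
        hφm).trans_lt ENNReal.ofReal_lt_top
    · obtain ⟨R, hR, heq⟩ := picardLim_spec he hA (hg ω) hT hφm hφ
      rw [ENNReal.tendsto_nhds_zero]
      intro ε hε
      rcases eq_or_ne ε ⊤ with rfl | hε'
      · exact Eventually.of_forall fun _ => le_top
      have hεp : 0 < ε.toReal := ENNReal.toReal_pos hε.ne' hε'
      filter_upwards [hlim ω (ε.toReal / 2) (by linarith)] with n hn
      refine (normCW_le fun t ht => (hn t ht).congr fun ξ hξ => ?_).trans (le_of_eq ?_)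
      · have h0 := heq 0 ⟨le_rfl, hT⟩ ξ hξ
        rw [intervalIntegral.integral_same, add_zero] at h0
        rw [h0]
        ring
      · rw [mul_div_cancel₀ _ (by norm_num), ENNReal.ofReal_toReal hε']

end FracEq

end

/-! ### Assembly of the theorem -/

theorem theorem5p1 {Ω : Type*} [MeasurableSpace Ω] (P : Measure Ω) [IsProbabilityMeasure P]
    (H α T : ℝ) (hH : 1 / 2 < H) (hH1 : H < 1) (hα : 1 - H < α) (hα' : α < 1 / 2) (hT : 0 < T)
    (B : Ω → ℝ → ℝ → ℝ) (hB : FracEq.IsFBMField T H B P)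
    (φ : ℝ → ℝ) (hφ : FracEq.MemW α φ)
    (A : ℝ → ℝ) (hA1 : Differentiable ℝ A)
    (hA2 : ∃ M₁ > 0, ∀ x y : ℝ, |A x - A y| ≤ M₁ * |x - y|)
    (hA3 : ∃ M₂ > 0, ∀ x : ℝ, |A x| ≤ M₂)
    (hA4 : ∀ N : ℝ, ∃ M > 0, ∀ x y : ℝ, |x| ≤ N → |y| ≤ N →
      |deriv A x - deriv A y| ≤ M * |x - y|) :
    ∃ Y : Ω → ℝ → ℝ → ℝ, FracEq.MemL0 T α Y P ∧
      (∀ᵐ ω ∂P, FracEq.ContinuousInW T α (Y ω)) ∧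
      (∀ᵐ ω ∂P, FracEq.IsSolution T α A φ (B ω) (Y ω)) ∧
      (∀ᵐ ω ∂P, ∀ ξ ∈ Icc (0 : ℝ) 1, ∀ᵐ t ∂(volume.restrict (Icc 0 T)),
        HasDerivAt (fun τ => Y ω τ ξ)
          (FracEq.stieltjes α (fun η => A (Y ω t η)) (B ω t) 0 ξ) t) ∧
      ∀ Z : Ω → ℝ → ℝ → ℝ, (∀ᵐ ω ∂P, FracEq.MemCW T α (Z ω)) →
        (∀ᵐ ω ∂P, FracEq.IsSolution T α A φ (B ω) (Z ω)) →
        ∀ᵐ ω ∂P, ∀ t ∈ Icc (0 : ℝ) T, ∀ ξ ∈ Icc (0 : ℝ) 1, Z ω t ξ = Y ω t ξ := by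
  obtain ⟨M₁, hM₁, hA2⟩ := hA2
  obtain ⟨M₂, -, hA3⟩ := hA3
  have hA : FracEq.Nonlinearity A M₁ M₂ := ⟨hA1, hM₁, hA2, hA3, hA4⟩
  -- The midpoint of `1 - α` and `H`, an interval that is nonempty because `1 - H < α`: large enough
  -- for the integral to exist, small enough for the paths to be `β`-Hölder.
  set β := (1 - α + H) / 2 with hβ
  have he : FracEq.Exponents α β :=
    ⟨by linarith, hα', by rw [hβ]; linarith, by rw [hβ]; linarith⟩
  obtain ⟨g, Λ, hgm, hg, hgB⟩ := hB.exists_driver (β := β) hT.le (by linarith [he.lt])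
    (by rw [hβ]; linarith) he.le_one
  -- `φ` is measurable only on `[0,1]`; its constant extension is measurable on the line.
  set ψ : ℝ → ℝ := fun ξ => φ (projIcc (0 : ℝ) 1 zero_le_one ξ) with hψ
  have hψm : Measurable ψ := hφ.1.comp continuous_projIcc.measurable
  have hψφ : ∀ ξ ∈ Icc (0 : ℝ) 1, ψ ξ = φ ξ := fun ξ hξ => by
    rw [hψ]
    simp only [projIcc_of_mem _ hξ]
  have hψW : FracEq.BddW α ψ (FracEq.normW α φ).toReal := by
    refine (FracEq.bddW_of_normW_le ENNReal.toReal_nonneg ?_).congr fun ξ hξ => (hψφ ξ hξ).symm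
    rw [ENNReal.ofReal_toReal hφ.2.ne]
  have hsol : ∀ᵐ ω ∂P, FracEq.IsSolution T α A φ (B ω) (FracEq.picardLim ψ A (g ω)) := by
    filter_upwards [hgB] with ω hω
    exact (FracEq.isSolution_picardLim he hA (hg ω) hT.le hω hψm hψW).congr_initial hψφ
  refine ⟨fun ω => FracEq.picardLim ψ A (g ω),
    FracEq.memL0_picardLim he hA hgm hg hT.le hψm hψW, ae_of_all _ fun ω =>
      FracEq.continuousInW_picardLim he hA (hg ω) hT.le hψm hψW, hsol, ?_, fun Z hZ hZsol => ?_⟩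
  · filter_upwards [hsol] with ω hω ξ hξ using hω.ae_hasDerivAt hT.le hξ
  · filter_upwards [hgB, hZ, hZsol] with ω h1 h2 h3
    exact (h3.congr_initial fun ξ hξ => (hψφ ξ hξ).symm).eq_picardLim he hA (hg ω) hT.le h1 hψm
      hψW h2
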